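/- All Lie superalgebras are over $\mathbb{C}$, and a $\mathbb{Z}$-grading $\mathfrak g=\bigoplus_j\mathfrak g_j$ is consistent if $\mathfrak g_j$ has parity $j \bmod 2$. An anti-linear graded conjugation of a consistently $\mathbb{Z}$-graded Lie superalgebra $\mathfrak g$ is an anti-linear Lie superalgebra automorphism $\varphi$ of $\mathfrak g$ with $\varphi(\mathfrak g_j)=\mathfrak g_{-j}$ and $\varphi^2(x)=(-1)^k x$ for $x\in\mathfrak g_k$. Two of them, $\sigma_1,\sigma_2$, are equivalent if $\sigma_2=\varphi\sigma_1\varphi^{-1}$ for some grading-preserving (linear) automorphism $\varphi$ of $\mathfrak g$. For $m,n\ge 1$ let $sl(m,n)$ be the Lie superalgebra of complex matrices $\begin{pmatrix}a&b\\c&d\end{pmatrix}$, with $a$ of size $m\times m$, $d$ of size $n\times n$ and $\operatorname{tr}a=\operatorname{tr}d$, under the supercommutator, and let $psl(m,n)$ be its quotient by the scalar matrices that it contains (so $psl(m,n)=sl(m,n)$ if $m\ne n$). It is graded by $\mathfrak g_{-1}=\{c\}$, $\mathfrak g_0=\{(a,d)\}$, $\mathfrak g_1=\{b\}$. For $n\ge1$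 let $J=\begin{pmatrix}0&I_n\\-I_n&0\end{pmatrix}$, $Q=\begin{pmatrix}0&1\\1&0\end{pmatrix}$, and let $osp(2,2n)$ be the Lie superalgebra of complex matrices $\begin{pmatrix}a&b\\c&d\end{pmatrix}$, with $a$ of size $2\times2$ and $d$ of size $2n\times 2n$, such that $a^tQ+Qa=0$, $d^tJ+Jd=0$ and $c=Jb^tQ$. It is graded by giving the matrix unit $E_{ij}$ the degree $w_i-w_j$, where $w=(1,-1,0,\dots,0)$. Let $\tilde\sigma_1\begin{pmatrix}a&b\\c&d\end{pmatrix}=\begin{pmatrix}-\bar a^t&\bar c^t\\-\bar b^t&-\bar d^t\end{pmatrix}$, $\tau_\pm\begin{pmatrix}a&b\\c&d\end{pmatrix}=\begin{pmatrix}\bar d&\pm i\bar c\\\mp i\bar b&\bar a\end{pmatrix}$, $\operatorname{Ad}g\,(X)=gXg^{-1}$, $S^n_p=\operatorname{diag}(I_p,-I_{n-p})$ and $H^{2n}_p=\operatorname{diag}(S^n_p,S^n_p)$. The following are complete lists, up to equivalence, of the anti-linear graded conjugations of these graded Lie superalgebras; that is, every map listed is an anti-linear graded conjugation, and every anti-linear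 graded conjugation is equivalent to at least one map listed (maps listed separately may be equivalent to each other). (a) For $psl(m,n)$ with $m,n\ge1$, $m\neq n$: $\operatorname{Ad}\operatorname{diag}(S^m_p,S^n_q)\circ\tilde\sigma_1$ for $p=0,\dots,m$ and $q=0,\dots,n$. (b) For $psl(n,n)$ with $n\ge1$: $\operatorname{Ad}\operatorname{diag}(S^n_p,S^n_q)\circ\tilde\sigma_1$ for $p,q=0,\dots,n$, together with $\tau_+$ and $\tau_-$. (c) For $osp(2,2n)$ with $n\ge1$: $\operatorname{Ad}\operatorname{diag}(\pm A,H)\circ\tilde\sigma_1$, where either $A=I_2$ and $H=H^{2n}_p$ for some $p=0,\dots,n$, or $A=\operatorname{diag}(i,-i)$ and $H=iS^{2n}_n$. -/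

import Mathlib

noncomputable section

/-- A complex Lie superalgebra with a consistent `ℤ`-grading: a superspace `part 0 ⊕ part 1` with an
even bilinear super-skew-symmetric bracket satisfying the super Jacobi identity, together with a
decomposition `⨁ j, deg j` compatible with the bracket, in which `deg j` has parity `j mod 2`. -/
structure GradedLieSuperalgebra (L : Type*) [AddCommGroup L] [Module ℂ L] where
  part : ZMod 2 → Submodule ℂ L
  part_isInternal : DirectSum.IsInternal part
  bracket : L →ₗ[ℂ] L →ₗ[ℂ] L
  bracket_mem_part : ∀ i j x y, x ∈ part i → y ∈ part j → bracket x y ∈ part (i + j)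
  bracket_skew : ∀ i j x y, x ∈ part i → y ∈ part j →
    bracket x y = -((-1 : ℂ) ^ (i.val * j.val) • bracket y x)
  bracket_jacobi : ∀ i j x y z, x ∈ part i → y ∈ part j →
    bracket x (bracket y z) =
      bracket (bracket x y) z + (-1 : ℂ) ^ (i.val * j.val) • bracket y (bracket x z)
  deg : ℤ → Submodule ℂ L
  deg_isInternal : DirectSum.IsInternal deg
  bracket_mem_deg : ∀ i j x y, x ∈ deg i → y ∈ deg j → bracket x y ∈ deg (i + j)
  deg_le_part : ∀ j : ℤ, deg j ≤ part (j : ZMod 2)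

namespace GradedLieSuperalgebra

variable {L : Type*} [AddCommGroup L] [Module ℂ L]

/-- An anti-linear automorphism `φ` of the Lie superalgebra with `φ (𝔤_j) = 𝔤_{-j}` and
`φ² = (-1)^k` on `𝔤_k`. -/
structure IsAntilinearGradedConjugation (G : GradedLieSuperalgebra L)
    (φ : L →ₛₗ[starRingEnd ℂ] L) : Prop where
  bijective : Function.Bijective φ
  map_bracket : ∀ x y, φ (G.bracket x y) = G.bracket (φ x) (φ y)
  map_part : ∀ i, (G.part i).map φ = G.part i
  map_deg : ∀ j, (G.deg j).map φ = G.deg (-j)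
  sq : ∀ k x, x ∈ G.deg k → φ (φ x) = (-1 : ℂ) ^ k • x

/-- A (linear) automorphism of the Lie superalgebra which preserves the `ℤ`-grading. -/
structure IsGradedAutomorphism (G : GradedLieSuperalgebra L) (φ : L ≃ₗ[ℂ] L) : Prop where
  map_bracket : ∀ x y, φ (G.bracket x y) = G.bracket (φ x) (φ y)
  map_part : ∀ i, (G.part i).map (φ : L →ₗ[ℂ] L) = G.part i
  map_deg : ∀ j, (G.deg j).map (φ : L →ₗ[ℂ] L) = G.deg j

/-- `σ₂ = φ σ₁ φ⁻¹` for some grading-preserving automorphism `φ`. -/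
def Equivalent (G : GradedLieSuperalgebra L) (σ₁ σ₂ : L →ₛₗ[starRingEnd ℂ] L) : Prop :=
  ∃ φ : L ≃ₗ[ℂ] L, G.IsGradedAutomorphism φ ∧ ∀ x, σ₂ x = φ (σ₁ (φ.symm x))

/-- `S` is a complete list, up to equivalence, of the anti-linear graded conjugations: all
members of `S` are such conjugations and each such conjugation is equivalent to a member of `S`. -/
def IsCompleteListOfConjugations (G : GradedLieSuperalgebra L)
    (S : Set (L →ₛₗ[starRingEnd ℂ] L)) : Prop :=
  (∀ σ ∈ S, G.IsAntilinearGradedConjugation σ) ∧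
    ∀ σ, G.IsAntilinearGradedConjugation σ → ∃ σ' ∈ S, G.Equivalent σ σ'

theorem isInternal_comap {ι : Type*} [DecidableEq ι] {A : ι → Submodule ℂ L}
    (h : DirectSum.IsInternal A) (M : Submodule ℂ L) (hM : M ≤ ⨆ i, M ⊓ A i) :
    DirectSum.IsInternal fun i => (A i).comap M.subtype := by
  rw [DirectSum.isInternal_submodule_iff_iSupIndep_and_iSup_eq_top] at h ⊢
  refine ⟨fun i => ?_, ?_⟩
  · rw [Submodule.disjoint_def]
    intro x hx hx'
    have h1 : (⨆ j, ⨆ (_ : j ≠ i), (A j).comap M.subtype) ≤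
        (⨆ j, ⨆ (_ : j ≠ i), A j).comap M.subtype :=
      iSup₂_le fun j hj => Submodule.comap_mono (le_iSup₂_of_le j hj le_rfl)
    have := Submodule.disjoint_def.1 (h.1 i) x.1 hx (h1 hx')
    exact Subtype.ext this
  · rw [eq_top_iff]
    intro x _
    have h1 : M ≤ (⨆ i, (A i).comap M.subtype).map M.subtype := by
      refine hM.trans (iSup_le fun i y hy => ⟨⟨y, hy.1⟩, ?_, rfl⟩)
      exact Submodule.mem_iSup_of_mem i hy.2
    obtain ⟨y, hy, hyx⟩ := h1 x.2
    rwa [← Subtype.ext (a1 := y) (a2 := x) hyx]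

theorem isInternal_mapQ {ι : Type*} [DecidableEq ι] {A : ι → Submodule ℂ L}
    (h : DirectSum.IsInternal A) (I : Submodule ℂ L) (hI : I ≤ ⨆ i, I ⊓ A i) :
    DirectSum.IsInternal fun i => (A i).map I.mkQ := by
  rw [DirectSum.isInternal_submodule_iff_iSupIndep_and_iSup_eq_top] at h ⊢
  refine ⟨fun i => ?_, ?_⟩
  · rw [Submodule.disjoint_def]
    rintro _ ⟨u, hu, rfl⟩ hx
    simp_rw [← Submodule.map_iSup] at hx
    obtain ⟨v, hv, hvu⟩ := hx
    have h1 : u - v ∈ I := by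
      rw [← Submodule.Quotient.eq]; exact hvu.symm
    have h2 : (⨆ j, I ⊓ A j) ≤ (I ⊓ A i) ⊔ (I ⊓ ⨆ j, ⨆ (_ : j ≠ i), A j) := by
      refine iSup_le fun j => ?_
      by_cases hj : j = i
      · subst hj; exact le_sup_left
      · exact le_sup_of_le_right (inf_le_inf_left _ (le_iSup₂_of_le j hj le_rfl))
    obtain ⟨p, hp, q, hq, hpq⟩ := Submodule.mem_sup.1 (h2 (hI h1))
    have h3 : u - p = v + q := by
      rw [sub_eq_iff_eq_add, add_assoc, add_comm q p, hpq]; abel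
    have h4 := Submodule.disjoint_def.1 (h.1 i) (u - p) (sub_mem hu hp.2)
      (h3 ▸ add_mem hv hq.2)
    rw [sub_eq_zero] at h4
    simpa [h4] using hp.1
  · rw [← Submodule.map_iSup, h.2, Submodule.map_top, Submodule.range_mkQ]

/-- The graded subalgebra carried by a graded subspace closed under the bracket. -/
def sub (G : GradedLieSuperalgebra L) (M : Submodule ℂ L) (hM : M ≤ ⨆ j, M ⊓ G.deg j)
    (hB : ∀ x ∈ M, ∀ y ∈ M, G.bracket x y ∈ M) : GradedLieSuperalgebra M where
  part i := (G.part i).comap M.subtype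
  part_isInternal := isInternal_comap G.part_isInternal M
    (hM.trans (iSup_le fun j => le_iSup_of_le (j : ZMod 2) (inf_le_inf_left _ (G.deg_le_part j))))
  bracket := LinearMap.mk₂ ℂ (fun x y => ⟨G.bracket x y, hB x x.2 y y.2⟩)
    (fun x y z => Subtype.ext (by simp)) (fun c x y => Subtype.ext (by simp))
    (fun x y z => Subtype.ext (by simp)) (fun c x y => Subtype.ext (by simp))
  bracket_mem_part i j x y hx hy := G.bracket_mem_part i j x y hx hy
  bracket_skew i j x y hx hy := Subtype.ext (G.bracket_skew i j x y hx hy)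
  bracket_jacobi i j x y z hx hy := Subtype.ext (G.bracket_jacobi i j x y z hx hy)
  deg j := (G.deg j).comap M.subtype
  deg_isInternal := isInternal_comap G.deg_isInternal M hM
  bracket_mem_deg i j x y hx hy := G.bracket_mem_deg i j x y hx hy
  deg_le_part j := Submodule.comap_mono (G.deg_le_part j)

/-- The quotient by a graded (two-sided) ideal. -/
def quot (G : GradedLieSuperalgebra L) (I : Submodule ℂ L) (hI : I ≤ ⨆ j, I ⊓ G.deg j)
    (hl : ∀ x, ∀ y ∈ I, G.bracket x y ∈ I) (hr : ∀ x ∈ I, ∀ y, G.bracket x y ∈ I) :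
    GradedLieSuperalgebra (L ⧸ I) where
  part i := (G.part i).map I.mkQ
  part_isInternal := isInternal_mapQ G.part_isInternal I
    (hI.trans (iSup_le fun j => le_iSup_of_le (j : ZMod 2) (inf_le_inf_left _ (G.deg_le_part j))))
  bracket := I.liftQ ((I.mapQLinear I).comp
      (G.bracket.codRestrict (I.compatibleMaps I) fun x y hy => hl x y hy)) (by
    intro x hx
    rw [LinearMap.mem_ker]
    refine LinearMap.ext fun y => ?_
    induction y using Submodule.Quotient.induction_on with
    | _ y => exact (Submodule.Quotient.mk_eq_zero I).2 (hr x hx y))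
  bracket_mem_part := by
    rintro i j _ _ ⟨x, hx, rfl⟩ ⟨y, hy, rfl⟩
    exact ⟨_, G.bracket_mem_part i j x y hx hy, rfl⟩
  bracket_skew := by
    rintro i j _ _ ⟨x, hx, rfl⟩ ⟨y, hy, rfl⟩
    exact congrArg I.mkQ (G.bracket_skew i j x y hx hy)
  bracket_jacobi := by
    rintro i j _ _ z ⟨x, hx, rfl⟩ ⟨y, hy, rfl⟩
    induction z using Submodule.Quotient.induction_on with
    | _ z => exact congrArg I.mkQ (G.bracket_jacobi i j x y z hx hy)
  deg j := (G.deg j).map I.mkQ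
  deg_isInternal := isInternal_mapQ G.deg_isInternal I hI
  bracket_mem_deg := by
    rintro i j _ _ ⟨x, hx, rfl⟩ ⟨y, hy, rfl⟩
    exact ⟨_, G.bracket_mem_deg i j x y hx hy, rfl⟩
  deg_le_part j := Submodule.map_mono (G.deg_le_part j)

end GradedLieSuperalgebra

/-! ### The general linear Lie superalgebra -/

section gl

set_option linter.unusedSectionVars false

open Matrix

variable {ι κ : Type*} [Fintype ι] [DecidableEq ι] [Fintype κ] [DecidableEq κ]

/-- Matrices of weight `a`: the matrix unit `E_{ij}` has weight `w i - w j`. -/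
def weightSpace {A : Type*} [AddCommGroup A] (w : ι → A) (a : A) :
    Submodule ℂ (Matrix ι ι ℂ) where
  carrier := {X | ∀ i j, X i j ≠ 0 → w i - w j = a}
  zero_mem' := by intro i j h; simp at h
  add_mem' := by
    intro X Y hX hY i j h
    by_cases h0 : X i j = 0
    · exact hY i j (by simpa [h0] using h)
    · exact hX i j h0
  smul_mem' := by
    intro c X hX i j h
    exact hX i j (right_ne_zero_of_mul (by simpa using h))

theorem weightSpace_isInternal {A : Type*} [AddCommGroup A] [DecidableEq A] (w : ι → A) :
    DirectSum.IsInternal (weightSpace w) := by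
  rw [DirectSum.isInternal_submodule_iff_iSupIndep_and_iSup_eq_top]
  refine ⟨fun a => ?_, ?_⟩
  · rw [Submodule.disjoint_def]
    intro X hX hX'
    let N : Submodule ℂ (Matrix ι ι ℂ) :=
      { carrier := {X | ∀ i j, w i - w j = a → X i j = 0}
        zero_mem' := by intro i j _; rfl
        add_mem' := by intro X Y hX hY i j h; simp [hX i j h, hY i j h]
        smul_mem' := by intro c X hX i j h; simp [hX i j h] }
    have hN : (⨆ b, ⨆ (_ : b ≠ a), weightSpace w b) ≤ N := by
      refine iSup₂_le fun b hb Y hY i j hij => ?_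
      by_contra h0
      exact hb ((hY i j h0).symm.trans hij)
    ext i j
    by_contra h0
    exact h0 (hN hX' i j (hX i j h0))
  · rw [eq_top_iff]
    intro X _
    rw [Matrix.matrix_eq_sum_single X]
    refine Submodule.sum_mem _ fun i _ => Submodule.sum_mem _ fun j _ => ?_
    refine Submodule.mem_iSup_of_mem (w i - w j) ?_
    intro k l h
    by_cases hk : i = k ∧ j = l
    · rw [hk.1, hk.2]
    · exact absurd (Matrix.single_apply_of_ne _ _ _ _ _ hk) h

theorem mul_mem_weightSpace {A : Type*} [AddCommGroup A] (w : ι → A) {a b : A}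
    {X Y : Matrix ι ι ℂ} (hX : X ∈ weightSpace w a) (hY : Y ∈ weightSpace w b) :
    X * Y ∈ weightSpace w (a + b) := by
  intro i j h
  rw [Matrix.mul_apply] at h
  obtain ⟨k, _, hk⟩ := Finset.exists_ne_zero_of_sum_ne_zero h
  rw [← hX i k (left_ne_zero_of_mul hk), ← hY k j (right_ne_zero_of_mul hk)]
  abel

/-- The parity of the indices: `ι` is even and `κ` is odd. -/
def parity : ι ⊕ κ → ZMod 2 := Sum.elim (fun _ => 0) (fun _ => 1)

/-- The even (block diagonal) component. -/
def evenPart : Matrix (ι ⊕ κ) (ι ⊕ κ) ℂ →ₗ[ℂ] Matrix (ι ⊕ κ) (ι ⊕ κ) ℂ where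
  toFun X := fromBlocks X.toBlocks₁₁ 0 0 X.toBlocks₂₂
  map_add' X Y := by ext (i | i) (j | j) <;> simp [toBlocks₁₁, toBlocks₂₂]
  map_smul' c X := by ext (i | i) (j | j) <;> simp [toBlocks₁₁, toBlocks₂₂]

/-- The odd (block off-diagonal) component. -/
def oddPart : Matrix (ι ⊕ κ) (ι ⊕ κ) ℂ →ₗ[ℂ] Matrix (ι ⊕ κ) (ι ⊕ κ) ℂ where
  toFun X := fromBlocks 0 X.toBlocks₁₂ X.toBlocks₂₁ 0
  map_add' X Y := by ext (i | i) (j | j) <;> simp [toBlocks₁₂, toBlocks₂₁]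
  map_smul' c X := by ext (i | i) (j | j) <;> simp [toBlocks₁₂, toBlocks₂₁]

/-- The supercommutator, i.e. the bilinear extension of `X Y - (-1)^{|X||Y|} Y X`. -/
def superBracket :
    Matrix (ι ⊕ κ) (ι ⊕ κ) ℂ →ₗ[ℂ] Matrix (ι ⊕ κ) (ι ⊕ κ) ℂ →ₗ[ℂ] Matrix (ι ⊕ κ) (ι ⊕ κ) ℂ :=
  LinearMap.mk₂ ℂ
    (fun X Y => X * Y - (evenPart Y * evenPart X + evenPart Y * oddPart X
      + oddPart Y * evenPart X - oddPart Y * oddPart X))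
    (fun X Y Z => by simp only [map_add]; noncomm_ring)
    (fun c X Y => by simp only [map_smul, smul_mul_assoc, mul_smul_comm, smul_add, smul_sub])
    (fun X Y Z => by simp only [map_add]; noncomm_ring)
    (fun c X Y => by simp only [map_smul, smul_mul_assoc, mul_smul_comm, smul_add, smul_sub])

theorem superBracket_apply (X Y : Matrix (ι ⊕ κ) (ι ⊕ κ) ℂ) :
    superBracket X Y = X * Y - (evenPart Y * evenPart X + evenPart Y * oddPart X
      + oddPart Y * evenPart X - oddPart Y * oddPart X) := rfl

theorem evenPart_add_oddPart (X : Matrix (ι ⊕ κ) (ι ⊕ κ) ℂ) : evenPart X + oddPart X = X := by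
  ext (i | i) (j | j) <;> simp [evenPart, oddPart, toBlocks₁₁, toBlocks₂₂, toBlocks₁₂, toBlocks₂₁]

theorem oddPart_of_even {X : Matrix (ι ⊕ κ) (ι ⊕ κ) ℂ} (hX : X ∈ weightSpace parity 0) :
    oddPart X = 0 := by
  ext (i | i) (j | j)
  · rfl
  · by_contra h
    have := hX (Sum.inl i) (Sum.inr j) h
    revert this; simp [parity]
  · by_contra h
    have := hX (Sum.inr i) (Sum.inl j) h
    revert this; simp [parity]
  · rfl

theorem evenPart_of_odd {X : Matrix (ι ⊕ κ) (ι ⊕ κ) ℂ} (hX : X ∈ weightSpace parity 1) :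
    evenPart X = 0 := by
  ext (i | i) (j | j)
  · by_contra h
    have := hX (Sum.inl i) (Sum.inl j) h
    revert this; simp [parity]
  · rfl
  · rfl
  · by_contra h
    have := hX (Sum.inr i) (Sum.inr j) h
    revert this; simp [parity]

theorem superBracket_of_mem {i j : ZMod 2} {X Y : Matrix (ι ⊕ κ) (ι ⊕ κ) ℂ}
    (hX : X ∈ weightSpace parity i) (hY : Y ∈ weightSpace parity j) :
    superBracket X Y = X * Y - (-1 : ℂ) ^ (i.val * j.val) • (Y * X) := by
  have key : ∀ (Z : Matrix (ι ⊕ κ) (ι ⊕ κ) ℂ) (k : ZMod 2), Z ∈ weightSpace parity k →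
      (k = 0 ∧ evenPart Z = Z ∧ oddPart Z = 0) ∨ (k = 1 ∧ evenPart Z = 0 ∧ oddPart Z = Z) := by
    intro Z k hZ
    have hs := evenPart_add_oddPart Z
    fin_cases k
    · have h0 := oddPart_of_even hZ
      rw [h0, add_zero] at hs
      exact Or.inl ⟨rfl, hs, h0⟩
    · have h0 := evenPart_of_odd hZ
      rw [h0, zero_add] at hs
      exact Or.inr ⟨rfl, h0, hs⟩
  rw [superBracket_apply]
  obtain ⟨rfl, h1, h2⟩ | ⟨rfl, h1, h2⟩ := key X i hX <;>
  obtain ⟨rfl, h3, h4⟩ | ⟨rfl, h3, h4⟩ := key Y j hY <;>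
  simp [h1, h2, h3, h4, ZMod.val_one]

theorem evenPart_mem {A : Type*} [AddCommGroup A] {w : ι ⊕ κ → A} {a : A}
    {X : Matrix (ι ⊕ κ) (ι ⊕ κ) ℂ} (hX : X ∈ weightSpace w a) : evenPart X ∈ weightSpace w a := by
  rintro (i | i) (j | j) h
  · exact hX _ _ h
  · exact absurd rfl h
  · exact absurd rfl h
  · exact hX _ _ h

theorem oddPart_mem {A : Type*} [AddCommGroup A] {w : ι ⊕ κ → A} {a : A}
    {X : Matrix (ι ⊕ κ) (ι ⊕ κ) ℂ} (hX : X ∈ weightSpace w a) : oddPart X ∈ weightSpace w a := by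
  rintro (i | i) (j | j) h
  · exact absurd rfl h
  · exact hX _ _ h
  · exact hX _ _ h
  · exact absurd rfl h

theorem evenPart_mem_even (X : Matrix (ι ⊕ κ) (ι ⊕ κ) ℂ) : evenPart X ∈ weightSpace parity 0 := by
  rintro (i | i) (j | j) h
  · simp [parity]
  · exact absurd rfl h
  · exact absurd rfl h
  · simp [parity]

theorem oddPart_mem_odd (X : Matrix (ι ⊕ κ) (ι ⊕ κ) ℂ) : oddPart X ∈ weightSpace parity 1 := by
  rintro (i | i) (j | j) h
  · exact absurd rfl h
  · simp [parity]
  · simp [parity]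
  · exact absurd rfl h

theorem superBracket_mem_part {i j : ZMod 2} {X Y : Matrix (ι ⊕ κ) (ι ⊕ κ) ℂ}
    (hX : X ∈ weightSpace parity i) (hY : Y ∈ weightSpace parity j) :
    superBracket X Y ∈ weightSpace parity (i + j) := by
  rw [superBracket_of_mem hX hY]
  exact sub_mem (mul_mem_weightSpace _ hX hY)
    (Submodule.smul_mem _ _ (add_comm j i ▸ mul_mem_weightSpace _ hY hX))

theorem superBracket_jacobi_of_mem {i j k : ZMod 2} {X Y Z : Matrix (ι ⊕ κ) (ι ⊕ κ) ℂ}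
    (hX : X ∈ weightSpace parity i) (hY : Y ∈ weightSpace parity j)
    (hZ : Z ∈ weightSpace parity k) :
    superBracket X (superBracket Y Z) = superBracket (superBracket X Y) Z +
      (-1 : ℂ) ^ (i.val * j.val) • superBracket Y (superBracket X Z) := by
  rw [superBracket_of_mem hX (superBracket_mem_part hY hZ),
    superBracket_of_mem (superBracket_mem_part hX hY) hZ,
    superBracket_of_mem hY (superBracket_mem_part hX hZ),
    superBracket_of_mem hX hY, superBracket_of_mem hY hZ, superBracket_of_mem hX hZ]
  have h01 : ∀ l : ZMod 2, l = 0 ∨ l = 1 := by decide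
  have h11 : (1 : ZMod 2) + 1 = 0 := by decide
  obtain rfl | rfl := h01 i <;> obtain rfl | rfl := h01 j <;> obtain rfl | rfl := h01 k <;>
  simp [ZMod.val_one, h11] <;> noncomm_ring

/-- `gl(ι|κ)` with the grading in which `E_{ij}` has degree `w i - w j`. -/
def glGraded (w : ι ⊕ κ → ℤ)
    (hw : ∀ i j, ((w i - w j : ℤ) : ZMod 2) = parity i - parity j) :
    GradedLieSuperalgebra (Matrix (ι ⊕ κ) (ι ⊕ κ) ℂ) where
  part := weightSpace parity
  part_isInternal := weightSpace_isInternal _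
  bracket := superBracket
  bracket_mem_part i j x y hx hy := superBracket_mem_part hx hy
  bracket_skew i j x y hx hy := by
    rw [superBracket_of_mem hx hy, superBracket_of_mem hy hx, mul_comm j.val i.val, smul_sub,
      smul_smul, ← mul_pow]
    simp
  bracket_jacobi i j x y z hx hy := by
    have h0 := superBracket_jacobi_of_mem hx hy (evenPart_mem_even z)
    have h1 := superBracket_jacobi_of_mem hx hy (oddPart_mem_odd z)
    rw [← evenPart_add_oddPart z]
    simp only [map_add, smul_add, h0, h1]
    abel
  deg := weightSpace w
  deg_isInternal := weightSpace_isInternal _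
  bracket_mem_deg i j x y hx hy := by
    rw [superBracket_apply]
    have h : ∀ {X Y}, X ∈ weightSpace w i → Y ∈ weightSpace w j → Y * X ∈ weightSpace w (i + j) :=
      fun hX hY => add_comm j i ▸ mul_mem_weightSpace w hY hX
    exact sub_mem (mul_mem_weightSpace w hx hy)
      (sub_mem (add_mem (add_mem (h (evenPart_mem hx) (evenPart_mem hy))
        (h (oddPart_mem hx) (evenPart_mem hy))) (h (evenPart_mem hx) (oddPart_mem hy)))
        (h (oddPart_mem hx) (oddPart_mem hy)))
  deg_le_part j X hX i k h := by
    rw [← hw, hX i k h]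

theorem evenPart_fromBlocks (a : Matrix ι ι ℂ) (b : Matrix ι κ ℂ) (c : Matrix κ ι ℂ)
    (d : Matrix κ κ ℂ) : evenPart (fromBlocks a b c d) = fromBlocks a 0 0 d := rfl

theorem oddPart_fromBlocks (a : Matrix ι ι ℂ) (b : Matrix ι κ ℂ) (c : Matrix κ ι ℂ)
    (d : Matrix κ κ ℂ) : oddPart (fromBlocks a b c d) = fromBlocks 0 b c 0 := rfl

/-- The supercommutator in block form. -/
theorem superBracket_fromBlocks (a a' : Matrix ι ι ℂ) (b b' : Matrix ι κ ℂ) (c c' : Matrix κ ι ℂ)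
    (d d' : Matrix κ κ ℂ) :
    superBracket (fromBlocks a b c d) (fromBlocks a' b' c' d') =
      fromBlocks (a * a' - a' * a + (b * c' + b' * c)) (a * b' + b * d' - a' * b - b' * d)
        (c * a' + d * c' - c' * a - d' * c) (d * d' - d' * d + (c * b' + c' * b)) := by
  rw [superBracket_apply]
  simp only [evenPart_fromBlocks, oddPart_fromBlocks, fromBlocks_multiply, fromBlocks_add,
    sub_eq_add_neg, fromBlocks_neg]
  congr 1 <;> simp <;> abel

/-- The anti-linear map `(a b; c d) ↦ (-āᵗ c̄ᵗ; -b̄ᵗ -d̄ᵗ)`. -/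
def sigmaTilde : Matrix (ι ⊕ κ) (ι ⊕ κ) ℂ →ₛₗ[starRingEnd ℂ] Matrix (ι ⊕ κ) (ι ⊕ κ) ℂ where
  toFun X := fromBlocks (-X.toBlocks₁₁ᴴ) X.toBlocks₂₁ᴴ (-X.toBlocks₁₂ᴴ) (-X.toBlocks₂₂ᴴ)
  map_add' X Y := by
    ext (i | i) (j | j) <;> simp [toBlocks₁₁, toBlocks₂₂, toBlocks₁₂, toBlocks₂₁] <;> ring
  map_smul' c X := by
    ext (i | i) (j | j) <;> simp [toBlocks₁₁, toBlocks₂₂, toBlocks₁₂, toBlocks₂₁]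

/-- `Ad g : X ↦ g X g⁻¹`. -/
def matrixAd (g : GL ι ℂ) : Matrix ι ι ℂ →ₗ[ℂ] Matrix ι ι ℂ where
  toFun X := g.1 * X * g.2
  map_add' X Y := by noncomm_ring
  map_smul' c X := by simp

/-- The block diagonal matrix `diag(A, B)`. -/
def blockDiag (A : GL ι ℂ) (B : GL κ ℂ) : GL (ι ⊕ κ) ℂ where
  val := fromBlocks A.1 0 0 B.1
  inv := fromBlocks A.2 0 0 B.2
  val_inv := by
    simp [fromBlocks_multiply]
  inv_val := by
    simp [fromBlocks_multiply]

theorem matrixAd_blockDiag (A : GL ι ℂ) (B : GL κ ℂ) (a : Matrix ι ι ℂ) (b : Matrix ι κ ℂ)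
    (c : Matrix κ ι ℂ) (d : Matrix κ κ ℂ) :
    matrixAd (blockDiag A B) (fromBlocks a b c d) =
      fromBlocks (A.1 * a * A.2) (A.1 * b * B.2) (B.1 * c * A.2) (B.1 * d * B.2) := by
  show fromBlocks A.1 0 0 B.1 * fromBlocks a b c d * fromBlocks A.2 0 0 B.2 = _
  simp [fromBlocks_multiply]

end gl

/-! ### The Lie superalgebra `psl(m,n)` -/

section psl

open Matrix

/-- The supertrace of `(a b; c d)` is `tr a - tr d`. -/
def superTrace (m n : ℕ) : Matrix (Fin m ⊕ Fin n) (Fin m ⊕ Fin n) ℂ →ₗ[ℂ] ℂ where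
  toFun X := X.toBlocks₁₁.trace - X.toBlocks₂₂.trace
  map_add' X Y := by simp [toBlocks₁₁, toBlocks₂₂, trace, Finset.sum_add_distrib]; ring
  map_smul' c X := by simp [toBlocks₁₁, toBlocks₂₂, trace, ← Finset.mul_sum, mul_sub]

theorem superTrace_fromBlocks {m n : ℕ} (a : Matrix (Fin m) (Fin m) ℂ) (b : Matrix (Fin m) (Fin n) ℂ)
    (c : Matrix (Fin n) (Fin m) ℂ) (d : Matrix (Fin n) (Fin n) ℂ) :
    superTrace m n (fromBlocks a b c d) = a.trace - d.trace := rfl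

/-- The weights `f(ε_i) = 1`, `f(δ_j) = 0`. -/
def pslWeight (m n : ℕ) : Fin m ⊕ Fin n → ℤ := Sum.elim (fun _ => 1) (fun _ => 0)

theorem pslWeight_parity (m n : ℕ) (i j : Fin m ⊕ Fin n) :
    ((pslWeight m n i - pslWeight m n j : ℤ) : ZMod 2) = parity i - parity j := by
  rcases i with i | i <;> rcases j with j | j <;> simp [pslWeight, parity]

/-- The underlying space of `sl(m,n)`. -/
def slSpace (m n : ℕ) : Submodule ℂ (Matrix (Fin m ⊕ Fin n) (Fin m ⊕ Fin n) ℂ) :=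
  LinearMap.ker (superTrace m n)

theorem fromBlocks_mem_slSpace {m n : ℕ} {a : Matrix (Fin m) (Fin m) ℂ}
    {b : Matrix (Fin m) (Fin n) ℂ} {c : Matrix (Fin n) (Fin m) ℂ} {d : Matrix (Fin n) (Fin n) ℂ} :
    fromBlocks a b c d ∈ slSpace m n ↔ a.trace = d.trace := by
  rw [slSpace, LinearMap.mem_ker, superTrace_fromBlocks, sub_eq_zero]

theorem slSpace_homogeneous (m n : ℕ) :
    slSpace m n ≤ ⨆ j, slSpace m n ⊓ weightSpace (pslWeight m n) j := by
  intro X hX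
  rw [← fromBlocks_toBlocks X] at hX ⊢
  generalize X.toBlocks₁₁ = a, X.toBlocks₁₂ = b, X.toBlocks₂₁ = c, X.toBlocks₂₂ = d at hX ⊢
  have h : fromBlocks a b c d = fromBlocks a 0 0 d + fromBlocks 0 b 0 0 + fromBlocks 0 0 c 0 := by
    simp [fromBlocks_add]
  rw [h]
  refine add_mem (add_mem ?_ ?_) ?_
  · refine Submodule.mem_iSup_of_mem 0 ⟨?_, ?_⟩
    · exact fromBlocks_mem_slSpace.2 (fromBlocks_mem_slSpace.1 hX)
    · rintro (i | i) (j | j) h <;> simp [pslWeight] at h ⊢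
  · refine Submodule.mem_iSup_of_mem 1 ⟨fromBlocks_mem_slSpace.2 (by simp), ?_⟩
    rintro (i | i) (j | j) h <;> simp [pslWeight] at h ⊢
  · refine Submodule.mem_iSup_of_mem (-1) ⟨fromBlocks_mem_slSpace.2 (by simp), ?_⟩
    rintro (i | i) (j | j) h <;> simp [pslWeight] at h ⊢

theorem superBracket_mem_slSpace {m n : ℕ} (X Y : Matrix (Fin m ⊕ Fin n) (Fin m ⊕ Fin n) ℂ) :
    superBracket X Y ∈ slSpace m n := by
  rw [← fromBlocks_toBlocks X, ← fromBlocks_toBlocks Y, superBracket_fromBlocks,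
    fromBlocks_mem_slSpace]
  simp only [trace_add, trace_sub]
  rw [trace_mul_comm Y.toBlocks₁₁, trace_mul_comm Y.toBlocks₂₂, trace_mul_comm X.toBlocks₂₁,
    trace_mul_comm Y.toBlocks₂₁]
  ring

/-- `sl(m,n)` with its grading. -/
def sl (m n : ℕ) : GradedLieSuperalgebra (slSpace m n) :=
  (glGraded (pslWeight m n) (pslWeight_parity m n)).sub (slSpace m n) (slSpace_homogeneous m n)
    fun X _ Y _ => superBracket_mem_slSpace X Y

/-- The scalar matrices contained in `sl(m,n)`; they are zero if `m ≠ n`. -/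
def slScalars (m n : ℕ) : Submodule ℂ (slSpace m n) :=
  (Submodule.span ℂ {1}).comap (slSpace m n).subtype

theorem mem_slScalars {m n : ℕ} (x : slSpace m n) :
    x ∈ slScalars m n ↔ ∃ z : ℂ, z • (1 : Matrix (Fin m ⊕ Fin n) (Fin m ⊕ Fin n) ℂ) = x :=
  Submodule.mem_span_singleton

theorem slScalars_homogeneous (m n : ℕ) :
    slScalars m n ≤ ⨆ j, slScalars m n ⊓ (sl m n).deg j := by
  intro x hx
  refine Submodule.mem_iSup_of_mem 0 ⟨hx, ?_⟩
  obtain ⟨z, hz⟩ := (mem_slScalars x).1 hx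
  show x.1 ∈ weightSpace (pslWeight m n) 0
  rw [← hz]
  intro i j h
  have : i = j := by
    by_contra hij
    simp [hij] at h
  simp [this]

theorem superBracket_scalar_right {m n : ℕ} (X : Matrix (Fin m ⊕ Fin n) (Fin m ⊕ Fin n) ℂ) (z : ℂ) :
    superBracket X (z • 1) = 0 := by
  rw [← fromBlocks_toBlocks X, ← fromBlocks_one, fromBlocks_smul, superBracket_fromBlocks]
  simp

theorem superBracket_scalar_left {m n : ℕ} (X : Matrix (Fin m ⊕ Fin n) (Fin m ⊕ Fin n) ℂ) (z : ℂ) :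
    superBracket (z • 1) X = 0 := by
  rw [← fromBlocks_toBlocks X, ← fromBlocks_one, fromBlocks_smul, superBracket_fromBlocks]
  simp

/-- The underlying space of `psl(m,n)`. -/
abbrev pslSpace (m n : ℕ) : Type := slSpace m n ⧸ slScalars m n

/-- `psl(m,n)`, the quotient of `sl(m,n)` by its scalar matrices (so `psl(m,n) = sl(m,n)` for
`m ≠ n`), with the grading `𝔤_{-1} = {c}`, `𝔤_0 = {a, d}`, `𝔤_1 = {b}`. -/
def psl (m n : ℕ) : GradedLieSuperalgebra (pslSpace m n) :=
  (sl m n).quot (slScalars m n) (slScalars_homogeneous m n)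
    (fun x y hy => by
      obtain ⟨z, hz⟩ := (mem_slScalars y).1 hy
      refine (mem_slScalars _).2 ⟨0, ?_⟩
      show _ = superBracket x.1 y.1
      rw [← hz, superBracket_scalar_right, zero_smul])
    (fun x hx y => by
      obtain ⟨z, hz⟩ := (mem_slScalars x).1 hx
      refine (mem_slScalars _).2 ⟨0, ?_⟩
      show _ = superBracket x.1 y.1
      rw [← hz, superBracket_scalar_left, zero_smul])

/-- The map induced on `psl(m,n)` by a (semi)linear map of matrices which preserves `sl(m,n)` and
the scalar matrices. -/
def pslMap {m n : ℕ} {τ : ℂ →+* ℂ}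
    (f : Matrix (Fin m ⊕ Fin n) (Fin m ⊕ Fin n) ℂ →ₛₗ[τ] Matrix (Fin m ⊕ Fin n) (Fin m ⊕ Fin n) ℂ)
    (hf : ∀ X ∈ slSpace m n, f X ∈ slSpace m n) (h1 : ∃ z : ℂ, f 1 = z • 1) :
    pslSpace m n →ₛₗ[τ] pslSpace m n :=
  (slScalars m n).mapQ (slScalars m n)
    ((f.comp (slSpace m n).subtype).codRestrict (slSpace m n) fun x => hf x x.2) (by
      intro x hx
      obtain ⟨z, hz⟩ := (mem_slScalars x).1 hx
      obtain ⟨z', hz'⟩ := h1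
      refine (mem_slScalars _).2 ⟨τ z * z', ?_⟩
      show _ = f x.1
      rw [← hz, map_smulₛₗ, hz', smul_smul])

/-- `σ̃₁` on `psl(m,n)`. -/
def pslSigma (m n : ℕ) : pslSpace m n →ₛₗ[starRingEnd ℂ] pslSpace m n :=
  pslMap sigmaTilde
    (fun X hX => by
      rw [← fromBlocks_toBlocks X, fromBlocks_mem_slSpace] at hX
      refine fromBlocks_mem_slSpace.2 ?_
      rw [trace_neg, trace_neg, trace_conjTranspose, trace_conjTranspose, hX])
    ⟨-1, by
      rw [← fromBlocks_one]
      show fromBlocks (-1ᴴ) 0ᴴ (-0ᴴ) (-1ᴴ) = _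
      rw [fromBlocks_smul]
      simp⟩

/-- `Ad diag(A, B)` on `psl(m,n)`. -/
def pslAd {m n : ℕ} (A : GL (Fin m) ℂ) (B : GL (Fin n) ℂ) : pslSpace m n →ₗ[ℂ] pslSpace m n :=
  pslMap (matrixAd (blockDiag A B))
    (fun X hX => by
      rw [← fromBlocks_toBlocks X] at hX ⊢
      rw [matrixAd_blockDiag]
      rw [fromBlocks_mem_slSpace] at hX ⊢
      rw [trace_mul_comm, ← mul_assoc, A.4, one_mul, trace_mul_comm, ← mul_assoc, B.4, one_mul, hX])
    ⟨1, by
      show (blockDiag A B).1 * 1 * (blockDiag A B).2 = _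
      rw [mul_one, (blockDiag A B).3, one_smul]⟩

/-- `S_p^n = diag(I_p, -I_{n-p})`. -/
def signMatrix (n p : ℕ) : GL (Fin n) ℂ where
  val := diagonal fun i => if i.val < p then 1 else -1
  inv := diagonal fun i => if i.val < p then 1 else -1
  val_inv := by
    rw [diagonal_mul_diagonal, ← diagonal_one]; congr 1; ext i; split_ifs <;> simp
  inv_val := by
    rw [diagonal_mul_diagonal, ← diagonal_one]; congr 1; ext i; split_ifs <;> simp

/-- The anti-linear map `(a b; c d) ↦ (d̄ (ε i c̄); (-ε i b̄) ā)` on square matrices. -/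
def tauMatrix (n : ℕ) (ε : ℤˣ) : Matrix (Fin n ⊕ Fin n) (Fin n ⊕ Fin n) ℂ →ₛₗ[starRingEnd ℂ]
    Matrix (Fin n ⊕ Fin n) (Fin n ⊕ Fin n) ℂ where
  toFun X := fromBlocks (X.toBlocks₂₂.map star) (((ε : ℤ) * Complex.I : ℂ) • X.toBlocks₂₁.map star)
    (-((ε : ℤ) * Complex.I : ℂ) • X.toBlocks₁₂.map star) (X.toBlocks₁₁.map star)
  map_add' X Y := by
    ext (i | i) (j | j) <;> simp [toBlocks₁₁, toBlocks₂₂, toBlocks₁₂, toBlocks₂₁] <;> ring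
  map_smul' c X := by
    ext (i | i) (j | j) <;> simp [toBlocks₁₁, toBlocks₂₂, toBlocks₁₂, toBlocks₂₁] <;> ring

/-- `τ_+` (for `ε = 1`) and `τ_-` (for `ε = -1`) on `psl(n,n)`. -/
def pslTau (n : ℕ) (ε : ℤˣ) : pslSpace n n →ₛₗ[starRingEnd ℂ] pslSpace n n :=
  pslMap (tauMatrix n ε)
    (fun X hX => by
      rw [← fromBlocks_toBlocks X, fromBlocks_mem_slSpace] at hX
      refine fromBlocks_mem_slSpace.2 ?_
      have h : ∀ Y : Matrix (Fin n) (Fin n) ℂ, (Y.map star).trace = star Y.trace := by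
        intro Y; simp [trace]
      rw [h, h, hX])
    ⟨1, by
      rw [← fromBlocks_one]
      show fromBlocks ((1 : Matrix (Fin n) (Fin n) ℂ).map star) (_ • (0 : Matrix _ _ ℂ).map star)
        (_ • (0 : Matrix _ _ ℂ).map star) ((1 : Matrix (Fin n) (Fin n) ℂ).map star) = _
      simp⟩

end psl

/-! ### The Lie superalgebra `osp(2,2n)` -/

section osp

open Matrix

/-- The symplectic matrix `J_{2n} = (0 I_n; -I_n 0)`. -/
def sympJ (n : ℕ) : Matrix (Fin n ⊕ Fin n) (Fin n ⊕ Fin n) ℂ := fromBlocks 0 1 (-1) 0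

/-- The symmetric matrix `(0 1; 1 0)`. -/
def symQ : Matrix (Fin 2) (Fin 2) ℂ := !![0, 1; 1, 0]

/-- The supersymmetric form on `ℂ^{2|2n}`. -/
def ospForm (n : ℕ) : Matrix (Fin 2 ⊕ (Fin n ⊕ Fin n)) (Fin 2 ⊕ (Fin n ⊕ Fin n)) ℂ :=
  fromBlocks symQ 0 0 (-sympJ n)

/-- The supertranspose `(a b; c d) ↦ (aᵗ cᵗ; -bᵗ dᵗ)`. -/
def superTranspose (n : ℕ) : Matrix (Fin 2 ⊕ (Fin n ⊕ Fin n)) (Fin 2 ⊕ (Fin n ⊕ Fin n)) ℂ →ₗ[ℂ]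
    Matrix (Fin 2 ⊕ (Fin n ⊕ Fin n)) (Fin 2 ⊕ (Fin n ⊕ Fin n)) ℂ where
  toFun X := fromBlocks X.toBlocks₁₁ᵀ X.toBlocks₂₁ᵀ (-X.toBlocks₁₂ᵀ) X.toBlocks₂₂ᵀ
  map_add' X Y := by
    ext (i | i) (j | j) <;> simp [toBlocks₁₁, toBlocks₂₂, toBlocks₁₂, toBlocks₂₁]
    all_goals ring
  map_smul' c X := by
    ext (i | i) (j | j) <;> simp [toBlocks₁₁, toBlocks₂₂, toBlocks₁₂, toBlocks₂₁]

/-- The underlying space of `osp(2,2n)`: the `X` with `(X u, v) + (-1)^{|X||u|} (u, X v) = 0`. -/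
def ospSpace (n : ℕ) :
    Submodule ℂ (Matrix (Fin 2 ⊕ (Fin n ⊕ Fin n)) (Fin 2 ⊕ (Fin n ⊕ Fin n)) ℂ) where
  carrier := {X | superTranspose n X * ospForm n + ospForm n * X = 0}
  zero_mem' := by simp
  add_mem' := by
    intro X Y hX hY
    have h : superTranspose n (X + Y) * ospForm n + ospForm n * (X + Y) =
        (superTranspose n X * ospForm n + ospForm n * X) +
        (superTranspose n Y * ospForm n + ospForm n * Y) := by rw [map_add]; noncomm_ring
    show _ = _
    rw [h, hX, hY, add_zero]
  smul_mem' := by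
    intro c X hX
    have h : superTranspose n (c • X) * ospForm n + ospForm n * (c • X) =
        c • (superTranspose n X * ospForm n + ospForm n * X) := by
      rw [map_smul, smul_mul_assoc, mul_smul_comm, smul_add]
    show _ = _
    rw [h, hX, smul_zero]

theorem sympJ_mul_self (n : ℕ) : sympJ n * sympJ n = -1 := by
  rw [← fromBlocks_one, sympJ, fromBlocks_multiply, fromBlocks_neg]; simp

theorem sympJ_transpose (n : ℕ) : (sympJ n)ᵀ = -sympJ n := by
  rw [sympJ, fromBlocks_transpose, fromBlocks_neg]; simp

theorem sympJ_conjTranspose (n : ℕ) : (sympJ n)ᴴ = -sympJ n := by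
  rw [sympJ, fromBlocks_conjTranspose, fromBlocks_neg]; simp

theorem symQ_mul_self : symQ * symQ = 1 := by
  ext i j; fin_cases i <;> fin_cases j <;> simp [symQ]

theorem symQ_transpose : symQᵀ = symQ := by
  ext i j; fin_cases i <;> fin_cases j <;> simp [symQ]

theorem symQ_conjTranspose : symQᴴ = symQ := by
  ext i j; fin_cases i <;> fin_cases j <;> simp [symQ]

/-- The block description of `osp(2,2n)`: `a ∈ so(2)`, `d ∈ sp(2n)` and `c = J bᵗ Q`. -/
theorem fromBlocks_mem_ospSpace {n : ℕ} {a : Matrix (Fin 2) (Fin 2) ℂ}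
    {b : Matrix (Fin 2) (Fin n ⊕ Fin n) ℂ} {c : Matrix (Fin n ⊕ Fin n) (Fin 2) ℂ}
    {d : Matrix (Fin n ⊕ Fin n) (Fin n ⊕ Fin n) ℂ} :
    fromBlocks a b c d ∈ ospSpace n ↔ aᵀ = -(symQ * a * symQ) ∧
      dᵀ = sympJ n * d * sympJ n ∧ c = sympJ n * bᵀ * symQ := by
  have h0 : fromBlocks a b c d ∈ ospSpace n ↔
      fromBlocks aᵀ cᵀ (-bᵀ) dᵀ * ospForm n + ospForm n * fromBlocks a b c d = 0 := Iff.rfl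
  rw [h0, ospForm, fromBlocks_multiply, fromBlocks_multiply, fromBlocks_add, ← fromBlocks_zero,
    fromBlocks_inj]
  simp only [Matrix.mul_zero, Matrix.zero_mul, add_zero, zero_add, Matrix.mul_neg, Matrix.neg_mul]
  have hJ := sympJ_mul_self n
  have hQ := symQ_mul_self
  have hJt := sympJ_transpose n
  have hQt := symQ_transpose
  constructor
  · rintro ⟨h1, -, h3, h4⟩
    refine ⟨?_, ?_, ?_⟩
    · rw [eq_neg_of_add_eq_zero_right h1, Matrix.neg_mul, neg_neg, Matrix.mul_assoc, hQ,
        Matrix.mul_one]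
    · have h5 : sympJ n * d = -(dᵀ * sympJ n) := by
        rw [← neg_add, neg_eq_zero] at h4
        exact eq_neg_of_add_eq_zero_right h4
      rw [h5, Matrix.neg_mul, Matrix.mul_assoc, hJ, Matrix.mul_neg, Matrix.mul_one, neg_neg]
    · have h5 : bᵀ * symQ = -(sympJ n * c) := by
        rw [← neg_add, neg_eq_zero] at h3
        exact eq_neg_of_add_eq_zero_left h3
      rw [Matrix.mul_assoc, h5, Matrix.mul_neg, ← Matrix.mul_assoc, hJ, Matrix.neg_mul,
        Matrix.one_mul, neg_neg]
  · rintro ⟨h1, h2, rfl⟩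
    refine ⟨?_, ?_, ?_, ?_⟩
    · rw [h1, Matrix.neg_mul, Matrix.mul_assoc, hQ, Matrix.mul_one, neg_add_cancel]
    · have h5 : (sympJ n * bᵀ * symQ)ᵀ = -(symQ * b * sympJ n) := by
        simp only [transpose_mul, transpose_transpose, hJt, hQt, Matrix.mul_neg, Matrix.mul_assoc]
      rw [h5, Matrix.neg_mul, neg_neg, Matrix.mul_assoc, hJ, Matrix.mul_neg, Matrix.mul_one,
        neg_add_cancel]
    · simp only [← Matrix.mul_assoc, hJ]
      simp
    · rw [h2]
      simp only [Matrix.mul_assoc, hJ]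
      simp

/-- The weights `f(ε₁) = 1` and `f(δ_j) = 0`; the first two basis vectors have weights `±ε₁`. -/
def ospWeight (n : ℕ) : Fin 2 ⊕ (Fin n ⊕ Fin n) → ℤ := Sum.elim ![1, -1] (fun _ => 0)

theorem ospWeight_parity (n : ℕ) (i j : Fin 2 ⊕ (Fin n ⊕ Fin n)) :
    ((ospWeight n i - ospWeight n j : ℤ) : ZMod 2) = parity i - parity j := by
  rcases i with i | i <;> rcases j with j | j
  · fin_cases i <;> fin_cases j <;> simp [ospWeight, parity] <;> rfl
  · fin_cases i <;> simp [ospWeight, parity]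
  · fin_cases j <;> simp [ospWeight, parity]
  · simp [ospWeight, parity]

theorem ospSpace_homogeneous (n : ℕ) :
    ospSpace n ≤ ⨆ j, ospSpace n ⊓ weightSpace (ospWeight n) j := by
  intro X hX
  rw [← fromBlocks_toBlocks X] at hX ⊢
  generalize X.toBlocks₁₁ = a, X.toBlocks₁₂ = b, X.toBlocks₂₁ = c, X.toBlocks₂₂ = d at hX ⊢
  obtain ⟨ha, hd, rfl⟩ := fromBlocks_mem_ospSpace.1 hX
  have hq : ∀ i j : Fin 2, (symQ * a * symQ) i j = a (1 - i) (1 - j) := by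
    intro i j
    simp only [Matrix.mul_apply, Fin.sum_univ_two]
    fin_cases i <;> fin_cases j <;> simp [symQ]
  have ha01 : a 0 1 = 0 := by
    have h1 : a 0 1 = -(symQ * a * symQ) 1 0 := congrFun (congrFun ha 1) 0
    rw [hq] at h1
    exact self_eq_neg.1 h1
  have ha10 : a 1 0 = 0 := by
    have h1 : a 1 0 = -(symQ * a * symQ) 0 1 := congrFun (congrFun ha 0) 1
    rw [hq] at h1
    exact self_eq_neg.1 h1
  have hb : b = of ![b 0, 0] + of ![0, b 1] := by
    ext i j; fin_cases i <;> simp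
  have h : fromBlocks a b (sympJ n * bᵀ * symQ) d = fromBlocks a 0 0 d
      + fromBlocks 0 (of ![b 0, 0]) (sympJ n * (of ![b 0, 0])ᵀ * symQ) 0
      + fromBlocks 0 (of ![0, b 1]) (sympJ n * (of ![0, b 1])ᵀ * symQ) 0 := by
    rw [fromBlocks_add, fromBlocks_add]
    congr 1
    · simp
    · simpa using hb
    · rw [zero_add, ← Matrix.add_mul, ← Matrix.mul_add, ← transpose_add, ← hb]
    · simp
  rw [h]
  refine add_mem (add_mem ?_ ?_) ?_
  · refine Submodule.mem_iSup_of_mem 0 ⟨fromBlocks_mem_ospSpace.2 ⟨ha, hd, by simp⟩, ?_⟩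
    rintro (i | i) (j | j) h
    · fin_cases i <;> fin_cases j <;> simp [ospWeight, ha01, ha10] at h ⊢
    · simp at h
    · simp at h
    · simp [ospWeight]
  · refine Submodule.mem_iSup_of_mem 1 ⟨fromBlocks_mem_ospSpace.2 ⟨by simp, by simp, rfl⟩, ?_⟩
    rintro (i | i) (j | j) h
    · simp at h
    · fin_cases i <;> simp [ospWeight] at h ⊢
    · fin_cases j <;> simp [ospWeight, symQ, Matrix.mul_apply] at h ⊢
    · simp at h
  · refine Submodule.mem_iSup_of_mem (-1) ⟨fromBlocks_mem_ospSpace.2 ⟨by simp, by simp, rfl⟩, ?_⟩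
    rintro (i | i) (j | j) h
    · simp at h
    · fin_cases i <;> simp [ospWeight] at h ⊢
    · fin_cases j <;> simp [ospWeight, symQ, Matrix.mul_apply] at h ⊢
    · simp at h

theorem superBracket_mem_ospSpace {n : ℕ} (X Y : Matrix (Fin 2 ⊕ (Fin n ⊕ Fin n)) _ ℂ)
    (hX : X ∈ ospSpace n) (hY : Y ∈ ospSpace n) : superBracket X Y ∈ ospSpace n := by
  rw [← fromBlocks_toBlocks X] at hX ⊢
  rw [← fromBlocks_toBlocks Y] at hY ⊢
  generalize X.toBlocks₁₁ = a, X.toBlocks₁₂ = b, X.toBlocks₂₁ = c, X.toBlocks₂₂ = d at hX ⊢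
  generalize Y.toBlocks₁₁ = a', Y.toBlocks₁₂ = b', Y.toBlocks₂₁ = c', Y.toBlocks₂₂ = d' at hY ⊢
  obtain ⟨ha, hd, rfl⟩ := fromBlocks_mem_ospSpace.1 hX
  obtain ⟨ha', hd', rfl⟩ := fromBlocks_mem_ospSpace.1 hY
  have hJ := sympJ_mul_self n
  have hQ := symQ_mul_self
  have hJ' : ∀ {k : Type} (Z : Matrix (Fin n ⊕ Fin n) k ℂ), sympJ n * (sympJ n * Z) = -Z := by
    intro k Z; rw [← Matrix.mul_assoc, hJ, Matrix.neg_mul, Matrix.one_mul]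
  have hQ' : ∀ {k : Type} (Z : Matrix (Fin 2) k ℂ), symQ * (symQ * Z) = Z := by
    intro k Z; rw [← Matrix.mul_assoc, hQ, Matrix.one_mul]
  rw [superBracket_fromBlocks, fromBlocks_mem_ospSpace]
  refine ⟨?_, ?_, ?_⟩ <;>
  simp only [transpose_add, transpose_sub, transpose_mul, transpose_transpose, ha, hd, ha', hd',
    sympJ_transpose, symQ_transpose, Matrix.mul_add, Matrix.add_mul, Matrix.mul_sub,
    Matrix.sub_mul, Matrix.mul_neg, Matrix.neg_mul, Matrix.mul_assoc, hQ, hJ', hQ', neg_neg,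
    Matrix.mul_one] <;>
  abel

/-- `osp(2,2n)` with its grading. -/
def osp (n : ℕ) : GradedLieSuperalgebra (ospSpace n) :=
  (glGraded (ospWeight n) (ospWeight_parity n)).sub (ospSpace n) (ospSpace_homogeneous n)
    fun X hX Y hY => superBracket_mem_ospSpace X Y hX hY

/-- `σ̃₁` on `osp(2,2n)`. -/
def ospSigma (n : ℕ) : ospSpace n →ₛₗ[starRingEnd ℂ] ospSpace n :=
  (sigmaTilde.comp (ospSpace n).subtype).codRestrict (ospSpace n) fun X => by
    have hX := X.2
    rw [← fromBlocks_toBlocks X.1] at hX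
    show fromBlocks (-X.1.toBlocks₁₁ᴴ) X.1.toBlocks₂₁ᴴ (-X.1.toBlocks₁₂ᴴ) (-X.1.toBlocks₂₂ᴴ) ∈ _
    generalize X.1.toBlocks₁₁ = a, X.1.toBlocks₁₂ = b, X.1.toBlocks₂₁ = c,
      X.1.toBlocks₂₂ = d at hX ⊢
    obtain ⟨ha, hd, rfl⟩ := fromBlocks_mem_ospSpace.1 hX
    have hc : ∀ {k l : Type} (Z : Matrix k l ℂ), Zᴴᵀ = Zᵀᴴ := fun _ => rfl
    have hJ := sympJ_mul_self n
    have hQ := symQ_mul_self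
    have hJ' : ∀ {k : Type} (Z : Matrix (Fin n ⊕ Fin n) k ℂ), sympJ n * (sympJ n * Z) = -Z := by
      intro k Z; rw [← Matrix.mul_assoc, hJ, Matrix.neg_mul, Matrix.one_mul]
    rw [fromBlocks_mem_ospSpace]
    refine ⟨?_, ?_, ?_⟩ <;>
    simp only [transpose_neg, hc, ha, hd, conjTranspose_neg, conjTranspose_mul, transpose_mul,
      sympJ_conjTranspose, symQ_conjTranspose, sympJ_transpose, symQ_transpose,
      transpose_transpose, Matrix.mul_neg, Matrix.neg_mul, Matrix.mul_assoc, hJ', hQ, neg_neg,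
      Matrix.mul_one]

/-- The matrix `diag(α, α⁻¹)`. -/
def torusMatrix (α : ℂˣ) : GL (Fin 2) ℂ where
  val := !![(α : ℂ), 0; 0, (α⁻¹ : ℂˣ)]
  inv := !![((α⁻¹ : ℂˣ) : ℂ), 0; 0, α]
  val_inv := by ext i j; fin_cases i <;> fin_cases j <;> simp
  inv_val := by ext i j; fin_cases i <;> fin_cases j <;> simp

/-- A symplectic matrix as an invertible matrix. -/
def sympToGL {n : ℕ} (B : symplecticGroup (Fin n) ℂ) : GL (Fin n ⊕ Fin n) ℂ :=
  Units.map (symplecticGroup (Fin n) ℂ).subtype (toUnits B)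

theorem sympToGL_transpose {n : ℕ} (B : symplecticGroup (Fin n) ℂ) :
    (sympToGL B).1ᵀ = -(sympJ n * (sympToGL B).2 * sympJ n) := by
  have hJ := sympJ_mul_self n
  have h : Matrix.J (Fin n) ℂ = -sympJ n := by simp [Matrix.J, sympJ, fromBlocks_neg]
  have h1 : (sympToGL B).1ᵀ * sympJ n * (sympToGL B).1 = sympJ n := by
    have := SymplecticGroup.mem_iff'.1 B.2
    rw [h] at this
    have h' : (B : Matrix _ _ ℂ)ᵀ * sympJ n * (B : Matrix _ _ ℂ) = sympJ n := by simpa using this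
    exact h'
  have h2 : sympJ n * (sympToGL B).2 = (sympToGL B).1ᵀ * sympJ n := by
    conv_lhs => rw [← h1]
    rw [Matrix.mul_assoc, (sympToGL B).3, Matrix.mul_one]
  rw [h2, Matrix.mul_assoc, hJ, Matrix.mul_neg, Matrix.mul_one, neg_neg]

/-- `Ad diag(diag(α, α⁻¹), B)` on `osp(2,2n)`, for `α ≠ 0` and a symplectic matrix `B`. -/
def ospAd {n : ℕ} (α : ℂˣ) (B : symplecticGroup (Fin n) ℂ) : ospSpace n →ₗ[ℂ] ospSpace n :=
  ((matrixAd (blockDiag (torusMatrix α) (sympToGL B))).comp (ospSpace n).subtype).codRestrict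
    (ospSpace n) fun X => by
    have hX := X.2
    rw [LinearMap.comp_apply, Submodule.subtype_apply]
    rw [← fromBlocks_toBlocks X.1] at hX ⊢
    generalize X.1.toBlocks₁₁ = a, X.1.toBlocks₁₂ = b, X.1.toBlocks₂₁ = c,
      X.1.toBlocks₂₂ = d at hX ⊢
    obtain ⟨ha, hd, rfl⟩ := fromBlocks_mem_ospSpace.1 hX
    have hJ := sympJ_mul_self n
    have hQ := symQ_mul_self
    have hJ' : ∀ {k : Type} (Z : Matrix (Fin n ⊕ Fin n) k ℂ), sympJ n * (sympJ n * Z) = -Z := by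
      intro k Z; rw [← Matrix.mul_assoc, hJ, Matrix.neg_mul, Matrix.one_mul]
    have hQ' : ∀ {k : Type} (Z : Matrix (Fin 2) k ℂ), symQ * (symQ * Z) = Z := by
      intro k Z; rw [← Matrix.mul_assoc, hQ, Matrix.one_mul]
    have hA1 : (torusMatrix α).1ᵀ = symQ * (torusMatrix α).2 * symQ := by
      ext i j; fin_cases i <;> fin_cases j <;> simp [torusMatrix, symQ]
    have hA2 : (torusMatrix α).2ᵀ = symQ * (torusMatrix α).1 * symQ := by
      ext i j; fin_cases i <;> fin_cases j <;> simp [torusMatrix, symQ]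
    have hB1 := sympToGL_transpose B
    have hB2 : (sympToGL B).2ᵀ = -(sympJ n * (sympToGL B).1 * sympJ n) := by
      have := sympToGL_transpose B⁻¹
      simpa [sympToGL] using this
    rw [matrixAd_blockDiag, fromBlocks_mem_ospSpace]
    refine ⟨?_, ?_, ?_⟩ <;>
    simp only [transpose_mul, ha, hd, hA1, hA2, hB1, hB2, Matrix.mul_neg, Matrix.neg_mul,
      Matrix.mul_assoc, hJ', hQ, hQ', neg_neg, Matrix.mul_one]

/-- `H_p^{2n} = diag(S_p^n, S_p^n)`. -/
def hermH (n p : ℕ) : symplecticGroup (Fin n) ℂ :=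
  ⟨fromBlocks (signMatrix n p).1 0 0 (signMatrix n p).1, by
    rw [SymplecticGroup.mem_iff, Matrix.J, fromBlocks_transpose, fromBlocks_multiply,
      fromBlocks_multiply]
    have h : (signMatrix n p).1 * (signMatrix n p).1 = 1 := (signMatrix n p).3
    have ht : (signMatrix n p).1ᵀ = (signMatrix n p).1 := diagonal_transpose _
    simp [ht, h]⟩

/-- `i S_n^{2n} = diag(i I_n, -i I_n)`. -/
def antiHermH (n : ℕ) : symplecticGroup (Fin n) ℂ :=
  ⟨Complex.I • fromBlocks 1 0 0 (-1), by
    rw [SymplecticGroup.mem_iff, Matrix.J, transpose_smul, fromBlocks_transpose, smul_mul_assoc,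
      smul_mul_assoc, mul_smul_comm, smul_smul, fromBlocks_multiply,
      fromBlocks_multiply]
    simp [fromBlocks_neg]⟩

/-- The imaginary unit as an invertible complex number. -/
def unitI : ℂˣ := Units.mk0 Complex.I Complex.I_ne_zero

theorem torusMatrix_one : (torusMatrix 1).1 = 1 := by
  ext i j; fin_cases i <;> fin_cases j <;> simp [torusMatrix]

theorem torusMatrix_neg (α : ℂˣ) : (torusMatrix (-α)).1 = -(torusMatrix α).1 := by
  ext i j; fin_cases i <;> fin_cases j <;> simp [torusMatrix, inv_neg]

theorem torusMatrix_unitI : (torusMatrix unitI).1 = !![Complex.I, 0; 0, -Complex.I] := by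
  ext i j; fin_cases i <;> fin_cases j <;> simp [torusMatrix, unitI]

end osp

end

/-! A conjugation σ is determined by its restriction to 𝔤_1: it carries 𝔤_1 onto 𝔤_{-1}, its square
is -1 on 𝔤_1, and in all the algebras at hand 𝔤_{±1} together with [𝔤_1, 𝔤_{-1}] span everything
(`psl_generated`, `osp_generated`). Hence equivalence can be tested on 𝔤_1 (`equivalent_of_eqOn`).
The problem becomes one of linear algebra: find the anti-linear maps 𝔤_1 → 𝔤_{-1} compatible with
the triple product [[𝔤_1, 𝔤_{-1}], 𝔤_1], up to graded automorphisms. Block diagonal `Ad`s suffice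
for this, except for psl(1,1).

For psl(m,n), the composite σ̃₁σ is a linear graded automorphism. Such automorphisms preserve rank
one elements of 𝔤_1, because for m, n ≥ 2 these are singled out by a condition on brackets and
degrees (`IsMinimal`). A bijective linear map preserving rank at most one is b ↦ PbQ or b ↦ PbᵗQ
(`eq_mul_mul_or_eq_mul_transpose_mul`), so on 𝔤_1 either σ(b) = D b̄ᵗ C or σ(b) = E b̄ G, the latter
only for m = n ≥ 2 (`psl_conjugation_form`). The triple product then makes C and D Hermitian after a
scalar adjustment, and Sylvester's law brings them to signature matrices
(`psl_conjugation_hermitian`, `psl_equivalent_sign`). In the second form it makes G a purely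
imaginary multiple of Ē, and the sign of that multiple selects τ_+ or τ_-
(`psl_conjugation_tau_form`, `psl_equivalent_tau`). The abelian psl(1,1) carries no triple product
information, but has an additional scaling automorphism instead (`psl_one_one_equivalent`).

For osp(2,2n), both 𝔤_1 and 𝔤_{-1} are copies of the symplectic space ℂ^{2n}, with form ω. There σ
becomes an anti-linear bijection j, and taking a trace in the triple product identity forces j² = μ
with μ real and ω(jx, jy) = -μ · conj ω(x, y) (`exists_sq_eq_smul_of_triple`). After rescaling μ =
±1. A Gram–Schmidt process for the Hermitian form ω(jx, y) produces a Darboux basis adapted to j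
(`exists_adapted_system`). For μ = 1 all signs can be made positive, because j exchanges positive
and negative vectors; this gives the anti-Hermitian entry of the list. For μ = -1 the signature
survives and gives H_p. -/

namespace GradedLieSuperalgebra

/-! ### Conjugations and graded automorphisms; reduction to 𝔤_1. -/

variable {L : Type*} [AddCommGroup L] [Module ℂ L] {G : GradedLieSuperalgebra L}

theorem iSup_deg (G : GradedLieSuperalgebra L) : ⨆ j, G.deg j = ⊤ :=
  G.deg_isInternal.submodule_iSup_eq_top

/-- A bracket-preserving anti-linear map which sends `deg j` into `deg (-j)`, preserves parity and
squares to `(-1)^k` on `deg k` is an anti-linear graded conjugation. -/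
theorem IsAntilinearGradedConjugation.of_mapsTo {φ : L →ₛₗ[starRingEnd ℂ] L}
    (hb : ∀ x y, φ (G.bracket x y) = G.bracket (φ x) (φ y))
    (hp : ∀ i, ∀ x ∈ G.part i, φ x ∈ G.part i)
    (hd : ∀ j, ∀ x ∈ G.deg j, φ x ∈ G.deg (-j))
    (hs : ∀ k x, x ∈ G.deg k → φ (φ x) = (-1 : ℂ) ^ k • x) :
    G.IsAntilinearGradedConjugation φ := by
  -- On `deg k` the fourth power is (-1)^{2k} = 1. So φ³ inverts φ, and the assumed inclusions
  -- become equalities.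
  have h4 : ∀ x, φ (φ (φ (φ x))) = x := by
    intro x
    have hx : x ∈ ⨆ j, G.deg j := by rw [iSup_deg]; trivial
    induction hx using Submodule.iSup_induction' with
    | mem k x hx =>
      rw [hs k x hx, hs k _ (Submodule.smul_mem _ _ hx), smul_smul, ← mul_zpow]
      simp
    | zero => simp
    | add x y _ _ hx hy => simp [hx, hy]
  refine ⟨⟨fun x y h => ?_, fun x => ⟨_, h4 x⟩⟩, hb, fun i => ?_, fun j => ?_, hs⟩
  · rw [← h4 x, h, h4]
  · refine le_antisymm ?_ fun x hx => ⟨_, hp _ _ (hp _ _ (hp _ _ hx)), h4 x⟩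
    rintro _ ⟨x, hx, rfl⟩
    exact hp i x hx
  · refine le_antisymm ?_ fun x hx => ?_
    · rintro _ ⟨x, hx, rfl⟩
      exact hd j x hx
    · have h3 := hd _ _ (hd _ _ (hd _ _ hx))
      simp only [neg_neg] at h3
      exact ⟨_, h3, h4 x⟩

/-- A bracket-preserving linear equivalence which, together with its inverse, preserves parity and
degree is a graded automorphism. -/
theorem IsGradedAutomorphism.of_mapsTo {φ : L ≃ₗ[ℂ] L}
    (hb : ∀ x y, φ (G.bracket x y) = G.bracket (φ x) (φ y))
    (hp : ∀ i, ∀ x ∈ G.part i, φ x ∈ G.part i) (hp' : ∀ i, ∀ x ∈ G.part i, φ.symm x ∈ G.part i)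
    (hd : ∀ j, ∀ x ∈ G.deg j, φ x ∈ G.deg j) (hd' : ∀ j, ∀ x ∈ G.deg j, φ.symm x ∈ G.deg j) :
    G.IsGradedAutomorphism φ := by
  refine ⟨hb, fun i => ?_, fun j => ?_⟩
  · refine le_antisymm ?_ fun x hx => ⟨_, hp' _ _ hx, φ.apply_symm_apply x⟩
    rintro _ ⟨x, hx, rfl⟩
    exact hp i x hx
  · refine le_antisymm ?_ fun x hx => ⟨_, hd' _ _ hx, φ.apply_symm_apply x⟩
    rintro _ ⟨x, hx, rfl⟩
    exact hd j x hx

theorem IsAntilinearGradedConjugation.mem_part {φ : L →ₛₗ[starRingEnd ℂ] L}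
    (h : G.IsAntilinearGradedConjugation φ) {i : ZMod 2} {x : L} (hx : x ∈ G.part i) :
    φ x ∈ G.part i := h.map_part i ▸ Submodule.mem_map_of_mem hx

theorem IsAntilinearGradedConjugation.mem_deg {φ : L →ₛₗ[starRingEnd ℂ] L}
    (h : G.IsAntilinearGradedConjugation φ) {j : ℤ} {x : L} (hx : x ∈ G.deg j) :
    φ x ∈ G.deg (-j) := h.map_deg j ▸ Submodule.mem_map_of_mem hx

theorem IsAntilinearGradedConjugation.apply_apply_one {φ : L →ₛₗ[starRingEnd ℂ] L}
    (h : G.IsAntilinearGradedConjugation φ) {x : L} (hx : x ∈ G.deg 1) : φ (φ x) = -x := by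
  simpa using h.sq 1 x hx

theorem IsGradedAutomorphism.mem_part {φ : L ≃ₗ[ℂ] L} (h : G.IsGradedAutomorphism φ)
    {i : ZMod 2} {x : L} (hx : x ∈ G.part i) : φ x ∈ G.part i :=
  h.map_part i ▸ Submodule.mem_map_of_mem (f := (φ : L →ₗ[ℂ] L)) hx

theorem IsGradedAutomorphism.mem_deg {φ : L ≃ₗ[ℂ] L} (h : G.IsGradedAutomorphism φ)
    {j : ℤ} {x : L} (hx : x ∈ G.deg j) : φ x ∈ G.deg j :=
  h.map_deg j ▸ Submodule.mem_map_of_mem (f := (φ : L →ₗ[ℂ] L)) hx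

theorem IsGradedAutomorphism.symm {φ : L ≃ₗ[ℂ] L} (h : G.IsGradedAutomorphism φ) :
    G.IsGradedAutomorphism φ.symm := by
  refine .of_mapsTo (fun x y => ?_) (fun i x hx => ?_) (fun i x hx => h.mem_part hx)
    (fun j x hx => ?_) (fun j x hx => h.mem_deg hx)
  · rw [LinearEquiv.symm_apply_eq, h.map_bracket, φ.apply_symm_apply, φ.apply_symm_apply]
  · rw [← h.map_part i] at hx
    obtain ⟨y, hy, rfl⟩ := hx
    simpa using hy
  · rw [← h.map_deg j] at hx
    obtain ⟨y, hy, rfl⟩ := hx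
    simpa using hy

/-- Conjugating by a graded automorphism preserves anti-linear graded conjugations. -/
theorem IsAntilinearGradedConjugation.conj {σ : L →ₛₗ[starRingEnd ℂ] L}
    (h : G.IsAntilinearGradedConjugation σ) {φ : L ≃ₗ[ℂ] L} (hφ : G.IsGradedAutomorphism φ) :
    G.IsAntilinearGradedConjugation ((φ : L →ₗ[ℂ] L).comp (σ.comp (φ.symm : L →ₗ[ℂ] L))) := by
  refine .of_mapsTo (fun x y => ?_) (fun i x hx => ?_) (fun i x hx => ?_) (fun k x hx => ?_)
  · simp [hφ.symm.map_bracket, h.map_bracket, hφ.map_bracket]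
  · exact hφ.mem_part (h.mem_part (hφ.symm.mem_part hx))
  · exact hφ.mem_deg (h.mem_deg (hφ.symm.mem_deg hx))
  · simp [h.sq k _ (hφ.symm.mem_deg hx)]

/-- If `𝔤` is generated by `𝔤_1 + 𝔤_{-1}` in the strong sense `𝔤_0 = [𝔤_1, 𝔤_{-1}]`, then an
anti-linear graded conjugation is determined by its restriction to `𝔤_1`. -/
theorem IsAntilinearGradedConjugation.eq_of_eqOn {σ τ : L →ₛₗ[starRingEnd ℂ] L}
    (hσ : G.IsAntilinearGradedConjugation σ) (hτ : G.IsAntilinearGradedConjugation τ)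
    (hgen : ∀ N : Submodule ℂ L, G.deg 1 ≤ N → G.deg (-1) ≤ N →
      (∀ x ∈ G.deg 1, ∀ y ∈ G.deg (-1), G.bracket x y ∈ N) → N = ⊤)
    (h : ∀ x ∈ G.deg 1, σ x = τ x) : σ = τ := by
  -- Write y = σx = τx with x in 𝔤_1; then σy = -x = τy.
  have h' : ∀ y ∈ G.deg (-1), σ y = τ y := by
    intro y hy
    rw [← hσ.map_deg 1] at hy
    obtain ⟨x, hx, rfl⟩ := hy
    rw [hσ.apply_apply_one hx, h x hx, hτ.apply_apply_one hx]
  have := hgen (LinearMap.eqLocus σ τ) h h' fun x hx y hy => by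
    show σ _ = τ _
    rw [hσ.map_bracket, hτ.map_bracket, h x hx, h' y hy]
  ext x
  have hx : x ∈ LinearMap.eqLocus σ τ := by rw [this]; trivial
  exact hx

/-- Equivalence of anti-linear graded conjugations can be tested on `𝔤_1`. -/
theorem IsAntilinearGradedConjugation.equivalent_of_eqOn {σ τ : L →ₛₗ[starRingEnd ℂ] L}
    (hσ : G.IsAntilinearGradedConjugation σ) (hτ : G.IsAntilinearGradedConjugation τ)
    (hgen : ∀ N : Submodule ℂ L, G.deg 1 ≤ N → G.deg (-1) ≤ N →
      (∀ x ∈ G.deg 1, ∀ y ∈ G.deg (-1), G.bracket x y ∈ N) → N = ⊤)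
    {φ : L ≃ₗ[ℂ] L} (hφ : G.IsGradedAutomorphism φ)
    (h : ∀ x ∈ G.deg 1, τ (φ x) = φ (σ x)) : G.Equivalent σ τ := by
  refine ⟨φ, hφ, fun x => ?_⟩
  -- Uniqueness is applied to τ and to the conjugate φσφ⁻¹, which is again a graded conjugation.
  have := hτ.eq_of_eqOn (hσ.conj hφ) hgen fun x hx => by
    simpa using h _ (hφ.symm.mem_deg hx)
  rw [this]
  rfl

end GradedLieSuperalgebra

/-! ### Sylvester's law of inertia. -/

section

open Matrix

/-- A predicate on `Fin n` can be sorted by a permutation. -/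
theorem exists_perm_iff_lt {n : ℕ} (q : Fin n → Prop) :
    ∃ p ≤ n, ∃ e : Equiv.Perm (Fin n), ∀ i, q (e i) ↔ i.val < p := by
  classical
  have hle : Fintype.card {i // q i} ≤ n := by
    simpa using Fintype.card_subtype_le q
  refine ⟨_, hle, ?_⟩
  -- With p the number of indices satisfying `q`, the initial segment of length p is equinumerous
  -- with them, and a bijection between the two subsets extends to a permutation.
  have hc : Fintype.card {i : Fin n // i.val < Fintype.card {i // q i}} =
      Fintype.card {i // q i} := by
    rw [Fintype.card_subtype, Fin.card_filter_val_lt, min_eq_right hle]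
  let e := Fintype.equivOfCardEq hc
  refine ⟨e.extendSubtype, fun i => ⟨fun h => ?_, fun h => e.extendSubtype_mem i h⟩⟩
  by_contra hi
  exact e.extendSubtype_not_mem i hi h

/-- Sylvester's law: an invertible Hermitian matrix is congruent to some `diag(I_p, -I_{n-p})`. -/
theorem exists_congr_signMatrix {n : ℕ} {C : Matrix (Fin n) (Fin n) ℂ} (hC : C.IsHermitian)
    (hu : IsUnit C) : ∃ p ≤ n, ∃ A : GL (Fin n) ℂ, A.1 * C * A.1ᴴ = (signMatrix n p).1 := by
  have hl : ∀ i, hC.eigenvalues i ≠ 0 := by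
    have h1 : C.det ≠ 0 := ((Matrix.isUnit_iff_isUnit_det C).1 hu).ne_zero
    rw [hC.det_eq_prod_eigenvalues, Finset.prod_ne_zero_iff] at h1
    intro i hi
    exact h1 i (Finset.mem_univ i) (by simp [hi])
  set U : Matrix (Fin n) (Fin n) ℂ := hC.eigenvectorUnitary.1 with hU
  have hUU : Uᴴ * U = 1 := Unitary.coe_star_mul_self hC.eigenvectorUnitary
  set l := hC.eigenvalues with hl'
  have hsp : Uᴴ * C * U = diagonal (fun i => (l i : ℂ)) := by
    have h2 : C = U * diagonal (fun i => (l i : ℂ)) * Uᴴ := hC.spectral_theorem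
    rw [h2]
    calc _ = (Uᴴ * U) * diagonal (fun i => (l i : ℂ)) * (Uᴴ * U) := by noncomm_ring
      _ = _ := by rw [hUU, Matrix.one_mul, Matrix.mul_one]
  obtain ⟨p, hp, e, he⟩ := exists_perm_iff_lt fun i => 0 < l i
  -- Scaling the i-th eigenvector by |l i|^{-1/2} turns the eigenvalue into its sign.
  let r : Fin n → ℂ := fun i => ((Real.sqrt |l i|)⁻¹ : ℝ)
  let A' : Matrix (Fin n) (Fin n) ℂ := diagonal r * Uᴴ
  have hA' : A' * C * A'ᴴ = diagonal fun i => if 0 < l i then 1 else -1 := by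
    have hr : (diagonal r)ᴴ = diagonal r := by
      rw [diagonal_conjTranspose]
      congr 1
      ext i
      simp [r]
    calc A' * C * A'ᴴ = diagonal r * (Uᴴ * C * U) * diagonal r := by
          simp only [A', conjTranspose_mul, conjTranspose_conjTranspose, hr, Matrix.mul_assoc]
      _ = _ := by
        rw [hsp, diagonal_mul_diagonal, diagonal_mul_diagonal]
        congr 1
        ext i
        have hs : Real.sqrt |l i| * Real.sqrt |l i| = |l i| := Real.mul_self_sqrt (abs_nonneg _)
        have h0 : |l i| ≠ 0 := abs_ne_zero.2 (hl i)
        have h3 : (Real.sqrt |l i|)⁻¹ * l i * (Real.sqrt |l i|)⁻¹ = if 0 < l i then 1 else -1 := by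
          rw [mul_right_comm, ← mul_inv, hs]
          split_ifs with h
          · rw [abs_of_pos h, inv_mul_cancel₀ (hl i)]
          · rw [abs_of_neg (lt_of_le_of_ne (not_lt.1 h) (hl i)), inv_neg, neg_mul,
              inv_mul_cancel₀ (hl i)]
        have h4 := congrArg (fun x : ℝ => (x : ℂ)) h3
        simp only [Complex.ofReal_mul] at h4
        rw [show r i = (((Real.sqrt |l i|)⁻¹ : ℝ) : ℂ) from rfl, h4]
        split_ifs <;> simp
  -- Permuting the rows of A' conjugates the diagonal matrix of signs by e, which moves the positive
  -- signs to the front.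
  have hA : A'.submatrix e id * C * (A'.submatrix e id)ᴴ = (signMatrix n p).1 := by
    have h5 : A'.submatrix e id * C * (A'.submatrix e id)ᴴ = (A' * C * A'ᴴ).submatrix e e := by
      ext i j
      simp [Matrix.mul_apply]
    rw [h5, hA', submatrix_diagonal_equiv, signMatrix]
    congr 1
    ext i
    simp [he]
  have hd : (A'.submatrix e id).det ≠ 0 := by
    intro h0
    have h6 := congrArg det hA
    rw [det_mul, det_mul, h0, zero_mul, zero_mul] at h6
    exact ((Matrix.isUnit_iff_isUnit_det _).1 (signMatrix n p).isUnit).ne_zero h6.symm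
  exact ⟨p, hp, GeneralLinearGroup.mkOfDetNeZero _ hd, hA⟩

end

/-! ### Linear bijections preserving matrices of rank at most one. -/

section

open Matrix

/-- `x` and `y` are linearly dependent, expressed by the vanishing of their `2 × 2` minors. -/
def Proportional {ι : Type*} (x y : ι → ℂ) : Prop := ∀ i k, x i * y k = x k * y i

section RankOne

variable {α β ι κ : Type*}

theorem Proportional.symm {x y : ι → ℂ} (h : Proportional x y) : Proportional y x := by
  intro i k
  rw [mul_comm, h k i, mul_comm]

theorem Proportional.exists_smul {x y : ι → ℂ} (h : Proportional x y) (hx : x ≠ 0) :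
    ∃ c : ℂ, y = c • x := by
  obtain ⟨i, hi⟩ := Function.ne_iff.1 hx
  refine ⟨y i / x i, funext fun k => ?_⟩
  have hi' : x i ≠ 0 := hi
  have := h i k
  simp only [Pi.smul_apply, smul_eq_mul]
  field_simp
  linear_combination this

/-- The vectors proportional to `x`. -/
def proportionalSubmodule (x : ι → ℂ) : Submodule ℂ (ι → ℂ) where
  carrier := {y | Proportional x y}
  zero_mem' := by intro i k; simp
  add_mem' := by
    intro y z hy hz i k
    simp only [Pi.add_apply]
    linear_combination hy i k + hz i k
  smul_mem' := by
    intro c y hy i k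
    simp only [Pi.smul_apply, smul_eq_mul]
    linear_combination c * hy i k

/-- If a sum of two rank one matrices has rank at most one, then the column vectors or the row
vectors are linearly dependent. -/
theorem proportional_or_of_add_eq {x x' z : ι → ℂ} {y y' w : κ → ℂ}
    (h : vecMulVec x y + vecMulVec x' y' = vecMulVec z w) :
    Proportional x x' ∨ Proportional y y' := by
  by_contra hc
  simp only [Proportional, not_or, not_forall] at hc
  obtain ⟨⟨i, k, hik⟩, j, l, hjl⟩ := hc
  have e : ∀ i j, x i * y j + x' i * y' j = z i * w j := fun i j => congrFun (congrFun h i) j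
  -- The 2 × 2 minor of x⊗y + x'⊗y' factors as the minor of (x, x') times the minor of (y, y'); it
  -- vanishes because z⊗w has rank at most one.
  have h0 : (x i * x' k - x k * x' i) * (y j * y' l - y l * y' j) = 0 := by
    have : (x i * y j + x' i * y' j) * (x k * y l + x' k * y' l) =
        (x i * y l + x' i * y' l) * (x k * y j + x' k * y' j) := by
      rw [e, e, e, e]; ring
    linear_combination this
  rcases mul_eq_zero.1 h0 with h1 | h1
  · exact hik (sub_eq_zero.1 h1)
  · exact hjl (sub_eq_zero.1 h1)

/-- All values of `f` have the form `x ⊗ y` with `x` fixed. -/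
def IsRowType {V : Type*} (f : V → Matrix ι κ ℂ) : Prop := ∃ x, ∀ v, ∃ y, f v = vecMulVec x y

/-- All values of `f` have the form `x ⊗ y` with `y` fixed. -/
def IsColType {V : Type*} (f : V → Matrix ι κ ℂ) : Prop := ∃ y, ∀ v, ∃ x, f v = vecMulVec x y

theorem vecMulVec_zero_right (x : ι → ℂ) : vecMulVec x (0 : κ → ℂ) = 0 := by
  ext i j; simp [vecMulVec_apply]

theorem IsColType.transpose {V : Type*} {f : V → Matrix ι κ ℂ} (h : IsColType f) :
    IsRowType fun v => (f v)ᵀ := by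
  obtain ⟨y, hy⟩ := h
  refine ⟨y, fun v => ?_⟩
  obtain ⟨x, hx⟩ := hy v
  exact ⟨x, by simp only [hx, transpose_vecMulVec]⟩

/-- A linear space of matrices of rank at most one has a common column or a common row. -/
theorem isRowType_or_isColType {V : Type*} [AddCommGroup V] [Module ℂ V]
    (f : V →ₗ[ℂ] Matrix ι κ ℂ) (hf : ∀ v, ∃ x y, f v = vecMulVec x y) :
    IsRowType f ∨ IsColType f := by
  choose x y hxy using hf
  by_cases h0 : ∀ v, f v = 0
  · exact Or.inl ⟨0, fun v => ⟨0, by simp [h0]⟩⟩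
  push Not at h0
  obtain ⟨v₀, hv₀⟩ := h0
  have hx₀ : x v₀ ≠ 0 := fun h => hv₀ (by rw [hxy, h, zero_vecMulVec])
  have hy₀ : y v₀ ≠ 0 := fun h => hv₀ (by rw [hxy, h, vecMulVec_zero_right])
  have hadd : ∀ v w, Proportional (x v) (x w) ∨ Proportional (y v) (y w) := fun v w =>
    proportional_or_of_add_eq (z := x (v + w)) (w := y (v + w))
      (by rw [← hxy, ← hxy, ← hxy, map_add])
  by_cases h1 : ∀ v, ∃ y, f v = vecMulVec (x v₀) y
  · exact Or.inl ⟨x v₀, h1⟩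
  push Not at h1
  obtain ⟨v₁, hv₁⟩ := h1
  -- Since v₁ is a witness against the common column x v₀, its column vector is independent of x v₀,
  -- and `hadd` forces the rows of v₀ and v₁ to be dependent. The claim is that y v₀ is then a
  -- common row.
  have hx₁ : ¬ Proportional (x v₀) (x v₁) := by
    intro h
    obtain ⟨c, hc⟩ := h.exists_smul hx₀
    exact hv₁ (c • y v₁) (by rw [hxy v₁, hc, smul_vecMulVec, vecMulVec_smul])
  obtain ⟨c₁, hc₁⟩ := ((hadd v₀ v₁).resolve_left hx₁).exists_smul hy₀
  have hc₁0 : c₁ ≠ 0 := by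
    rintro rfl
    exact hv₁ 0 (by rw [hxy v₁, hc₁, zero_smul, vecMulVec_zero_right, vecMulVec_zero_right])
  refine Or.inr ⟨y v₀, fun v => ?_⟩
  by_cases hy : Proportional (y v₀) (y v)
  · obtain ⟨c, hc⟩ := hy.exists_smul hy₀
    exact ⟨c • x v, by rw [hxy v, hc, smul_vecMulVec, vecMulVec_smul]⟩
  obtain ⟨c, hc⟩ := ((hadd v₀ v).resolve_right hy).exists_smul hx₀
  by_cases hxv : c = 0
  · exact ⟨0, by rw [hxy v, hc, hxv, zero_smul, zero_vecMulVec, zero_vecMulVec]⟩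
  -- Here x v is a nonzero multiple of x v₀ and y v₁ a nonzero multiple of y v₀. The dependence of
  -- v₁ and v given by `hadd` thus passes to x v₀, x v₁ or to y v₀, y v, both of which are
  -- independent.
  exfalso
  rcases hadd v₁ v with h2 | h2
  · apply hx₁
    intro i k
    have := h2 i k
    rw [hc] at this
    simp only [Pi.smul_apply, smul_eq_mul] at this
    have h3 : c * (x v₀ i * x v₁ k - x v₀ k * x v₁ i) = 0 := by linear_combination -this
    exact sub_eq_zero.1 ((mul_eq_zero.1 h3).resolve_left hxv)
  · apply hy
    intro i k
    have := h2 i k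
    rw [hc₁] at this
    simp only [Pi.smul_apply, smul_eq_mul] at this
    have h3 : c₁ * (y v₀ i * y v k - y v₀ k * y v i) = 0 := by linear_combination this
    exact sub_eq_zero.1 ((mul_eq_zero.1 h3).resolve_left hc₁0)

/-- A vector space is not the union of two proper subspaces. -/
theorem Submodule.eq_top_or_eq_top_of_union {V : Type*} [AddCommGroup V] [Module ℂ V]
    (M N : Submodule ℂ V) (h : ∀ v, v ∈ M ∨ v ∈ N) : M = ⊤ ∨ N = ⊤ := by
  by_contra hc
  simp only [not_or, Submodule.eq_top_iff', not_forall] at hc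
  obtain ⟨⟨a, ha⟩, b, hb⟩ := hc
  have haN := (h a).resolve_left ha
  have hbM := (h b).resolve_right hb
  rcases h (a + b) with h1 | h1
  · exact ha (by simpa using sub_mem h1 hbM)
  · exact hb (by simpa using sub_mem h1 haN)

/-- A linear functional extracting the vector `x` from `x ⊗ y` for fixed `y ≠ 0`. -/
theorem exists_linear_of_colType {V : Type*} [AddCommGroup V] [Module ℂ V]
    (f : V →ₗ[ℂ] Matrix ι κ ℂ) {y : κ → ℂ} (hf : ∀ v, ∃ x, f v = vecMulVec x y) :
    ∃ g : V →ₗ[ℂ] ι → ℂ, ∀ v, f v = vecMulVec (g v) y := by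
  by_cases hy : y = 0
  · refine ⟨0, fun v => ?_⟩
    obtain ⟨x, hx⟩ := hf v
    rw [hx, hy, vecMulVec_zero_right, vecMulVec_zero_right]
  obtain ⟨j, hj⟩ := Function.ne_iff.1 hy
  have hj' : y j ≠ 0 := hj
  refine ⟨{ toFun := fun v i => f v i j / y j
            map_add' := fun v w => by ext i; simp [add_div]
            map_smul' := fun c v => by ext i; simp [mul_div_assoc] }, fun v => ?_⟩
  obtain ⟨x, hx⟩ := hf v
  ext i k
  simp [hx, vecMulVec_apply, hj']

theorem exists_linear_of_rowType {V : Type*} [AddCommGroup V] [Module ℂ V]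
    (f : V →ₗ[ℂ] Matrix ι κ ℂ) {x : ι → ℂ} (hf : ∀ v, ∃ y, f v = vecMulVec x y) :
    ∃ g : V →ₗ[ℂ] κ → ℂ, ∀ v, f v = vecMulVec x (g v) := by
  obtain ⟨g, hg⟩ := exists_linear_of_colType
    (((transposeLinearEquiv ι κ ℂ ℂ).toLinearMap).comp f) (y := x) fun v => by
      obtain ⟨y, hy⟩ := hf v
      exact ⟨y, by simp [hy, transpose_vecMulVec]⟩
  refine ⟨g, fun v => ?_⟩
  have := congrArg transpose (hg v)
  simpa [transpose_vecMulVec] using this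

/-- In a bilinear family of matrices of rank at most one, the slices have a uniform type. -/
theorem forall_isRowType_or_forall_isColType {V W : Type*} [AddCommGroup V] [Module ℂ V]
    [AddCommGroup W] [Module ℂ W] (B : V →ₗ[ℂ] W →ₗ[ℂ] Matrix ι κ ℂ)
    (hB : ∀ u v, ∃ x y, B u v = vecMulVec x y) :
    (∀ u, IsRowType (B u)) ∨ (∀ u, IsColType (B u)) := by
  by_contra hc
  simp only [not_or, not_forall] at hc
  obtain ⟨⟨u₂, h₂⟩, u₁, h₁⟩ := hc
  obtain ⟨x₁, hx₁⟩ := (isRowType_or_isColType (B u₁) (hB u₁)).resolve_right h₁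
  obtain ⟨y₂, hy₂⟩ := (isRowType_or_isColType (B u₂) (hB u₂)).resolve_left h₂
  obtain ⟨g, hg⟩ := exists_linear_of_rowType _ hx₁
  obtain ⟨k, hk⟩ := exists_linear_of_colType _ hy₂
  have hx0 : x₁ ≠ 0 := by
    rintro rfl
    exact h₁ ⟨0, fun v => ⟨0, by rw [hg, zero_vecMulVec, zero_vecMulVec]⟩⟩
  have hy0 : y₂ ≠ 0 := by
    rintro rfl
    exact h₂ ⟨0, fun v => ⟨0, by rw [hk, vecMulVec_zero_right, vecMulVec_zero_right]⟩⟩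
  -- The slice at u₁ + u₂ sends v to x₁⊗g(v) + k(v)⊗y₂, of rank at most one, so each v satisfies
  -- k(v) ∥ x₁ or g(v) ∥ y₂. Both conditions are linear in v, so one holds for all v. The first
  -- would make u₂ of row type, the second u₁ of column type.
  rcases Submodule.eq_top_or_eq_top_of_union ((proportionalSubmodule x₁).comap k)
    ((proportionalSubmodule y₂).comap g) (fun v => by
      obtain ⟨z, w, hzw⟩ := hB (u₁ + u₂) v
      rw [map_add, LinearMap.add_apply, hg, hk] at hzw
      exact (proportional_or_of_add_eq hzw).imp id fun h => h.symm) with h | h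
  · refine h₂ ⟨x₁, fun v => ?_⟩
    have hv : v ∈ (proportionalSubmodule x₁).comap k := h ▸ Submodule.mem_top
    obtain ⟨c, hc⟩ := Proportional.exists_smul hv hx0
    exact ⟨c • y₂, by rw [hk, hc, smul_vecMulVec, vecMulVec_smul]⟩
  · refine h₁ ⟨y₂, fun v => ?_⟩
    have hv : v ∈ (proportionalSubmodule y₂).comap g := h ▸ Submodule.mem_top
    obtain ⟨c, hc⟩ := Proportional.exists_smul hv hy0
    exact ⟨c • x₁, by rw [hg, hc, smul_vecMulVec, vecMulVec_smul]⟩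

/-- A linear map pointwise proportional to an injective one is a multiple of it. -/
theorem exists_eq_smul_of_forall_proportional {V W : Type*} [AddCommGroup V] [Module ℂ V]
    [AddCommGroup W] [Module ℂ W] {q g : V →ₗ[ℂ] W} (hq : Function.Injective q)
    (h : ∀ v, ∃ c : ℂ, g v = c • q v) : ∃ c : ℂ, g = c • q := by
  choose c hc using h
  by_cases h0 : ∀ v : V, v = 0
  · exact ⟨0, LinearMap.ext fun v => by simp [h0 v]⟩
  push Not at h0
  obtain ⟨a, ha⟩ := h0
  refine ⟨c a, LinearMap.ext fun v => ?_⟩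
  rw [LinearMap.smul_apply]
  by_cases hv : ∃ t : ℂ, v = t • a
  · obtain ⟨t, rfl⟩ := hv
    rw [map_smul, map_smul, hc a, smul_comm]
  push Not at hv
  have h1 := hc (a + v)
  rw [map_add, hc a, hc v, map_add, smul_add] at h1
  -- Comparing the factors at a, v and a + v gives a linear relation between a and v; as v is not a
  -- multiple of a, all three factors agree.
  have h2 : q ((c v - c (a + v)) • v) = q ((c (a + v) - c a) • a) := by
    rw [map_smul, map_smul, sub_smul, sub_smul, sub_eq_sub_iff_add_eq_add, add_comm, h1]
  have h3 := hq h2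
  have h4 : c v = c (a + v) := by
    by_contra hne
    refine hv ((c v - c (a + v))⁻¹ * (c (a + v) - c a)) ?_
    rw [mul_smul, ← h3, smul_smul, inv_mul_cancel₀ (sub_ne_zero.2 hne), one_smul]
  rw [h4, sub_self, zero_smul] at h3
  have h5 := (smul_eq_zero.1 h3.symm).resolve_right ha
  rw [hc v, h4, sub_eq_zero.1 h5]

/-- The slices at u and at v₀ share the nonzero value B(u, v₀), so the column of the former is a
multiple of the column of the latter, which does not depend on u. -/
theorem exists_forall_eq_vecMulVec {V W : Type*} [AddCommGroup V] [Module ℂ V]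
    [AddCommGroup W] [Module ℂ W] [Nontrivial W] (B : V →ₗ[ℂ] W →ₗ[ℂ] Matrix ι κ ℂ)
    (hB : ∀ u v, u ≠ 0 → v ≠ 0 → B u v ≠ 0)
    (h : ∀ u, IsRowType (B u)) (h' : ∀ v, IsRowType (B.flip v)) :
    ∃ x, ∀ u v, ∃ y, B u v = vecMulVec x y := by
  obtain ⟨v₀, hv₀⟩ := exists_ne (0 : W)
  obtain ⟨x', hx'⟩ := h' v₀
  refine ⟨x', fun u v => ?_⟩
  by_cases hu : u = 0
  · exact ⟨0, by rw [hu, vecMulVec_zero_right]; simp⟩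
  obtain ⟨x, hx⟩ := h u
  obtain ⟨y, hy⟩ := hx v₀
  obtain ⟨y', hy'⟩ := hx' u
  obtain ⟨w, hw⟩ := hx v
  have h0 := hB u v₀ hu hv₀
  have hy0 : y ≠ 0 := by rintro rfl; exact h0 (by rw [hy, vecMulVec_zero_right])
  obtain ⟨j, hj⟩ := Function.ne_iff.1 hy0
  have hj' : y j ≠ 0 := hj
  have hxx : x = (y' j / y j) • x' := by
    ext i
    have e : x i * y j = x' i * y' j := congrFun (congrFun (hy.symm.trans hy') i) j
    simp only [Pi.smul_apply, smul_eq_mul]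
    field_simp
    linear_combination e
  exact ⟨(y' j / y j) • w, by rw [hw, hxx, smul_vecMulVec, vecMulVec_smul]⟩

/-- The bilinear map `(u, v) ↦ T (u ⊗ v)`. -/
def onVecMulVec (T : Matrix α β ℂ →ₗ[ℂ] Matrix ι κ ℂ) :
    (α → ℂ) →ₗ[ℂ] (β → ℂ) →ₗ[ℂ] Matrix ι κ ℂ :=
  (vecMulVecBilin ℂ ℂ).compr₂ T

theorem onVecMulVec_apply (T : Matrix α β ℂ →ₗ[ℂ] Matrix ι κ ℂ) (u : α → ℂ) (v : β → ℂ) :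
    onVecMulVec T u v = T (vecMulVec u v) := rfl

theorem onVecMulVec_ne_zero (T : Matrix α β ℂ ≃ₗ[ℂ] Matrix ι κ ℂ) (u : α → ℂ) (v : β → ℂ)
    (hu : u ≠ 0) (hv : v ≠ 0) : onVecMulVec T.toLinearMap u v ≠ 0 := by
  obtain ⟨i, hi⟩ := Function.ne_iff.1 hu
  obtain ⟨j, hj⟩ := Function.ne_iff.1 hv
  intro h
  have h1 : vecMulVec u v = 0 := T.injective (h.trans (map_zero T).symm)
  exact mul_ne_zero hi hj (congrFun (congrFun h1 i) j)

variable [Fintype α] [Fintype β] [DecidableEq α] [DecidableEq β]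

theorem Matrix.linearMap_ext_vecMulVec {E : Type*} [AddCommGroup E] [Module ℂ E]
    {f g : Matrix α β ℂ →ₗ[ℂ] E} (h : ∀ u v, f (vecMulVec u v) = g (vecMulVec u v)) : f = g := by
  refine Matrix.ext_linearMap ℂ fun i j => LinearMap.ext_ring ?_
  simpa [single_eq_single_vecMulVec_single] using h (Pi.single i 1) (Pi.single j 1)

theorem mem_of_forall_vecMulVec_mem {E : Type*} [AddCommGroup E] [Module ℂ E]
    (f : Matrix α β ℂ →ₗ[ℂ] E) (N : Submodule ℂ E) (h : ∀ u v, f (vecMulVec u v) ∈ N)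
    (b : Matrix α β ℂ) : f b ∈ N := by
  have h1 : N.mkQ.comp f = 0 := Matrix.linearMap_ext_vecMulVec fun u v => by simpa using h u v
  simpa using LinearMap.congr_fun h1 b

/-- The image of T would consist of matrices x⊗y with one fixed x. As T is onto, this is impossible
once there are two rows. -/
theorem not_isRowType_and_isRowType [Nontrivial ι] [Nonempty κ] [Nonempty β]
    (T : Matrix α β ℂ ≃ₗ[ℂ] Matrix ι κ ℂ) (h : ∀ u, IsRowType (onVecMulVec T.toLinearMap u))
    (h' : ∀ v, IsRowType ((onVecMulVec T.toLinearMap).flip v)) : False := by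
  classical
  obtain ⟨x, hx⟩ := exists_forall_eq_vecMulVec _ (onVecMulVec_ne_zero T) h h'
  have hr : ∀ M : Matrix ι κ ℂ, ∃ y, M = vecMulVec x y := by
    intro M
    have := mem_of_forall_vecMulVec_mem T.toLinearMap
      (LinearMap.range (vecMulVecBilin (n := κ) ℂ ℂ x)) (fun u v => by
        obtain ⟨y, hy⟩ := hx u v
        exact ⟨y, hy.symm⟩) (T.symm M)
    obtain ⟨y, hy⟩ := this
    exact ⟨y, by simpa using hy.symm⟩
  obtain ⟨i, k, hik⟩ := exists_pair_ne ι
  obtain ⟨j⟩ := ‹Nonempty κ›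
  obtain ⟨y, hy⟩ := hr (Matrix.single i j 1)
  obtain ⟨z, hz⟩ := hr (Matrix.single k j 1)
  have e1 : 1 = x i * y j := by simpa [vecMulVec_apply] using congrFun (congrFun hy i) j
  have e2 : 0 = x k * y j := by
    simpa [vecMulVec_apply, Matrix.single_apply, hik] using congrFun (congrFun hy k) j
  have e3 : 1 = x k * z j := by simpa [vecMulVec_apply] using congrFun (congrFun hz k) j
  rcases mul_eq_zero.1 e2.symm with h0 | h0
  · simp [h0] at e3
  · simp [h0] at e1

/-- When fixing u fixes the column and fixing v fixes the row, T(u⊗v) must be a constant times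
p(u)⊗q(v) with p and q linear. The maps p and q are read off from the slices at fixed nonzero v₀ and
u₀, and their matrices give P and Qᵗ. -/
theorem eq_mul_mul_of_isRowType_of_isColType [Nonempty α] [Nonempty β]
    (T : Matrix α β ℂ ≃ₗ[ℂ] Matrix ι κ ℂ) (h : ∀ u, IsRowType (onVecMulVec T.toLinearMap u))
    (h' : ∀ v, IsColType ((onVecMulVec T.toLinearMap).flip v)) :
    ∃ (P : Matrix ι α ℂ) (Q : Matrix β κ ℂ), ∀ b, T b = P * b * Q := by
  set B := onVecMulVec T.toLinearMap
  have hB := onVecMulVec_ne_zero T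
  obtain ⟨u₀, hu₀⟩ := exists_ne (0 : α → ℂ)
  obtain ⟨v₀, hv₀⟩ := exists_ne (0 : β → ℂ)
  obtain ⟨x₀, hx₀⟩ := h u₀
  obtain ⟨y₀, hy₀⟩ := h' v₀
  obtain ⟨q, hq⟩ := exists_linear_of_rowType _ hx₀
  obtain ⟨p, hp⟩ := exists_linear_of_colType _ hy₀
  have hp' : ∀ u, B u v₀ = vecMulVec (p u) y₀ := hp
  have hqi : Function.Injective q := by
    rw [injective_iff_map_eq_zero]
    intro v hv
    by_contra h0
    exact hB u₀ v hu₀ h0 (by rw [hq, hv, vecMulVec_zero_right])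
  have hy0 : y₀ ≠ 0 := by
    rintro rfl
    exact hB u₀ v₀ hu₀ hv₀ (by rw [hp', vecMulVec_zero_right])
  have hx0 : x₀ ≠ 0 := by
    rintro rfl
    exact hB u₀ v₀ hu₀ hv₀ (by rw [hq, zero_vecMulVec])
  have hp0 : ∀ u, u ≠ 0 → p u ≠ 0 := by
    intro u hu h0
    exact hB u v₀ hu hv₀ (by rw [hp', h0, zero_vecMulVec])
  have key : ∀ x : ι → ℂ, ∀ x' y y', vecMulVec x y = vecMulVec x' y' → x' ≠ 0 → (y' : κ → ℂ) ≠ 0 →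
      (∃ c : ℂ, c ≠ 0 ∧ x' = c • x) ∧ ∃ c : ℂ, c ≠ 0 ∧ y' = c • y := by
    intro x x' y y' e hx hy
    obtain ⟨i, hi⟩ := Function.ne_iff.1 hx
    obtain ⟨j, hj⟩ := Function.ne_iff.1 hy
    have hi' : x' i ≠ 0 := hi
    have hj' : y' j ≠ 0 := hj
    have e' : ∀ i j, x i * y j = x' i * y' j := fun i j => congrFun (congrFun e i) j
    have h1 : x i * y j ≠ 0 := by rw [e']; exact mul_ne_zero hi' hj'
    have h2 := left_ne_zero_of_mul h1
    have h3 := right_ne_zero_of_mul h1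
    refine ⟨⟨y j / y' j, div_ne_zero h3 hj', ?_⟩, ⟨x i / x' i, div_ne_zero h2 hi', ?_⟩⟩
    · ext k
      simp only [Pi.smul_apply, smul_eq_mul]
      field_simp
      linear_combination -e' k j
    · ext k
      simp only [Pi.smul_apply, smul_eq_mul]
      field_simp
      linear_combination -e' i k
  have hrow : ∀ u, u ≠ 0 → ∀ v, ∃ y, B u v = vecMulVec (p u) y := by
    intro u hu v
    obtain ⟨x, hx⟩ := h u
    obtain ⟨y, hy⟩ := hx v₀
    obtain ⟨w, hw⟩ := hx v
    obtain ⟨⟨c, hc0, hc⟩, -⟩ := key _ _ _ _ (hy.symm.trans (hp' u)) (hp0 u hu) hy0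
    refine ⟨c⁻¹ • w, ?_⟩
    rw [hc, smul_vecMulVec, vecMulVec_smul, smul_smul, mul_inv_cancel₀ hc0, one_smul]
    exact hw
  have hcol : ∀ v, v ≠ 0 → ∀ u, ∃ x, B u v = vecMulVec x (q v) := by
    intro v hv u
    obtain ⟨y, hy⟩ := h' v
    obtain ⟨x, hx⟩ := hy u₀
    obtain ⟨w, hw⟩ := hy u
    obtain ⟨-, ⟨c, hc0, hc⟩⟩ := key _ _ _ _ (hx.symm.trans (hq v)) hx0
      (fun h0 => hv (hqi (by rw [h0, map_zero])))
    refine ⟨c⁻¹ • w, ?_⟩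
    rw [hc, smul_vecMulVec, vecMulVec_smul, smul_smul, inv_mul_cancel₀ hc0, one_smul]
    exact hw
  have hfac : ∀ u, u ≠ 0 → ∃ c : ℂ, ∀ v, B u v = c • vecMulVec (p u) (q v) := by
    intro u hu
    obtain ⟨g, hg⟩ := exists_linear_of_rowType _ (hrow u hu)
    -- For fixed u the row vector g(v) is proportional to q(v) for every v, hence g = c·q with c
    -- depending on u only.
    obtain ⟨c, hc⟩ := exists_eq_smul_of_forall_proportional (g := g) hqi (fun v => by
      by_cases hv : v = 0
      · exact ⟨0, by simp [hv]⟩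
      have hgv : g v ≠ 0 := fun h0 => hB u v hu hv (by rw [hg, h0, vecMulVec_zero_right])
      obtain ⟨x, hx⟩ := hcol v hv u
      obtain ⟨-, ⟨c, -, hc⟩⟩ := key _ _ _ _ (hx.symm.trans (hg v)) (hp0 u hu) hgv
      exact ⟨c, hc⟩)
    exact ⟨c, fun v => by rw [hg, hc, LinearMap.smul_apply, vecMulVec_smul]⟩
  have hq0 : q v₀ ≠ 0 := fun h0 => hv₀ (hqi (by rw [h0, map_zero]))
  obtain ⟨j, hj⟩ := Function.ne_iff.1 hq0
  have hj' : q v₀ j ≠ 0 := hj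
  -- Evaluating at v₀, where B(u, v₀) = p(u)⊗y₀, shows that the factor c is the same for all u.
  set c₀ := y₀ j / q v₀ j with hc₀
  have hfin : ∀ u v, B u v = c₀ • vecMulVec (p u) (q v) := by
    intro u v
    by_cases hu : u = 0
    · simp [hu, zero_vecMulVec]
    obtain ⟨c, hc⟩ := hfac u hu
    obtain ⟨i, hi⟩ := Function.ne_iff.1 (hp0 u hu)
    have hi' : p u i ≠ 0 := hi
    have e : p u i * y₀ j = c * (p u i * q v₀ j) :=
      congrFun (congrFun ((hp' u).symm.trans (hc v₀)) i) j
    have : c = c₀ := by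
      rw [hc₀, eq_div_iff hj']
      apply mul_left_cancel₀ hi'
      linear_combination -e
    rw [hc v, this]
  refine ⟨c₀ • LinearMap.toMatrix' p, (LinearMap.toMatrix' q)ᵀ, fun b => ?_⟩
  have hT : T.toLinearMap = ((mulRightLinearMap ι ℂ (LinearMap.toMatrix' q)ᵀ).comp
      (mulLeftLinearMap β ℂ (c₀ • LinearMap.toMatrix' p)) : Matrix α β ℂ →ₗ[ℂ] Matrix ι κ ℂ) := by
    refine Matrix.linearMap_ext_vecMulVec fun u v => ?_
    have := hfin u v
    rw [onVecMulVec_apply] at this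
    rw [this]
    simp only [LinearMap.comp_apply, mulLeftLinearMap_apply, mulRightLinearMap_apply,
      mul_vecMulVec, LinearMap.toMatrix'_mulVec, smul_mulVec, smul_vecMulVec]
    rw [Matrix.smul_mul, vecMulVec_mul, vecMul_transpose, LinearMap.toMatrix'_mulVec]
  exact LinearMap.congr_fun hT b

/-- A linear bijection between spaces of matrices which preserves matrices of rank at most one has
the form `b ↦ P b Q` or `b ↦ P bᵗ Q`. -/
theorem eq_mul_mul_or_eq_mul_transpose_mul [Nontrivial ι] [Nontrivial κ] [Nonempty α] [Nonempty β]
    (T : Matrix α β ℂ ≃ₗ[ℂ] Matrix ι κ ℂ)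
    (hT : ∀ u v, ∃ x y, T (vecMulVec u v) = vecMulVec x y) :
    (∃ (P : Matrix ι α ℂ) (Q : Matrix β κ ℂ), ∀ b, T b = P * b * Q) ∨
      ∃ (P : Matrix ι β ℂ) (Q : Matrix α κ ℂ), ∀ b, T b = P * bᵀ * Q := by
  rcases forall_isRowType_or_forall_isColType (onVecMulVec T.toLinearMap) hT with h | h <;>
  rcases forall_isRowType_or_forall_isColType (onVecMulVec T.toLinearMap).flip
    (fun v u => hT u v) with h' | h'
  · exact (not_isRowType_and_isRowType T h h').elim
  · exact Or.inl (eq_mul_mul_of_isRowType_of_isColType T h h')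
  · right
    -- Transposing the argument interchanges the two families of slices, which reduces this case to
    -- the previous one.
    let S : Matrix β α ℂ ≃ₗ[ℂ] Matrix ι κ ℂ := (transposeLinearEquiv β α ℂ ℂ).trans T
    have hS : onVecMulVec S.toLinearMap = (onVecMulVec T.toLinearMap).flip := by
      refine LinearMap.ext₂ fun v u => ?_
      show T (vecMulVec v u)ᵀ = T (vecMulVec u v)
      rw [transpose_vecMulVec]
    obtain ⟨P, Q, hPQ⟩ := eq_mul_mul_of_isRowType_of_isColType S (by rwa [hS])
      (by rw [hS]; exact h)
    exact ⟨P, Q, fun b => by simpa [S] using hPQ bᵀ⟩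
  -- Transposing the values turns column type into row type in both families; this excluded case is
  -- where at least two columns are needed.
  · exfalso
    exact not_isRowType_and_isRowType (T.trans (transposeLinearEquiv ι κ ℂ ℂ))
      (fun u => (h u).transpose) (fun v => (h' v).transpose)

end RankOne

end

/-! ### The listed maps on matrices, and that they are conjugations of psl(m,n). -/

section

open Matrix

section gl

set_option linter.unusedSectionVars false

variable {ι κ : Type*} [Fintype ι] [DecidableEq ι] [Fintype κ] [DecidableEq κ]

theorem sigmaTilde_fromBlocks (a : Matrix ι ι ℂ) (b : Matrix ι κ ℂ) (c : Matrix κ ι ℂ)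
    (d : Matrix κ κ ℂ) :
    sigmaTilde (fromBlocks a b c d) = fromBlocks (-aᴴ) cᴴ (-bᴴ) (-dᴴ) := rfl

theorem sigmaTilde_superBracket (X Y : Matrix (ι ⊕ κ) (ι ⊕ κ) ℂ) :
    sigmaTilde (superBracket X Y) = superBracket (sigmaTilde X) (sigmaTilde Y) := by
  rw [← fromBlocks_toBlocks X, ← fromBlocks_toBlocks Y]
  simp only [superBracket_fromBlocks, sigmaTilde_fromBlocks]
  congr 1 <;>
  simp only [conjTranspose_add, conjTranspose_sub, conjTranspose_mul, Matrix.mul_neg,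
    Matrix.neg_mul, neg_neg] <;> abel

theorem GL_inv_mul_mul (A : GL ι ℂ) {ν : Type*} (Z : Matrix ι ν ℂ) : A.2 * (A.1 * Z) = Z := by
  rw [← Matrix.mul_assoc, A.4, Matrix.one_mul]

theorem GL_mul_inv_mul (A : GL ι ℂ) {ν : Type*} (Z : Matrix ι ν ℂ) : A.1 * (A.2 * Z) = Z := by
  rw [← Matrix.mul_assoc, A.3, Matrix.one_mul]

theorem GL_inv_conjTranspose {A : GL ι ℂ} {ε : ℂ} (hε : ε * ε = 1) (hA : A.1ᴴ = ε • A.1) :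
    A.2ᴴ = ε • A.2 := by
  have h1 : A.2ᴴ * A.1ᴴ = 1 := by rw [← conjTranspose_mul, A.3, conjTranspose_one]
  rw [hA] at h1
  calc A.2ᴴ = A.2ᴴ * (ε • A.1) * (ε • A.2) := by
        rw [mul_assoc, smul_mul_smul_comm, hε, A.3, one_smul, mul_one]
    _ = ε • A.2 := by rw [h1, one_mul]

theorem matrixAd_superBracket (A : GL ι ℂ) (B : GL κ ℂ) (X Y : Matrix (ι ⊕ κ) (ι ⊕ κ) ℂ) :
    matrixAd (blockDiag A B) (superBracket X Y) =
      superBracket (matrixAd (blockDiag A B) X) (matrixAd (blockDiag A B) Y) := by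
  rw [← fromBlocks_toBlocks X, ← fromBlocks_toBlocks Y]
  simp only [superBracket_fromBlocks, matrixAd_blockDiag]
  congr 1 <;>
  simp only [Matrix.mul_add, Matrix.add_mul, Matrix.mul_sub, Matrix.sub_mul, Matrix.mul_assoc,
    GL_inv_mul_mul]

theorem sigmaTilde_mem_weightSpace {M : Type*} [AddCommGroup M] {w : ι ⊕ κ → M} {a : M}
    {X : Matrix (ι ⊕ κ) (ι ⊕ κ) ℂ} (hX : X ∈ weightSpace w a) :
    sigmaTilde X ∈ weightSpace w (-a) := by
  have h : ∀ i j, sigmaTilde X i j ≠ 0 → X j i ≠ 0 := by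
    intro i j h h0
    apply h
    rcases i with i | i <;> rcases j with j | j <;>
    simp [sigmaTilde, toBlocks₁₁, toBlocks₁₂, toBlocks₂₁, toBlocks₂₂, h0]
  intro i j hij
  rw [← hX j i (h i j hij), neg_sub]

theorem matrixAd_mem_weightSpace {M : Type*} [AddCommGroup M] {w : ι → M} {a : M} {g : GL ι ℂ}
    (hg : g.1 ∈ weightSpace w 0) (hg' : g.2 ∈ weightSpace w 0) {X : Matrix ι ι ℂ}
    (hX : X ∈ weightSpace w a) : matrixAd g X ∈ weightSpace w a := by
  have := mul_mem_weightSpace w (mul_mem_weightSpace w hg hX) hg'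
  rw [zero_add, add_zero] at this
  exact this

theorem fromBlocks_mem_weightSpace_zero {M : Type*} [AddCommGroup M] {w : ι ⊕ κ → M}
    {a : Matrix ι ι ℂ} {d : Matrix κ κ ℂ} (ha : a ∈ weightSpace (w ∘ Sum.inl) 0)
    (hd : d ∈ weightSpace (w ∘ Sum.inr) 0) : fromBlocks a 0 0 d ∈ weightSpace w 0 := by
  rintro (i | i) (j | j) h
  · exact ha i j h
  · exact absurd rfl h
  · exact absurd rfl h
  · exact hd i j h

theorem mem_weightSpace_const {M : Type*} [AddCommGroup M] {w : ι → M}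
    (hw : ∀ i j, w i = w j) (X : Matrix ι ι ℂ) : X ∈ weightSpace w 0 := by
  intro i j _
  rw [hw i j, sub_self]

theorem matrixAd_blockDiag_mem_part (A : GL ι ℂ) (B : GL κ ℂ) {i : ZMod 2}
    {X : Matrix (ι ⊕ κ) (ι ⊕ κ) ℂ} (hX : X ∈ weightSpace parity i) :
    matrixAd (blockDiag A B) X ∈ weightSpace parity i :=
  matrixAd_mem_weightSpace
    (fromBlocks_mem_weightSpace_zero (mem_weightSpace_const (by simp [parity]) _)
      (mem_weightSpace_const (by simp [parity]) _))
    (fromBlocks_mem_weightSpace_zero (mem_weightSpace_const (by simp [parity]) _)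
      (mem_weightSpace_const (by simp [parity]) _)) hX

theorem matrixAd_inv_matrixAd (g : GL ι ℂ) (X : Matrix ι ι ℂ) :
    matrixAd g⁻¹ (matrixAd g X) = X := by
  show g.2 * (g.1 * X * g.2) * g.1 = X
  calc g.2 * (g.1 * X * g.2) * g.1 = (g.2 * g.1) * X * (g.2 * g.1) := by noncomm_ring
    _ = X := by rw [g.4, Matrix.one_mul, Matrix.mul_one]

theorem blockDiag_inv (A : GL ι ℂ) (B : GL κ ℂ) : blockDiag A⁻¹ B⁻¹ = (blockDiag A B)⁻¹ :=
  Units.ext rfl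

theorem evenPart_sub_oddPart_of_mem {X : Matrix (ι ⊕ κ) (ι ⊕ κ) ℂ} {k : ℤ}
    (hX : X ∈ weightSpace parity (k : ZMod 2)) :
    evenPart X - oddPart X = (-1 : ℂ) ^ k • X := by
  have hs := evenPart_add_oddPart X
  rcases Int.even_or_odd k with hk | hk
  · rw [(ZMod.intCast_eq_zero_iff_even).2 hk] at hX
    rw [oddPart_of_even hX, add_zero] at hs
    rw [oddPart_of_even hX, hs, hk.neg_one_zpow, one_smul, sub_zero]
  · rw [(ZMod.intCast_eq_one_iff_odd).2 hk] at hX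
    rw [evenPart_of_odd hX, zero_add] at hs
    rw [evenPart_of_odd hX, hs, hk.neg_one_zpow, neg_one_smul, zero_sub]

/-- `(Ad diag(A, B) σ̃₁)²` is the parity operator if `A A⁻ᴴ` and `B B⁻ᴴ` are the same scalar. -/
theorem matrixAd_sigmaTilde_sq {A : GL ι ℂ} {B : GL κ ℂ} {ε : ℂ} (hε : ε * ε = 1)
    (hA : A.1ᴴ = ε • A.1) (hB : B.1ᴴ = ε • B.1)
    (X : Matrix (ι ⊕ κ) (ι ⊕ κ) ℂ) :
    matrixAd (blockDiag A B) (sigmaTilde (matrixAd (blockDiag A B) (sigmaTilde X))) =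
      evenPart X - oddPart X := by
  have hA' := GL_inv_conjTranspose hε hA
  have hB' := GL_inv_conjTranspose hε hB
  have h3 := A.3
  have h4 := B.3
  rw [← fromBlocks_toBlocks X, evenPart_fromBlocks, oddPart_fromBlocks]
  simp only [sigmaTilde_fromBlocks, matrixAd_blockDiag, sub_eq_add_neg, fromBlocks_neg,
    fromBlocks_add]
  congr 1 <;>
  simp only [conjTranspose_mul, conjTranspose_neg, conjTranspose_conjTranspose, hA, hB, hA', hB',
    Matrix.mul_neg, Matrix.neg_mul, Matrix.mul_smul, Matrix.smul_mul, smul_smul, hε, one_smul,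
    Matrix.mul_assoc, GL_mul_inv_mul, h3, h4, neg_neg, Matrix.mul_one, neg_zero, add_zero, zero_add]

end gl

section psl

variable {m n : ℕ}

/-- The class in `psl(m,n)` of a matrix in `sl(m,n)`. -/
def pslMk (X : Matrix (Fin m ⊕ Fin n) (Fin m ⊕ Fin n) ℂ) (hX : X ∈ slSpace m n) : pslSpace m n :=
  (slScalars m n).mkQ ⟨X, hX⟩

theorem exists_pslMk (x : pslSpace m n) : ∃ X hX, pslMk X hX = x := by
  induction x using Submodule.Quotient.induction_on with
  | _ y => exact ⟨y.1, y.2, rfl⟩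

theorem pslMk_eq_zero {X : Matrix (Fin m ⊕ Fin n) (Fin m ⊕ Fin n) ℂ} {hX : X ∈ slSpace m n} :
    pslMk X hX = 0 ↔ ∃ z : ℂ, z • 1 = X :=
  (Submodule.Quotient.mk_eq_zero _).trans (mem_slScalars _)

theorem bracket_pslMk (X Y : Matrix (Fin m ⊕ Fin n) (Fin m ⊕ Fin n) ℂ) (hX : X ∈ slSpace m n)
    (hY : Y ∈ slSpace m n) :
    (psl m n).bracket (pslMk X hX) (pslMk Y hY) =
      pslMk (superBracket X Y) (superBracket_mem_slSpace X Y) := rfl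

theorem mem_psl_deg {j : ℤ} {x : pslSpace m n} :
    x ∈ (psl m n).deg j ↔ ∃ X hX, X ∈ weightSpace (pslWeight m n) j ∧ pslMk X hX = x := by
  constructor
  · rintro ⟨y, hy, rfl⟩
    exact ⟨y.1, y.2, hy, rfl⟩
  · rintro ⟨X, hX, h, rfl⟩
    exact ⟨⟨X, hX⟩, h, rfl⟩

theorem mem_psl_part {i : ZMod 2} {x : pslSpace m n} :
    x ∈ (psl m n).part i ↔ ∃ X hX, X ∈ weightSpace parity i ∧ pslMk X hX = x := by
  constructor
  · rintro ⟨y, hy, rfl⟩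
    exact ⟨y.1, y.2, hy, rfl⟩
  · rintro ⟨X, hX, h, rfl⟩
    exact ⟨⟨X, hX⟩, h, rfl⟩

theorem pslMk_congr {X Y : Matrix (Fin m ⊕ Fin n) (Fin m ⊕ Fin n) ℂ} (h : X = Y)
    (hX : X ∈ slSpace m n) : pslMk X hX = pslMk Y (h ▸ hX) := by subst h; rfl

theorem matrixAd_blockDiag_mem_pslWeight (A : GL (Fin m) ℂ) (B : GL (Fin n) ℂ) {j : ℤ}
    {X : Matrix (Fin m ⊕ Fin n) (Fin m ⊕ Fin n) ℂ} (hX : X ∈ weightSpace (pslWeight m n) j) :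
    matrixAd (blockDiag A B) X ∈ weightSpace (pslWeight m n) j :=
  matrixAd_mem_weightSpace
    (fromBlocks_mem_weightSpace_zero (mem_weightSpace_const (by simp [pslWeight]) _)
      (mem_weightSpace_const (by simp [pslWeight]) _))
    (fromBlocks_mem_weightSpace_zero (mem_weightSpace_const (by simp [pslWeight]) _)
      (mem_weightSpace_const (by simp [pslWeight]) _)) hX

theorem pslWeight_le_parity {k : ℤ} {X : Matrix (Fin m ⊕ Fin n) (Fin m ⊕ Fin n) ℂ}
    (hX : X ∈ weightSpace (pslWeight m n) k) : X ∈ weightSpace parity (k : ZMod 2) := by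
  intro i j h
  rw [← pslWeight_parity, hX i j h]

/-- A matrix-level criterion for anti-linear graded conjugations of `psl(m,n)`. -/
theorem psl_conjugation_of_matrix (σ : pslSpace m n →ₛₗ[starRingEnd ℂ] pslSpace m n)
    (f : Matrix (Fin m ⊕ Fin n) (Fin m ⊕ Fin n) ℂ → Matrix (Fin m ⊕ Fin n) (Fin m ⊕ Fin n) ℂ)
    (hf : ∀ X hX, ∃ h, σ (pslMk X hX) = pslMk (f X) h)
    (hb : ∀ X Y, f (superBracket X Y) = superBracket (f X) (f Y))
    (hp : ∀ i, ∀ X ∈ weightSpace parity i, f X ∈ weightSpace parity i)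
    (hd : ∀ j, ∀ X ∈ weightSpace (pslWeight m n) j, f X ∈ weightSpace (pslWeight m n) (-j))
    (hs : ∀ X, f (f X) = evenPart X - oddPart X) :
    (psl m n).IsAntilinearGradedConjugation σ := by
  refine .of_mapsTo (fun x y => ?_) (fun i x hx => ?_) (fun j x hx => ?_) (fun k x hx => ?_)
  · obtain ⟨X, hX, rfl⟩ := exists_pslMk x
    obtain ⟨Y, hY, rfl⟩ := exists_pslMk y
    obtain ⟨h1, e1⟩ := hf X hX
    obtain ⟨h2, e2⟩ := hf Y hY
    obtain ⟨h3, e3⟩ := hf _ (superBracket_mem_slSpace X Y)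
    rw [bracket_pslMk, e1, e2, e3, bracket_pslMk]
    exact pslMk_congr (hb X Y) _
  · obtain ⟨X, hX, hXi, rfl⟩ := mem_psl_part.1 hx
    obtain ⟨h1, e1⟩ := hf X hX
    exact mem_psl_part.2 ⟨_, h1, hp i X hXi, e1.symm⟩
  · obtain ⟨X, hX, hXi, rfl⟩ := mem_psl_deg.1 hx
    obtain ⟨h1, e1⟩ := hf X hX
    exact mem_psl_deg.2 ⟨_, h1, hd j X hXi, e1.symm⟩
  · obtain ⟨X, hX, hXi, rfl⟩ := mem_psl_deg.1 hx
    obtain ⟨h1, e1⟩ := hf X hX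
    obtain ⟨h2, e2⟩ := hf _ h1
    rw [e1, e2]
    exact pslMk_congr ((hs X).trans (evenPart_sub_oddPart_of_mem (pslWeight_le_parity hXi))) _

theorem signMatrix_conjTranspose (n p : ℕ) : (signMatrix n p).1ᴴ = (signMatrix n p).1 := by
  rw [signMatrix, diagonal_conjTranspose]
  congr 1
  ext i
  simp only [Pi.star_apply]
  split_ifs <;> simp

theorem psl_sign_conjugation (m n p q : ℕ) : (psl m n).IsAntilinearGradedConjugation
    ((pslAd (signMatrix m p) (signMatrix n q)).comp (pslSigma m n)) := by
  refine psl_conjugation_of_matrix _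
    (fun X => matrixAd (blockDiag (signMatrix m p) (signMatrix n q)) (sigmaTilde X))
    (fun X hX => ⟨_, rfl⟩) (fun X Y => ?_) (fun i X hX => ?_) (fun j X hX => ?_) (fun X => ?_)
  · rw [sigmaTilde_superBracket, matrixAd_superBracket]
  · refine matrixAd_blockDiag_mem_part _ _ ?_
    have := sigmaTilde_mem_weightSpace hX
    rwa [ZMod.neg_eq_self_mod_two] at this
  · exact matrixAd_blockDiag_mem_pslWeight _ _ (sigmaTilde_mem_weightSpace hX)
  · exact matrixAd_sigmaTilde_sq (ε := 1) (by simp) (by simp [signMatrix_conjTranspose])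
      (by simp [signMatrix_conjTranspose]) X

theorem tauMatrix_fromBlocks (ε : ℤˣ) (a b c d : Matrix (Fin n) (Fin n) ℂ) :
    tauMatrix n ε (fromBlocks a b c d) = fromBlocks (d.map star)
      (((ε : ℤ) * Complex.I : ℂ) • c.map star) (-((ε : ℤ) * Complex.I : ℂ) • b.map star)
      (a.map star) := rfl

theorem psl_tau_conjugation (n : ℕ) (ε : ℤˣ) :
    (psl n n).IsAntilinearGradedConjugation (pslTau n ε) := by
  have hε : ((ε : ℤ) : ℂ) * ((ε : ℤ) : ℂ) = 1 := by
    rcases Int.units_eq_one_or ε with rfl | rfl <;> simp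
  -- The relation (εi)² = -1 does two things: it makes τ compatible with brackets of odd elements,
  -- and it gives τ² = -1 on the odd part.
  have hI : (((ε : ℤ) * Complex.I : ℂ)) * ((ε : ℤ) * Complex.I : ℂ) = -1 := by
    linear_combination Complex.I * Complex.I * hε + Complex.I_mul_I
  -- Up to conjugation and scalars τ exchanges the two index blocks, which reverses the ℤ-degree and
  -- keeps the parity.
  have hsw : ∀ i j, (pslWeight n n (Sum.swap i) - pslWeight n n (Sum.swap j)) =
      -(pslWeight n n i - pslWeight n n j) := by
    rintro (i | i) (j | j) <;> simp [pslWeight]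
  have hsw' : ∀ i j : Fin n ⊕ Fin n, (parity (Sum.swap i) - parity (Sum.swap j) : ZMod 2) =
      parity i - parity j := by
    rintro (i | i) (j | j) <;> simp [parity]
  have hent : ∀ X i j, tauMatrix n ε X i j ≠ 0 → X (Sum.swap i) (Sum.swap j) ≠ 0 := by
    intro X i j h h0
    apply h
    rcases i with i | i <;> rcases j with j | j <;> simp at h0 <;>
    simp [tauMatrix, toBlocks₁₁, toBlocks₁₂, toBlocks₂₁, toBlocks₂₂, h0]
  refine psl_conjugation_of_matrix _ (tauMatrix n ε)
    (fun X hX => ⟨_, rfl⟩) (fun X Y => ?_) (fun i X hX => ?_) (fun j X hX => ?_) (fun X => ?_)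
  · have hm : ∀ a b : Matrix (Fin n) (Fin n) ℂ, (a * b).map star = a.map star * b.map star :=
      fun a b => Matrix.map_mul (f := starRingEnd ℂ)
    have ha : ∀ a b : Matrix (Fin n) (Fin n) ℂ, (a + b).map star = a.map star + b.map star :=
      fun a b => Matrix.map_add _ (star_add (R := ℂ)) _ _
    have hs : ∀ a b : Matrix (Fin n) (Fin n) ℂ, (a - b).map star = a.map star - b.map star :=
      fun a b => Matrix.map_sub _ (star_sub (R := ℂ)) _ _
    rw [← fromBlocks_toBlocks X, ← fromBlocks_toBlocks Y]
    simp only [superBracket_fromBlocks, tauMatrix_fromBlocks]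
    congr 1 <;>
    simp only [hm, ha, hs, Matrix.mul_smul, Matrix.smul_mul, smul_smul, mul_neg, neg_mul, hI,
      neg_neg, one_smul, smul_add, smul_sub, neg_smul] <;> abel
  · intro k l h
    rw [← hsw', hX _ _ (hent X k l h)]
  · intro k l h
    rw [← hX _ _ (hent X k l h), hsw, neg_neg]
  · rw [← fromBlocks_toBlocks X, evenPart_fromBlocks, oddPart_fromBlocks]
    simp only [tauMatrix_fromBlocks, sub_eq_add_neg, fromBlocks_neg, fromBlocks_add]
    have hss : ∀ a : Matrix (Fin n) (Fin n) ℂ, (a.map star).map star = a := by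
      intro a; ext i j; simp
    have hsm : ∀ (c : ℂ) (a : Matrix (Fin n) (Fin n) ℂ), (c • a).map star = star c • a.map star := by
      intro c a; ext i j; simp
    have hst : star ((ε : ℤ) * Complex.I : ℂ) = -((ε : ℤ) * Complex.I : ℂ) := by simp
    congr 1 <;> simp only [hss, hsm, hst, star_neg, smul_smul, neg_neg, mul_neg, neg_mul, hI,
      neg_zero, add_zero, zero_add] <;> simp only [neg_smul, one_smul]

end psl

end

/-! ### Automorphisms, homogeneous components and generation of psl(m,n). -/

section

open Matrix

section psl

variable {m n : ℕ}

/-- `Ad diag(A, B)` as an automorphism of `psl(m,n)`. -/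
def pslAdEquiv (A : GL (Fin m) ℂ) (B : GL (Fin n) ℂ) : pslSpace m n ≃ₗ[ℂ] pslSpace m n :=
  LinearEquiv.ofLinearMap (pslAd A B) (pslAd A⁻¹ B⁻¹)
    (LinearMap.ext fun x => by
      obtain ⟨X, hX, rfl⟩ := exists_pslMk x
      refine pslMk_congr ?_ _
      have := matrixAd_inv_matrixAd (blockDiag A⁻¹ B⁻¹) X
      rwa [← blockDiag_inv, inv_inv, inv_inv] at this)
    (LinearMap.ext fun x => by
      obtain ⟨X, hX, rfl⟩ := exists_pslMk x
      refine pslMk_congr ?_ _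
      have := matrixAd_inv_matrixAd (blockDiag A B) X
      rwa [← blockDiag_inv] at this)

theorem psl_gradedAutomorphism_of_matrix (φ : pslSpace m n ≃ₗ[ℂ] pslSpace m n)
    (f g : Matrix (Fin m ⊕ Fin n) (Fin m ⊕ Fin n) ℂ → Matrix (Fin m ⊕ Fin n) (Fin m ⊕ Fin n) ℂ)
    (hf : ∀ X hX, ∃ h, φ (pslMk X hX) = pslMk (f X) h)
    (hg : ∀ X hX, ∃ h, φ.symm (pslMk X hX) = pslMk (g X) h)
    (hb : ∀ x y, φ ((psl m n).bracket x y) = (psl m n).bracket (φ x) (φ y))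
    (hfp : ∀ i, ∀ X ∈ weightSpace parity i, f X ∈ weightSpace parity i)
    (hgp : ∀ i, ∀ X ∈ weightSpace parity i, g X ∈ weightSpace parity i)
    (hfd : ∀ j, ∀ X ∈ weightSpace (pslWeight m n) j, f X ∈ weightSpace (pslWeight m n) j)
    (hgd : ∀ j, ∀ X ∈ weightSpace (pslWeight m n) j, g X ∈ weightSpace (pslWeight m n) j) :
    (psl m n).IsGradedAutomorphism φ := by
  refine .of_mapsTo hb (fun i x hx => ?_) (fun i x hx => ?_)
    (fun i x hx => ?_) (fun i x hx => ?_)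
  · obtain ⟨X, hX, hXi, rfl⟩ := mem_psl_part.1 hx
    obtain ⟨h1, e1⟩ := hf X hX
    exact mem_psl_part.2 ⟨_, h1, hfp i X hXi, e1.symm⟩
  · obtain ⟨X, hX, hXi, rfl⟩ := mem_psl_part.1 hx
    obtain ⟨h1, e1⟩ := hg X hX
    exact mem_psl_part.2 ⟨_, h1, hgp i X hXi, e1.symm⟩
  · obtain ⟨X, hX, hXi, rfl⟩ := mem_psl_deg.1 hx
    obtain ⟨h1, e1⟩ := hf X hX
    exact mem_psl_deg.2 ⟨_, h1, hfd i X hXi, e1.symm⟩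
  · obtain ⟨X, hX, hXi, rfl⟩ := mem_psl_deg.1 hx
    obtain ⟨h1, e1⟩ := hg X hX
    exact mem_psl_deg.2 ⟨_, h1, hgd i X hXi, e1.symm⟩

theorem pslAdEquiv_isGradedAutomorphism (A : GL (Fin m) ℂ) (B : GL (Fin n) ℂ) :
    (psl m n).IsGradedAutomorphism (pslAdEquiv A B) := by
  refine psl_gradedAutomorphism_of_matrix _ (matrixAd (blockDiag A B))
    (matrixAd (blockDiag A⁻¹ B⁻¹)) (fun X hX => ⟨_, rfl⟩) (fun X hX => ⟨_, rfl⟩) (fun x y => ?_)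
    (fun i X hX => matrixAd_blockDiag_mem_part _ _ hX)
    (fun i X hX => matrixAd_blockDiag_mem_part _ _ hX)
    (fun i X hX => matrixAd_blockDiag_mem_pslWeight _ _ hX)
    (fun i X hX => matrixAd_blockDiag_mem_pslWeight _ _ hX)
  obtain ⟨X, hX, rfl⟩ := exists_pslMk x
  obtain ⟨Y, hY, rfl⟩ := exists_pslMk y
  exact pslMk_congr (matrixAd_superBracket A B X Y) _

/-- The embedding of `𝔤_1` into `psl(m,n)`. -/
def pslUp : Matrix (Fin m) (Fin n) ℂ →ₗ[ℂ] pslSpace m n where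
  toFun b := pslMk (fromBlocks 0 b 0 0) (fromBlocks_mem_slSpace.2 (by simp))
  map_add' b b' := pslMk_congr (by simp [fromBlocks_add]) _
  map_smul' z b := pslMk_congr (by simp [fromBlocks_smul]) _

/-- The embedding of `𝔤_{-1}` into `psl(m,n)`. -/
def pslDown : Matrix (Fin n) (Fin m) ℂ →ₗ[ℂ] pslSpace m n where
  toFun c := pslMk (fromBlocks 0 0 c 0) (fromBlocks_mem_slSpace.2 (by simp))
  map_add' b b' := pslMk_congr (by simp [fromBlocks_add]) _
  map_smul' z b := pslMk_congr (by simp [fromBlocks_smul]) _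

/-- The upper right block of an element of `psl(m,n)`. -/
def pslUpper : pslSpace m n →ₗ[ℂ] Matrix (Fin m) (Fin n) ℂ :=
  (slScalars m n).liftQ
    { toFun := fun x => x.1.toBlocks₁₂
      map_add' := fun _ _ => rfl
      map_smul' := fun _ _ => rfl } (by
    intro x hx
    obtain ⟨z, hz⟩ := (mem_slScalars x).1 hx
    rw [LinearMap.mem_ker]
    ext i j
    show x.1 (Sum.inl i) (Sum.inr j) = 0
    simp [← hz])

/-- The lower left block of an element of `psl(m,n)`. -/
def pslLower : pslSpace m n →ₗ[ℂ] Matrix (Fin n) (Fin m) ℂ :=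
  (slScalars m n).liftQ
    { toFun := fun x => x.1.toBlocks₂₁
      map_add' := fun _ _ => rfl
      map_smul' := fun _ _ => rfl } (by
    intro x hx
    obtain ⟨z, hz⟩ := (mem_slScalars x).1 hx
    rw [LinearMap.mem_ker]
    ext i j
    show x.1 (Sum.inr i) (Sum.inl j) = 0
    simp [← hz])

@[simp] theorem pslUpper_pslUp (b : Matrix (Fin m) (Fin n) ℂ) : pslUpper (pslUp b) = b := rfl

@[simp] theorem pslLower_pslDown (c : Matrix (Fin n) (Fin m) ℂ) : pslLower (pslDown c) = c := rfl

theorem pslUp_injective : Function.Injective (pslUp (m := m) (n := n)) :=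
  Function.LeftInverse.injective pslUpper_pslUp

theorem pslDown_injective : Function.Injective (pslDown (m := m) (n := n)) :=
  Function.LeftInverse.injective pslLower_pslDown

theorem pslUp_mem (b : Matrix (Fin m) (Fin n) ℂ) : pslUp b ∈ (psl m n).deg 1 := by
  refine mem_psl_deg.2 ⟨_, _, ?_, rfl⟩
  rintro (i | i) (j | j) h <;> simp [pslWeight] at h ⊢

theorem pslDown_mem (c : Matrix (Fin n) (Fin m) ℂ) : pslDown c ∈ (psl m n).deg (-1) := by
  refine mem_psl_deg.2 ⟨_, _, ?_, rfl⟩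
  rintro (i | i) (j | j) h <;> simp [pslWeight] at h ⊢

theorem pslUp_pslUpper {x : pslSpace m n} (hx : x ∈ (psl m n).deg 1) :
    pslUp (pslUpper x) = x := by
  obtain ⟨X, hX, h, rfl⟩ := mem_psl_deg.1 hx
  refine pslMk_congr ?_ _
  ext (i | i) (j | j)
  · by_contra h0
    have := h (Sum.inl i) (Sum.inl j) (fun h1 => h0 (by simp [h1]))
    simp [pslWeight] at this
  · rfl
  · by_contra h0
    have := h (Sum.inr i) (Sum.inl j) (fun h1 => h0 (by simp [h1]))
    simp [pslWeight] at this
  · by_contra h0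
    have := h (Sum.inr i) (Sum.inr j) (fun h1 => h0 (by simp [h1]))
    simp [pslWeight] at this

theorem pslDown_pslLower {x : pslSpace m n} (hx : x ∈ (psl m n).deg (-1)) :
    pslDown (pslLower x) = x := by
  obtain ⟨X, hX, h, rfl⟩ := mem_psl_deg.1 hx
  refine pslMk_congr ?_ _
  ext (i | i) (j | j)
  · by_contra h0
    have := h (Sum.inl i) (Sum.inl j) (fun h1 => h0 (by simp [h1]))
    simp [pslWeight] at this
  · by_contra h0
    have := h (Sum.inl i) (Sum.inr j) (fun h1 => h0 (by simp [h1]))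
    simp [pslWeight] at this
  · rfl
  · by_contra h0
    have := h (Sum.inr i) (Sum.inr j) (fun h1 => h0 (by simp [h1]))
    simp [pslWeight] at this

theorem exists_of_mem_psl_deg_zero {x : pslSpace m n} (hx : x ∈ (psl m n).deg 0) :
    ∃ a d h, a.trace = d.trace ∧ pslMk (fromBlocks a 0 0 d) h = x := by
  obtain ⟨X, hX, h, rfl⟩ := mem_psl_deg.1 hx
  have hX' : X = fromBlocks X.toBlocks₁₁ 0 0 X.toBlocks₂₂ := by
    ext (i | i) (j | j)
    · rfl
    · by_contra h0
      have := h (Sum.inl i) (Sum.inr j) (fun h1 => h0 (by simp [h1]))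
      simp [pslWeight] at this
    · by_contra h0
      have := h (Sum.inr i) (Sum.inl j) (fun h1 => h0 (by simp [h1]))
      simp [pslWeight] at this
    · rfl
  exact ⟨_, _, hX' ▸ hX, fromBlocks_mem_slSpace.1 (hX' ▸ hX), (pslMk_congr hX' hX).symm⟩

theorem bracket_pslUp_pslDown (b : Matrix (Fin m) (Fin n) ℂ) (c : Matrix (Fin n) (Fin m) ℂ) :
    (psl m n).bracket (pslUp b) (pslDown c) = pslMk (fromBlocks (b * c) 0 0 (c * b))
      (fromBlocks_mem_slSpace.2 (trace_mul_comm b c)) :=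
  pslMk_congr ((superBracket_fromBlocks _ _ _ _ _ _ _ _).trans (by simp)) _

theorem bracket_pslDown_pslUp (b : Matrix (Fin m) (Fin n) ℂ) (c : Matrix (Fin n) (Fin m) ℂ) :
    (psl m n).bracket (pslDown c) (pslUp b) = pslMk (fromBlocks (b * c) 0 0 (c * b))
      (fromBlocks_mem_slSpace.2 (trace_mul_comm b c)) :=
  pslMk_congr ((superBracket_fromBlocks _ _ _ _ _ _ _ _).trans (by simp)) _

theorem bracket_pslMk_pslUp (a : Matrix (Fin m) (Fin m) ℂ) (d : Matrix (Fin n) (Fin n) ℂ) (h)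
    (b : Matrix (Fin m) (Fin n) ℂ) :
    (psl m n).bracket (pslMk (fromBlocks a 0 0 d) h) (pslUp b) = pslUp (a * b - b * d) :=
  pslMk_congr ((superBracket_fromBlocks _ _ _ _ _ _ _ _).trans (by simp)) _

theorem bracket_pslMk_pslDown (a : Matrix (Fin m) (Fin m) ℂ) (d : Matrix (Fin n) (Fin n) ℂ) (h)
    (c : Matrix (Fin n) (Fin m) ℂ) :
    (psl m n).bracket (pslMk (fromBlocks a 0 0 d) h) (pslDown c) = pslDown (d * c - c * a) :=
  pslMk_congr ((superBracket_fromBlocks _ _ _ _ _ _ _ _).trans (by simp)) _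

/-- Because psl is a quotient by scalars, a zero bracket only says that both products are the same
scalar. A nonzero z makes b and c inverse up to a factor, hence occurs only for m = n; the rank one
characterization below has to rule it out. -/
theorem bracket_pslUp_pslDown_eq_zero {b : Matrix (Fin m) (Fin n) ℂ}
    {c : Matrix (Fin n) (Fin m) ℂ} :
    (psl m n).bracket (pslUp b) (pslDown c) = 0 ↔ ∃ z : ℂ, b * c = z • 1 ∧ c * b = z • 1 := by
  rw [bracket_pslUp_pslDown, pslMk_eq_zero]
  refine exists_congr fun z => ?_
  rw [← fromBlocks_one, fromBlocks_smul, fromBlocks_inj]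
  simp [eq_comm]

/-- The bracket of u⊗e_k and e_k⊗v is diag(u⊗v, (v·u) E_kk). By linearity [𝔤_1, 𝔤_{-1}] contains
every diag(a, tr a · E_kk), and symmetrically every diag(tr d · E_ii, d). -/
theorem psl_generated (hm : 1 ≤ m) (hn : 1 ≤ n) (N : Submodule ℂ (pslSpace m n))
    (h1 : (psl m n).deg 1 ≤ N) (h2 : (psl m n).deg (-1) ≤ N)
    (h3 : ∀ x ∈ (psl m n).deg 1, ∀ y ∈ (psl m n).deg (-1), (psl m n).bracket x y ∈ N) :
    N = ⊤ := by
  have i₀ : Fin m := ⟨0, hm⟩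
  have k₀ : Fin n := ⟨0, hn⟩
  let N' : Submodule ℂ (Matrix (Fin m ⊕ Fin n) (Fin m ⊕ Fin n) ℂ) :=
    (N.comap (slScalars m n).mkQ).map (slSpace m n).subtype
  have hN' : ∀ {X}, X ∈ N' ↔ ∃ h, pslMk X h ∈ N := by
    intro X
    constructor
    · rintro ⟨x, hx, rfl⟩
      exact ⟨x.2, hx⟩
    · rintro ⟨h, hx⟩
      exact ⟨⟨X, h⟩, hx, rfl⟩
  have hbr : ∀ (b : Matrix (Fin m) (Fin n) ℂ) (c : Matrix (Fin n) (Fin m) ℂ),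
      fromBlocks (b * c) 0 0 (c * b) ∈ N' := fun b c =>
    hN'.2 ⟨_, bracket_pslUp_pslDown b c ▸ h3 _ (pslUp_mem b) _ (pslDown_mem c)⟩
  let f₁ : Matrix (Fin m) (Fin m) ℂ →ₗ[ℂ] Matrix (Fin m ⊕ Fin n) (Fin m ⊕ Fin n) ℂ :=
    { toFun := fun a => fromBlocks a 0 0 (a.trace • vecMulVec (Pi.single k₀ 1) (Pi.single k₀ 1))
      map_add' := fun a a' => by simp [fromBlocks_add, add_smul]
      map_smul' := fun z a => by simp [fromBlocks_smul, mul_smul] }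
  let f₂ : Matrix (Fin n) (Fin n) ℂ →ₗ[ℂ] Matrix (Fin m ⊕ Fin n) (Fin m ⊕ Fin n) ℂ :=
    { toFun := fun a => fromBlocks (a.trace • vecMulVec (Pi.single i₀ 1) (Pi.single i₀ 1)) 0 0 a
      map_add' := fun a a' => by simp [fromBlocks_add, add_smul]
      map_smul' := fun z a => by simp [fromBlocks_smul, mul_smul] }
  have hf₁ : ∀ a, f₁ a ∈ N' := mem_of_forall_vecMulVec_mem f₁ N' fun u v => by
    have := hbr (vecMulVec u (Pi.single k₀ 1)) (vecMulVec (Pi.single k₀ 1) v)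
    simpa [vecMulVec_mul_vecMulVec, f₁, trace_vecMulVec, dotProduct_comm, vecMulVec_smul] using this
  have hf₂ : ∀ a, f₂ a ∈ N' := mem_of_forall_vecMulVec_mem f₂ N' fun u v => by
    have := hbr (vecMulVec (Pi.single i₀ 1) v) (vecMulVec u (Pi.single i₀ 1))
    simpa [vecMulVec_mul_vecMulVec, f₂, trace_vecMulVec, dotProduct_comm, vecMulVec_smul] using this
  have hf₃ : fromBlocks (vecMulVec (Pi.single i₀ 1) (Pi.single i₀ 1)) 0 0
      (vecMulVec (Pi.single k₀ 1) (Pi.single k₀ 1)) ∈ N' := by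
    simpa [vecMulVec_mul_vecMulVec] using hbr (vecMulVec (Pi.single i₀ 1) (Pi.single k₀ 1))
      (vecMulVec (Pi.single k₀ 1) (Pi.single i₀ 1))
  rw [eq_top_iff]
  intro x _
  obtain ⟨X, hX, rfl⟩ := exists_pslMk x
  suffices h : X ∈ N' from (hN'.1 h).2
  rw [← fromBlocks_toBlocks X] at hX ⊢
  generalize X.toBlocks₁₁ = a, X.toBlocks₁₂ = b, X.toBlocks₂₁ = c, X.toBlocks₂₂ = d at hX ⊢
  have htr := fromBlocks_mem_slSpace.1 hX
  -- Since tr a = tr d, the surplus diagonal entries of f₁ a + f₂ d form tr a · diag(E_ii, E_kk),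
  -- itself a multiple of a bracket.
  have hdec : fromBlocks a b c d = fromBlocks 0 b 0 0 + fromBlocks 0 0 c 0 + (f₁ a + f₂ d -
      a.trace • fromBlocks (vecMulVec (Pi.single i₀ 1) (Pi.single i₀ 1)) 0 0
      (vecMulVec (Pi.single k₀ 1) (Pi.single k₀ 1))) := by
    simp [f₁, f₂, htr, fromBlocks_add, sub_eq_add_neg, fromBlocks_neg, fromBlocks_smul]
  rw [hdec]
  refine add_mem (add_mem (hN'.2 ⟨_, h1 (pslUp_mem b)⟩) (hN'.2 ⟨_, h2 (pslDown_mem c)⟩))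
    (sub_mem (add_mem (hf₁ a) (hf₂ d)) (Submodule.smul_mem _ _ hf₃))

theorem pslSigma_pslDown (c : Matrix (Fin n) (Fin m) ℂ) :
    pslSigma m n (pslDown c) = pslUp cᴴ :=
  pslMk_congr ((sigmaTilde_fromBlocks _ _ _ _).trans (by simp)) _

theorem pslSigma_pslUp (b : Matrix (Fin m) (Fin n) ℂ) :
    pslSigma m n (pslUp b) = pslDown (-bᴴ) :=
  pslMk_congr ((sigmaTilde_fromBlocks _ _ _ _).trans (by simp)) _

theorem pslAd_pslUp (A : GL (Fin m) ℂ) (B : GL (Fin n) ℂ) (b : Matrix (Fin m) (Fin n) ℂ) :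
    pslAd A B (pslUp b) = pslUp (A.1 * b * B.2) :=
  pslMk_congr ((matrixAd_blockDiag _ _ _ _ _ _).trans (by simp)) _

theorem pslAd_pslDown (A : GL (Fin m) ℂ) (B : GL (Fin n) ℂ) (c : Matrix (Fin n) (Fin m) ℂ) :
    pslAd A B (pslDown c) = pslDown (B.1 * c * A.2) :=
  pslMk_congr ((matrixAd_blockDiag _ _ _ _ _ _).trans (by simp)) _

theorem pslTau_pslUp (ε : ℤˣ) (b : Matrix (Fin n) (Fin n) ℂ) :
    pslTau n ε (pslUp b) = pslDown (-((ε : ℤ) * Complex.I : ℂ) • b.map star) :=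
  pslMk_congr ((tauMatrix_fromBlocks _ _ _ _ _).trans (by simp)) _

end psl

end

/-! ### Rank one elements and graded automorphisms of psl(m,n). -/

section

open Matrix

namespace GradedLieSuperalgebra

variable {L : Type*} [AddCommGroup L] [Module ℂ L] {G : GradedLieSuperalgebra L}

/-- The composite of two anti-linear graded conjugations, as a linear equivalence. -/
noncomputable def IsAntilinearGradedConjugation.compEquiv {σ τ : L →ₛₗ[starRingEnd ℂ] L}
    (hσ : G.IsAntilinearGradedConjugation σ) (hτ : G.IsAntilinearGradedConjugation τ) :
    L ≃ₗ[ℂ] L :=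
  LinearEquiv.ofBijective (σ.comp τ : L →ₗ[ℂ] L) (hσ.bijective.comp hτ.bijective)

theorem IsAntilinearGradedConjugation.compEquiv_apply {σ τ : L →ₛₗ[starRingEnd ℂ] L}
    (hσ : G.IsAntilinearGradedConjugation σ) (hτ : G.IsAntilinearGradedConjugation τ) (x : L) :
    hσ.compEquiv hτ x = σ (τ x) := rfl

theorem IsAntilinearGradedConjugation.compEquiv_isGradedAutomorphism
    {σ τ : L →ₛₗ[starRingEnd ℂ] L}
    (hσ : G.IsAntilinearGradedConjugation σ) (hτ : G.IsAntilinearGradedConjugation τ) :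
    G.IsGradedAutomorphism (hσ.compEquiv hτ) := by
  refine ⟨fun x y => ?_, fun i => ?_, fun j => ?_⟩
  · simp only [compEquiv_apply, hτ.map_bracket, hσ.map_bracket]
  · rw [← hσ.map_part i, ← hτ.map_part i]
    ext x
    constructor
    · rintro ⟨y, hy, rfl⟩
      refine ⟨τ y, ⟨y, ?_, rfl⟩, rfl⟩
      rwa [hτ.map_part i, hσ.map_part i] at hy
    · rintro ⟨_, ⟨y, hy, rfl⟩, rfl⟩
      refine ⟨y, ?_, rfl⟩
      rwa [hτ.map_part i, hσ.map_part i]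
  · have h1 := hσ.map_deg (-j)
    rw [neg_neg] at h1
    rw [← h1, ← hτ.map_deg j]
    ext x
    constructor
    · rintro ⟨y, hy, rfl⟩
      refine ⟨τ y, ⟨y, ?_, rfl⟩, rfl⟩
      rwa [SetLike.mem_coe, ← h1, ← hτ.map_deg j]
    · rintro ⟨_, ⟨y, hy, rfl⟩, rfl⟩
      refine ⟨y, ?_, rfl⟩
      rwa [SetLike.mem_coe, ← h1, ← hτ.map_deg j] at hy

/-- An element of `𝔤_1` which spans its double annihilator in `𝔤_1` (with respect to the bracket
with `𝔤_{-1}`) and is fixed by some element of `𝔤_0`. -/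
def IsMinimal (G : GradedLieSuperalgebra L) (x : L) : Prop :=
  (∀ x' ∈ G.deg 1, (∀ y ∈ G.deg (-1), G.bracket x y = 0 → G.bracket x' y = 0) →
    ∃ z : ℂ, x' = z • x) ∧ ∃ w ∈ G.deg 0, G.bracket w x = x

/-- Minimality is phrased through the bracket and the grading alone, so graded automorphisms
transport it. -/
theorem IsMinimal.map {φ : L ≃ₗ[ℂ] L} (hφ : G.IsGradedAutomorphism φ) {x : L}
    (hx : G.IsMinimal x) : G.IsMinimal (φ x) := by
  obtain ⟨h1, w, hw, hwx⟩ := hx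
  refine ⟨fun x' hx' h => ?_, φ w, hφ.mem_deg hw, by rw [← hφ.map_bracket, hwx]⟩
  obtain ⟨z, hz⟩ := h1 (φ.symm x') (hφ.symm.mem_deg hx') fun y hy hxy => by
    have := h (φ y) (hφ.mem_deg hy) (by rw [← hφ.map_bracket, hxy, map_zero])
    apply φ.injective
    rw [hφ.map_bracket, φ.apply_symm_apply, this, map_zero]
  exact ⟨z, by rw [← map_smul, ← hz, φ.apply_symm_apply]⟩

end GradedLieSuperalgebra

section vectors

variable {ι : Type*} [Fintype ι] [DecidableEq ι]

theorem exists_dotProduct_eq_one {u : ι → ℂ} (hu : u ≠ 0) : ∃ r, r ⬝ᵥ u = 1 := by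
  obtain ⟨i, hi⟩ := Function.ne_iff.1 hu
  have hi' : u i ≠ 0 := hi
  exact ⟨Pi.single i (u i)⁻¹, by simp [hi']⟩

theorem exists_ne_zero_of_dotProduct_eq_zero [Nontrivial ι] (u : ι → ℂ) :
    ∃ q, q ≠ 0 ∧ q ⬝ᵥ u = 0 := by
  by_cases hu : u = 0
  · obtain ⟨q, hq⟩ := exists_ne (0 : ι → ℂ)
    exact ⟨q, hq, by simp [hu]⟩
  obtain ⟨i, hi⟩ := Function.ne_iff.1 hu
  have hi' : u i ≠ 0 := hi
  obtain ⟨k, hk⟩ := exists_ne i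
  refine ⟨Pi.single k (u i) - Pi.single i (u k), fun h => hi' ?_, ?_⟩
  · simpa [hk] using congrFun h k
  · simp [sub_dotProduct, mul_comm]

end vectors

section psl

variable {m n : ℕ}

theorem vecMulVec_eq_zero' {α β : Type*} {x : α → ℂ} {y : β → ℂ} (h : vecMulVec x y = 0) :
    x = 0 ∨ y = 0 := by
  by_contra hc
  rw [not_or] at hc
  obtain ⟨i, hi⟩ := Function.ne_iff.1 hc.1
  obtain ⟨j, hj⟩ := Function.ne_iff.1 hc.2
  exact mul_ne_zero hi hj (congrFun (congrFun h i) j)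

theorem eq_zero_of_vecMulVec_eq_smul_one {α : Type*} [DecidableEq α] [Nontrivial α] {x y : α → ℂ}
    {z : ℂ} (h : vecMulVec x y = z • 1) : z = 0 := by
  obtain ⟨i, k, hik⟩ := exists_pair_ne α
  have e : ∀ i j, x i * y j = z * (1 : Matrix α α ℂ) i j := fun i j => congrFun (congrFun h i) j
  have h1 := e i i
  have h2 := e i k
  have h3 := e k k
  rw [one_apply_eq, mul_one] at h1 h3
  rw [one_apply_ne hik, mul_zero] at h2
  rcases mul_eq_zero.1 h2 with h0 | h0
  · rw [← h1, h0, zero_mul]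
  · rw [← h3, h0, mul_zero]

/-- The annihilator of u⊗v contains all p⊗q with v·p = 0 and q·u = 0. If b is annihilated by these,
bp⊗q is a scalar matrix of rank at most one and size at least 2, hence zero; likewise p⊗qb. So b
kills v^⊥ on the right and u^⊥ on the left, and is a multiple of u⊗v. -/
theorem isMinimal_pslUp_vecMulVec (hm : 2 ≤ m) (hn : 2 ≤ n) {u : Fin m → ℂ} {v : Fin n → ℂ}
    (hu : u ≠ 0) (hv : v ≠ 0) : (psl m n).IsMinimal (pslUp (vecMulVec u v)) := by
  have := Fin.nontrivial_iff_two_le.2 hm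
  have := Fin.nontrivial_iff_two_le.2 hn
  constructor
  · intro x' hx' h
    obtain ⟨b, rfl⟩ : ∃ b, pslUp b = x' := ⟨_, pslUp_pslUpper hx'⟩
    have key : ∀ p q, v ⬝ᵥ p = 0 → q ⬝ᵥ u = 0 →
        vecMulVec (b *ᵥ p) q = 0 ∧ vecMulVec p (q ᵥ* b) = 0 := by
      intro p q hp hq
      have h1 := h (pslDown (vecMulVec p q)) (pslDown_mem _) (bracket_pslUp_pslDown_eq_zero.2
        ⟨0, by simp [vecMulVec_mul_vecMulVec, hp],
          by simp [vecMulVec_mul_vecMulVec, hq]⟩)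
      obtain ⟨z, hz1, hz2⟩ := bracket_pslUp_pslDown_eq_zero.1 h1
      rw [mul_vecMulVec] at hz1
      rw [vecMulVec_mul] at hz2
      have hz := eq_zero_of_vecMulVec_eq_smul_one hz1
      rw [hz1, hz2, hz]
      simp
    have hbp : ∀ p, v ⬝ᵥ p = 0 → b *ᵥ p = 0 := by
      intro p hp
      obtain ⟨q, hq0, hq⟩ := exists_ne_zero_of_dotProduct_eq_zero u
      exact (vecMulVec_eq_zero' (key p q hp hq).1).resolve_right hq0
    have hqb : ∀ q, q ⬝ᵥ u = 0 → q ᵥ* b = 0 := by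
      intro q hq
      obtain ⟨p, hp0, hp⟩ := exists_ne_zero_of_dotProduct_eq_zero v
      exact (vecMulVec_eq_zero' (key p q (by rwa [dotProduct_comm]) hq).2).resolve_left hp0
    obtain ⟨i, hi⟩ := Function.ne_iff.1 hu
    obtain ⟨j, hj⟩ := Function.ne_iff.1 hv
    have hi' : u i ≠ 0 := hi
    have hj' : v j ≠ 0 := hj
    refine ⟨b i j / (u i * v j), ?_⟩
    rw [← map_smul]
    congr 1
    ext k l
    have h1 : v j * b k l = v l * b k j := by
      have := congrFun (hbp (Pi.single l (v j) - Pi.single j (v l))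
        (by simp [dotProduct_sub, mul_comm])) k
      simpa [mulVec_sub, sub_eq_zero] using this
    have h2 : u i * b k j = u k * b i j := by
      have := congrFun (hqb (Pi.single k (u i) - Pi.single i (u k))
        (by simp [sub_dotProduct, mul_comm])) j
      simpa [sub_vecMul, sub_eq_zero] using this
    simp only [Matrix.smul_apply, vecMulVec_apply, smul_eq_mul]
    field_simp
    linear_combination u i * h1 + v l * h2
  -- The fixing element is a = u⊗r - y⊗q with r·u = 1, q·u = 0 and q·y = 1: it maps u to u, and the
  -- second term makes it traceless, so that diag(a, 0) lies in sl(m,n).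
  · obtain ⟨r, hr⟩ := exists_dotProduct_eq_one hu
    obtain ⟨q, hq0, hq⟩ := exists_ne_zero_of_dotProduct_eq_zero u
    obtain ⟨y, hy⟩ := exists_dotProduct_eq_one hq0
    have hmem : fromBlocks (vecMulVec u r - vecMulVec y q) 0 0 0 ∈ slSpace m n := by
      rw [fromBlocks_mem_slSpace]
      simp [trace_vecMulVec, dotProduct_comm u r, hr, hy]
    refine ⟨pslMk _ hmem, mem_psl_deg.2 ⟨_, _, ?_, rfl⟩, ?_⟩
    · rintro (i | i) (j | j) h <;> simp [pslWeight] at h ⊢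
    · rw [bracket_pslMk_pslUp]
      congr 1
      simp [Matrix.sub_mul, vecMulVec_mul_vecMulVec, hr, hq, vecMulVec_zero_right]

/-- For every matrix unit e the element b e b is annihilated by the annihilator of b, so minimality
makes it a multiple of b; but b e b has rank at most one. The fixing element w serves to exclude
invertible b in psl(n,n), whose annihilator contains b⁻¹. -/
theorem exists_vecMulVec_of_isMinimal (hm : 1 ≤ m) {b : Matrix (Fin m) (Fin n) ℂ}
    (hb : (psl m n).IsMinimal (pslUp b)) : ∃ x y, b = vecMulVec x y := by
  by_cases hb0 : b = 0
  · exact ⟨0, 0, by simp [hb0]⟩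
  obtain ⟨h1, w, hw, hwb⟩ := hb
  obtain ⟨a, d, hw', htr, rfl⟩ := exists_of_mem_psl_deg_zero hw
  rw [bracket_pslMk_pslUp] at hwb
  have hab := pslUp_injective hwb
  have hann : ∀ c, (psl m n).bracket (pslUp b) (pslDown c) = 0 → b * c = 0 ∧ c * b = 0 := by
    intro c hc
    obtain ⟨z, hz1, hz2⟩ := bracket_pslUp_pslDown_eq_zero.1 hc
    suffices hz : z = 0 by rw [hz1, hz2, hz]; simp
    -- With ab - bd = b and bc = cb = z, the trace of (ab - bd)c is z·m on one side and z(tr a - tr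
    -- d) = 0 on the other.
    have h2 : ((a * b - b * d) * c).trace = z * m := by rw [hab, hz1]; simp
    have h3 : ((a * b - b * d) * c).trace = 0 := by
      rw [Matrix.sub_mul, trace_sub, Matrix.mul_assoc a, hz1, Matrix.mul_assoc b,
        trace_mul_comm b, Matrix.mul_assoc d, hz2]
      simp [htr]
    rw [h3, eq_comm, mul_eq_zero] at h2
    exact h2.resolve_right (by exact_mod_cast (by lia : m ≠ 0))
  obtain ⟨i, j, hij⟩ : ∃ i j, b i j ≠ 0 := by
    by_contra hc
    push Not at hc
    exact hb0 (by ext i j; exact hc i j)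
  obtain ⟨z, hz⟩ := h1 (pslUp (b * vecMulVec (Pi.single j (1 : ℂ)) (Pi.single i (1 : ℂ)) * b))
    (pslUp_mem _)
    (fun y hy hby => by
      obtain ⟨c, rfl⟩ : ∃ c, pslDown c = y := ⟨_, pslDown_pslLower hy⟩
      obtain ⟨h2, h3⟩ := hann c hby
      rw [bracket_pslUp_pslDown_eq_zero]
      refine ⟨0, ?_, ?_⟩
      · rw [Matrix.mul_assoc, h2]; simp
      · rw [← Matrix.mul_assoc, ← Matrix.mul_assoc, h3]; simp)
  rw [← map_smul] at hz
  have hz' := pslUp_injective hz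
  rw [mul_vecMulVec, vecMulVec_mul] at hz'
  -- The (i, j) entry of b e_j e_iᵗ b is (b i j)², which is nonzero.
  have hz0 : z ≠ 0 := by
    rintro rfl
    have := congrFun (congrFun hz' i) j
    simp [vecMulVec_apply, hij] at this
  refine ⟨z⁻¹ • (b *ᵥ Pi.single j 1), Pi.single i 1 ᵥ* b, ?_⟩
  rw [smul_vecMulVec, hz', smul_smul, inv_mul_cancel₀ hz0, one_smul]

/-- With a single row every matrix has rank at most one and the form PbQ is automatic. The case
min(m, n) = 1 needs this separately, as the minimality argument requires m, n ≥ 2. -/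
theorem eq_mul_mul_of_subsingleton_left {α β ι κ : Type*} [Fintype α] [Fintype β] [DecidableEq α]
    [DecidableEq β] [Unique α] [Unique ι] [Nonempty β] (T : Matrix α β ℂ ≃ₗ[ℂ] Matrix ι κ ℂ) :
    ∃ (P : Matrix ι α ℂ) (Q : Matrix β κ ℂ), ∀ b, T b = P * b * Q := by
  refine eq_mul_mul_of_isRowType_of_isColType T (fun u => ⟨1, fun v => ⟨onVecMulVec T.toLinearMap u v default, ?_⟩⟩)
    (fun v => ⟨T (vecMulVec 1 v) default, fun u => ⟨fun _ => u default, ?_⟩⟩)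
  · ext i j
    simp [vecMulVec_apply, Unique.eq_default i]
  · have hu : u = u default • 1 := by ext i; simp [Unique.eq_default i]
    ext i j
    rw [LinearMap.flip_apply, hu, map_smul, LinearMap.smul_apply]
    simp [vecMulVec_apply, onVecMulVec_apply, Unique.eq_default i]

theorem eq_mul_mul_of_subsingleton_right {α β ι κ : Type*} [Fintype α] [Fintype β] [DecidableEq α]
    [DecidableEq β] [Unique β] [Unique κ] [Nonempty α] (T : Matrix α β ℂ ≃ₗ[ℂ] Matrix ι κ ℂ) :
    ∃ (P : Matrix ι α ℂ) (Q : Matrix β κ ℂ), ∀ b, T b = P * b * Q := by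
  refine eq_mul_mul_of_isRowType_of_isColType T
    (fun u => ⟨fun i => T (vecMulVec u 1) i default, fun v => ⟨fun _ => v default, ?_⟩⟩)
    (fun v => ⟨1, fun u => ⟨fun i => T (vecMulVec u v) i default, ?_⟩⟩)
  · have hv : v = v default • 1 := by ext i; simp [Unique.eq_default i]
    ext i j
    rw [hv, map_smul]
    simp [vecMulVec_apply, onVecMulVec_apply, Unique.eq_default j, mul_comm]
  · ext i j
    simp [vecMulVec_apply, onVecMulVec_apply, Unique.eq_default j]

/-- The linear equivalence induced on `𝔤_1` by a graded automorphism of `psl(m,n)`. -/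
def pslUpEquiv {φ : pslSpace m n ≃ₗ[ℂ] pslSpace m n} (hφ : (psl m n).IsGradedAutomorphism φ) :
    Matrix (Fin m) (Fin n) ℂ ≃ₗ[ℂ] Matrix (Fin m) (Fin n) ℂ :=
  LinearEquiv.ofLinearMap (pslUpper.comp (φ.toLinearMap.comp pslUp))
    (pslUpper.comp (φ.symm.toLinearMap.comp pslUp))
    (LinearMap.ext fun b => by simp [pslUp_pslUpper (hφ.symm.mem_deg (pslUp_mem b))])
    (LinearMap.ext fun b => by simp [pslUp_pslUpper (hφ.mem_deg (pslUp_mem b))])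

theorem pslUp_pslUpEquiv {φ : pslSpace m n ≃ₗ[ℂ] pslSpace m n}
    (hφ : (psl m n).IsGradedAutomorphism φ) (b : Matrix (Fin m) (Fin n) ℂ) :
    pslUp (pslUpEquiv hφ b) = φ (pslUp b) :=
  pslUp_pslUpper (hφ.mem_deg (pslUp_mem b))

/-- The graded automorphisms of `psl(m,n)` act on `𝔤_1` by `b ↦ P b Q` or `b ↦ P bᵗ Q`. -/
theorem psl_gradedAutomorphism_form (hm : 1 ≤ m) (hn : 1 ≤ n)
    {φ : pslSpace m n ≃ₗ[ℂ] pslSpace m n} (hφ : (psl m n).IsGradedAutomorphism φ) :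
    (∃ (P : Matrix (Fin m) (Fin m) ℂ) (Q : Matrix (Fin n) (Fin n) ℂ),
      ∀ b, pslUpEquiv hφ b = P * b * Q) ∨
    (2 ≤ m ∧ 2 ≤ n) ∧ ∃ (P : Matrix (Fin m) (Fin n) ℂ) (Q : Matrix (Fin m) (Fin n) ℂ),
      ∀ b, pslUpEquiv hφ b = P * bᵀ * Q := by
  have : NeZero m := ⟨by lia⟩
  have : NeZero n := ⟨by lia⟩
  rcases Nat.eq_or_lt_of_le hm with rfl | hm'
  · exact Or.inl (eq_mul_mul_of_subsingleton_left _)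
  rcases Nat.eq_or_lt_of_le hn with rfl | hn'
  · exact Or.inl (eq_mul_mul_of_subsingleton_right _)
  have := Fin.nontrivial_iff_two_le.2 hm'
  have := Fin.nontrivial_iff_two_le.2 hn'
  refine (eq_mul_mul_or_eq_mul_transpose_mul (pslUpEquiv hφ) fun u v => ?_).imp id
    fun h => ⟨⟨hm', hn'⟩, h⟩
  by_cases hu : u = 0
  · exact ⟨0, 0, by simp [hu, zero_vecMulVec]⟩
  by_cases hv : v = 0
  · exact ⟨0, 0, by simp [hv, vecMulVec_zero_right]⟩
  refine exists_vecMulVec_of_isMinimal hm ?_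
  rw [pslUp_pslUpEquiv]
  exact (isMinimal_pslUp_vecMulVec hm' hn' hu hv).map hφ

end psl

end

/-! ### The form of a conjugation of psl(m,n) on 𝔤_1; the Hermitian case. -/

section

open Matrix GradedLieSuperalgebra

section

set_option linter.unusedSectionVars false

variable {α β : Type*} [Fintype α] [Fintype β] [DecidableEq α] [DecidableEq β]

/-- Inserting matrix units gives e_ij E_ab = e_ba E_ji for all a, b. If either size exceeds 1, one
can choose (a, b) ≠ (j, i), and then e_ij = 0. -/
theorem eq_zero_of_forall_mul_mul_comm {e : Matrix α β ℂ} 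
    (h : ∀ x y : Matrix β α ℂ, x * e * y = y * e * x)
    (hne : Nontrivial α ∨ Nontrivial β) : e = 0 := by
  ext i j
  have key : ∀ a b, single a b (e i j) = single j i (e b a) := by
    intro a b
    have := h (single a i 1) (single j b 1)
    simpa using this
  rcases hne with h | h
  · obtain ⟨k, hk⟩ := exists_ne i
    have := congrFun (congrFun (key j k) j) k
    simpa [Matrix.single_apply, hk.symm] using this
  · obtain ⟨k, hk⟩ := exists_ne j
    have := congrFun (congrFun (key k i) k) i
    simpa [Matrix.single_apply, hk.symm] using this

theorem exists_eq_smul_one_of_forall_mul_eq_mul [Nonempty α] [Nonempty β] {K : Matrix α α ℂ}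
    {L : Matrix β β ℂ} (h : ∀ x : Matrix α β ℂ, K * x = x * L) :
    ∃ z : ℂ, K = z • 1 ∧ L = z • 1 := by
  obtain ⟨i₀⟩ := ‹Nonempty α›
  obtain ⟨j₀⟩ := ‹Nonempty β›
  have key : ∀ i j a b, (if b = j then K a i else 0) = if a = i then L j b else 0 := by
    intro i j a b
    have := congrFun (congrFun (h (single i j 1)) a) b
    by_cases h1 : b = j <;> by_cases h2 : a = i
    · subst h1 h2; simpa using this
    · subst h1; simpa [h2] using this
    · subst h2; simpa [h1] using this
    · simp [h1, h2]
  have hK : ∀ a i, K a i = if a = i then L j₀ j₀ else 0 := by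
    intro a i
    simpa using key i j₀ a j₀
  have hL : ∀ j b, L j b = if b = j then K i₀ i₀ else 0 := by
    intro j b
    simpa using (key i₀ j i₀ b).symm
  have h0 : K i₀ i₀ = L j₀ j₀ := by simpa using hK i₀ i₀
  refine ⟨L j₀ j₀, ?_, ?_⟩
  · ext a i
    simp [hK, Matrix.one_apply]
  · ext j b
    rw [hL, h0, Matrix.smul_apply, Matrix.one_apply]
    by_cases hjb : j = b
    · simp [hjb]
    · simp [hjb, Ne.symm hjb]

/-- On rank one matrices the map is u⊗v ↦ Pu⊗vQ, so a kernel vector of P or Q would produce a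
nonzero matrix sent to zero. -/
theorem isUnit_of_injective_mul_mul [Nonempty α] [Nonempty β] {P : Matrix α α ℂ}
    {Q : Matrix β β ℂ} (h : Function.Injective fun b : Matrix α β ℂ => P * b * Q) :
    IsUnit P ∧ IsUnit Q := by
  have h0 : ∀ u v, vecMulVec (P *ᵥ u) (v ᵥ* Q) = 0 → u = 0 ∨ v = 0 := by
    intro u v huv
    refine vecMulVec_eq_zero' (h ?_)
    simpa [mul_vecMulVec, vecMulVec_mul] using huv
  constructor
  · rw [← Matrix.mulVec_injective_iff_isUnit]
    refine (injective_iff_map_eq_zero P.mulVecLin).2 fun u hu => ?_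
    obtain ⟨v, hv⟩ := exists_ne (0 : β → ℂ)
    refine (h0 u v ?_).resolve_right hv
    rw [show P *ᵥ u = 0 from hu, zero_vecMulVec]
  · rw [← Matrix.vecMul_injective_iff_isUnit]
    refine (injective_iff_map_eq_zero Q.vecMulLinear).2 fun v hv => ?_
    obtain ⟨u, hu⟩ := exists_ne (0 : α → ℂ)
    refine (h0 u v ?_).resolve_left hu
    rw [show v ᵥ* Q = 0 from hv, vecMulVec_zero_right]

/-- Here u⊗v ↦ Pv⊗uQ, so v ↦ Pv and u ↦ uQ are injections between ℂ^α and ℂ^β in opposite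
directions. This confines the transposed form to m = n. -/
theorem card_eq_of_injective_mul_transpose_mul [Nonempty α] [Nonempty β] {P Q : Matrix α β ℂ}
    (h : Function.Injective fun b : Matrix α β ℂ => P * bᵀ * Q) :
    Fintype.card α = Fintype.card β := by
  have h0 : ∀ u v, vecMulVec (P *ᵥ v) (u ᵥ* Q) = 0 → u = 0 ∨ v = 0 := by
    intro u v huv
    refine vecMulVec_eq_zero' (h ?_)
    simpa [mul_vecMulVec, vecMulVec_mul, transpose_vecMulVec] using huv
  apply le_antisymm
  · have h1 : Function.Injective Q.vecMulLinear := by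
      refine (injective_iff_map_eq_zero Q.vecMulLinear).2 fun u hu => ?_
      obtain ⟨v, hv⟩ := exists_ne (0 : β → ℂ)
      refine (h0 u v ?_).resolve_right hv
      rw [show u ᵥ* Q = 0 from hu, vecMulVec_zero_right]
    simpa using LinearMap.finrank_le_finrank_of_injective h1
  · have h1 : Function.Injective P.mulVecLin := by
      refine (injective_iff_map_eq_zero P.mulVecLin).2 fun v hv => ?_
      obtain ⟨u, hu⟩ := exists_ne (0 : α → ℂ)
      refine (h0 u v ?_).resolve_left hu
      rw [show P *ᵥ v = 0 from hv, zero_vecMulVec]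
    simpa using LinearMap.finrank_le_finrank_of_injective h1

end

section psl

variable {m n : ℕ}

/-- The action of an anti-linear graded conjugation from `𝔤_1` to `𝔤_{-1}` respects the triple
product up to sign. -/
theorem psl_conjugation_triple {σ : pslSpace m n →ₛₗ[starRingEnd ℂ] pslSpace m n}
    (hσ : (psl m n).IsAntilinearGradedConjugation σ)
    {F : Matrix (Fin m) (Fin n) ℂ → Matrix (Fin n) (Fin m) ℂ}
    (hF : ∀ b, σ (pslUp b) = pslDown (F b)) (x b b' : Matrix (Fin m) (Fin n) ℂ) :
    F (b * F x * b' - b' * F x * b) = F b' * x * F b - F b * x * F b' := by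
  -- The identity arises by applying σ to [[b, F x], b'] and using σ(F x) = -x.
  have h1 : (psl m n).bracket ((psl m n).bracket (pslUp b) (pslDown (F x))) (pslUp b') =
      pslUp (b * F x * b' - b' * F x * b) := by
    rw [bracket_pslUp_pslDown, bracket_pslMk_pslUp, Matrix.mul_assoc b' (F x) b]
  have h2 : σ (pslDown (F x)) = -pslUp x := by
    rw [← hF, hσ.apply_apply_one (pslUp_mem x)]
  apply pslDown_injective
  rw [← hF, ← h1, hσ.map_bracket, hσ.map_bracket, hF, hF, h2, map_neg, map_neg,
    LinearMap.neg_apply, bracket_pslDown_pslUp, bracket_pslMk_pslDown, ← map_neg]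
  congr 1
  rw [neg_sub, Matrix.mul_assoc (F b') x (F b)]

/-- On `𝔤_1` an anti-linear graded conjugation has the form `b ↦ D b̄ᵗ C` or `b ↦ E b̄ G`. -/
theorem psl_conjugation_form (hm : 1 ≤ m) (hn : 1 ≤ n)
    {σ : pslSpace m n →ₛₗ[starRingEnd ℂ] pslSpace m n}
    (hσ : (psl m n).IsAntilinearGradedConjugation σ) :
    (∃ (D : GL (Fin n) ℂ) (C : GL (Fin m) ℂ), ∀ b, σ (pslUp b) = pslDown (D.1 * bᴴ * C.1)) ∨
    (2 ≤ m ∧ m = n) ∧ ∃ E G : Matrix (Fin n) (Fin m) ℂ,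
      ∀ b, σ (pslUp b) = pslDown (E * b.map star * G) := by
  have : NeZero m := ⟨by lia⟩
  have : NeZero n := ⟨by lia⟩
  -- The map σ̃₁ is the listed conjugation whose signs are all positive.
  have hτ : (psl m n).IsAntilinearGradedConjugation (pslSigma m n) := by
    have h1 := psl_sign_conjugation m n m n
    have h2 : (pslAd (signMatrix m m) (signMatrix n n)).comp (pslSigma m n) = pslSigma m n := by
      refine LinearMap.ext fun x => ?_
      obtain ⟨X, hX, rfl⟩ := exists_pslMk x
      refine pslMk_congr ?_ _
      have h3 : blockDiag (signMatrix m m) (signMatrix n n) = 1 := by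
        apply Units.ext
        show fromBlocks (signMatrix m m).1 0 0 (signMatrix n n).1 = 1
        rw [← fromBlocks_one]
        simp [signMatrix]
      show (blockDiag (signMatrix m m) (signMatrix n n)).1 * sigmaTilde X *
        (blockDiag (signMatrix m m) (signMatrix n n)).2 = sigmaTilde X
      rw [h3]
      show 1 * sigmaTilde X * 1 = _
      rw [one_mul, mul_one]
    rwa [h2] at h1
  -- Composing with σ̃₁ gives a linear automorphism T on 𝔤_1 with σ(b) = (Tb)ᴴ; the two possible
  -- forms of T yield the two forms of σ.
  have hφ := hτ.compEquiv_isGradedAutomorphism hσ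
  have hdown : ∀ b, σ (pslUp b) = pslDown (pslLower (σ (pslUp b))) := fun b =>
    (pslDown_pslLower (hσ.mem_deg (pslUp_mem b))).symm
  have hT : ∀ b, σ (pslUp b) = pslDown (pslUpEquiv hφ b)ᴴ := by
    intro b
    have h1 := pslUp_pslUpEquiv hφ b
    rw [IsAntilinearGradedConjugation.compEquiv_apply, hdown b, pslSigma_pslDown] at h1
    rw [pslUp_injective h1, conjTranspose_conjTranspose]
    exact hdown b
  rcases psl_gradedAutomorphism_form hm hn hφ with ⟨P, Q, hPQ⟩ | ⟨⟨hm', hn'⟩, P, Q, hPQ⟩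
  · left
    have hinj : Function.Injective fun b : Matrix (Fin m) (Fin n) ℂ => P * b * Q := by
      have := (pslUpEquiv hφ).injective
      rwa [show (pslUpEquiv hφ : _ → _) = fun b => P * b * Q from funext hPQ] at this
    obtain ⟨hP, hQ⟩ := isUnit_of_injective_mul_mul hinj
    have hP' : IsUnit Pᴴ := hP.star
    have hQ' : IsUnit Qᴴ := hQ.star
    refine ⟨hQ'.unit, hP'.unit, fun b => ?_⟩
    rw [hT, hPQ, conjTranspose_mul, conjTranspose_mul, ← Matrix.mul_assoc]
    rfl
  · right
    have hinj : Function.Injective fun b : Matrix (Fin m) (Fin n) ℂ => P * bᵀ * Q := by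
      have := (pslUpEquiv hφ).injective
      rwa [show (pslUpEquiv hφ : _ → _) = fun b => P * bᵀ * Q from funext hPQ] at this
    refine ⟨⟨hm', by simpa using card_eq_of_injective_mul_transpose_mul hinj⟩, Qᴴ, Pᴴ,
      fun b => ?_⟩
    rw [hT, hPQ, conjTranspose_mul, conjTranspose_mul, ← Matrix.mul_assoc]
    rfl

/-- In the form `b ↦ D b̄ᵗ C` the matrices `C` and `D` can be chosen Hermitian. -/
theorem psl_conjugation_hermitian (hm : 1 ≤ m) (hn : 1 ≤ n) (hmn : 2 ≤ m ∨ 2 ≤ n)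
    {σ : pslSpace m n →ₛₗ[starRingEnd ℂ] pslSpace m n}
    (hσ : (psl m n).IsAntilinearGradedConjugation σ) {D : GL (Fin n) ℂ} {C : GL (Fin m) ℂ}
    (h : ∀ b, σ (pslUp b) = pslDown (D.1 * bᴴ * C.1)) :
    ∃ (D' : GL (Fin n) ℂ) (C' : GL (Fin m) ℂ), D'.1.IsHermitian ∧ C'.1.IsHermitian ∧
      ∀ b, σ (pslUp b) = pslDown (D'.1 * bᴴ * C'.1) := by
  have : NeZero m := ⟨by lia⟩
  have : NeZero n := ⟨by lia⟩
  -- The triple product identity says that e = CᴴxDᴴ - CxD satisfies b'eb = beb' for all b, b',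
  -- which forces e = 0.
  have h1 : ∀ x : Matrix (Fin m) (Fin n) ℂ, C.1ᴴ * x * D.1ᴴ = C.1 * x * D.1 := by
    intro x
    rw [← sub_eq_zero]
    refine eq_zero_of_forall_mul_mul_comm (fun b' b => ?_)
      (hmn.imp Fin.nontrivial_iff_two_le.2 Fin.nontrivial_iff_two_le.2)
    have h2 := psl_conjugation_triple hσ h x bᴴ b'ᴴ
    simp only [conjTranspose_sub, conjTranspose_mul, conjTranspose_conjTranspose] at h2
    have h3 : D.1 * (b' * (C.1ᴴ * x * D.1ᴴ - C.1 * x * D.1) * b) * C.1 =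
        D.1 * (b * (C.1ᴴ * x * D.1ᴴ - C.1 * x * D.1) * b') * C.1 := by
      simp only [Matrix.mul_sub, Matrix.sub_mul, Matrix.mul_assoc] at h2 ⊢
      rw [sub_eq_sub_iff_add_eq_add] at h2 ⊢
      rw [h2, add_comm]
    have h4 := congrArg (fun y => D.2 * y * C.2) h3
    simpa only [Matrix.mul_assoc, GL_inv_mul_mul, C.3, Matrix.mul_one] using h4
  -- Cancelling C and Dᴴ leaves C⁻¹Cᴴ x = x D D⁻ᴴ for every x, so both factors are the same scalar
  -- z, which has modulus one because Cᴴ = zC.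
  obtain ⟨z, hz1, hz2⟩ := exists_eq_smul_one_of_forall_mul_eq_mul (K := C.2 * C.1ᴴ)
    (L := D.1 * D.2ᴴ) (fun x => by
      have h5 := congrArg (fun y => C.2 * y * D.2ᴴ) (h1 x)
      have h6 : D.1ᴴ * D.2ᴴ = 1 := by rw [← conjTranspose_mul, D.4, conjTranspose_one]
      simpa only [Matrix.mul_assoc, GL_inv_mul_mul, h6, Matrix.mul_one] using h5)
  have hC : C.1ᴴ = z • C.1 := by
    have := congrArg (fun y => C.1 * y) hz1
    simpa only [GL_mul_inv_mul, Matrix.mul_smul, Matrix.mul_one] using this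
  have hD : D.1 = z • D.1ᴴ := by
    have h6 : D.2ᴴ * D.1ᴴ = 1 := by rw [← conjTranspose_mul, D.3, conjTranspose_one]
    have := congrArg (fun y => y * D.1ᴴ) hz2
    simpa only [Matrix.mul_assoc, h6, Matrix.smul_mul, Matrix.mul_one, Matrix.one_mul] using this
  have hzz : star z * z = 1 := by
    have h7 : C.1 = (star z * z) • C.1 := by
      conv_lhs => rw [← conjTranspose_conjTranspose C.1, hC, conjTranspose_smul, hC, smul_smul]
    have h8 : ((star z * z) - 1) • C.1 = 0 := by rw [sub_smul, ← h7, one_smul, sub_self]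
    exact sub_eq_zero.1 ((smul_eq_zero.1 h8).resolve_right C.ne_zero)
  -- With w² = z and |w| = 1, the matrices wC and w⁻¹D are Hermitian, and the product D b̄ᵗ C is
  -- unchanged.
  obtain ⟨w, hw⟩ := IsAlgClosed.exists_pow_nat_eq z (n := 2) (by norm_num)
  have hww : star w * w = 1 := by
    have h9 : (star w * w) ^ 2 = 1 := by
      rw [mul_pow, ← star_pow, hw, hzz]
    have h10 : star w * w = ((Complex.normSq w : ℝ) : ℂ) := by
      rw [Complex.normSq_eq_conj_mul_self]; rfl
    rw [h10] at h9 ⊢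
    have h11 : (Complex.normSq w) ^ 2 = 1 := by exact_mod_cast h9
    have h12 := Complex.normSq_nonneg w
    have h13 : Complex.normSq w = 1 := by nlinarith
    rw [h13]; simp
  have hw0 : w ≠ 0 := by rintro rfl; simp at hww
  let W : ℂˣ := Units.mk0 w hw0
  have hWi : ((W⁻¹ : ℂˣ) : ℂ) = star w := by
    rw [Units.val_inv_eq_inv_val]
    exact inv_eq_of_mul_eq_one_left hww
  refine ⟨W⁻¹ • D, W • C, ?_, ?_, fun b => ?_⟩
  · show (((W⁻¹ : ℂˣ) : ℂ) • D.1)ᴴ = ((W⁻¹ : ℂˣ) : ℂ) • D.1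
    rw [hWi, conjTranspose_smul, star_star]
    conv_rhs => rw [hD, smul_smul, ← hw, pow_two, ← mul_assoc, hww, one_mul]
  · show (w • C.1)ᴴ = w • C.1
    rw [conjTranspose_smul, hC, smul_smul, ← hw, pow_two, ← mul_assoc, hww, one_mul]
  · rw [h]
    congr 1
    show _ = (((W⁻¹ : ℂˣ) : ℂ) • D.1) * bᴴ * (w • C.1)
    rw [hWi, Matrix.smul_mul, Matrix.smul_mul, Matrix.mul_smul, smul_smul, hww, one_smul]

/-- Conjugating σ by Ad diag(A, B) changes C⁻¹ and D by congruences with A and B, so Sylvester's law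
applies to each separately. -/
theorem psl_equivalent_sign (hm : 1 ≤ m) (hn : 1 ≤ n)
    {σ : pslSpace m n →ₛₗ[starRingEnd ℂ] pslSpace m n}
    (hσ : (psl m n).IsAntilinearGradedConjugation σ) {D : GL (Fin n) ℂ} {C : GL (Fin m) ℂ}
    (hD : D.1.IsHermitian) (hC : C.1.IsHermitian)
    (h : ∀ b, σ (pslUp b) = pslDown (D.1 * bᴴ * C.1)) :
    ∃ p ≤ m, ∃ q ≤ n, (psl m n).Equivalent σ
      ((pslAd (signMatrix m p) (signMatrix n q)).comp (pslSigma m n)) := by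
  have hC' : C.2.IsHermitian := by
    have := GL_inv_conjTranspose (A := C) (ε := 1) (by simp) (by rw [one_smul]; exact hC)
    rwa [one_smul] at this
  obtain ⟨p, hp, A, hA⟩ := exists_congr_signMatrix hC' (C⁻¹).isUnit
  -- The sign of D is reversed because σ̃₁ sends b to -b̄ᵗ.
  obtain ⟨q, hq, B, hB⟩ := exists_congr_signMatrix hD.neg D.isUnit.neg
  refine ⟨p, hp, q, hq, hσ.equivalent_of_eqOn (psl_sign_conjugation m n p q)
    (psl_generated hm hn) (pslAdEquiv_isGradedAutomorphism A B) fun x hx => ?_⟩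
  obtain ⟨b, rfl⟩ : ∃ b, pslUp b = x := ⟨_, pslUp_pslUpper hx⟩
  show pslAd _ _ (pslSigma m n (pslAd A B (pslUp b))) = pslAd A B (σ (pslUp b))
  rw [h, pslAd_pslUp, pslAd_pslDown, pslSigma_pslUp, pslAd_pslDown]
  congr 1
  have e1 : A.1ᴴ * (signMatrix m p).2 = C.1 * A.2 := by
    have h1 : A.1ᴴ = C.1 * A.2 * (signMatrix m p).1 := by
      rw [← hA]
      simp only [Matrix.mul_assoc, GL_inv_mul_mul, GL_mul_inv_mul]
    rw [h1, Matrix.mul_assoc, (signMatrix m p).3, Matrix.mul_one]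
  have e2 : (signMatrix n q).1 * B.2ᴴ = -(B.1 * D.1) := by
    have h6 : B.1ᴴ * B.2ᴴ = 1 := by rw [← conjTranspose_mul, B.4, conjTranspose_one]
    rw [← hB, Matrix.mul_assoc, h6]
    simp
  calc (signMatrix n q).1 * -(A.1 * b * B.2)ᴴ * (signMatrix m p).2
      = -(((signMatrix n q).1 * B.2ᴴ) * bᴴ * (A.1ᴴ * (signMatrix m p).2)) := by
        simp only [conjTranspose_mul, Matrix.mul_neg, Matrix.neg_mul, Matrix.mul_assoc]
    _ = B.1 * (D.1 * bᴴ * C.1) * A.2 := by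
        rw [e1, e2]
        simp only [Matrix.neg_mul, neg_neg, Matrix.mul_assoc]

end psl

end

/-! ### The conjugations τ_±, the case psl(1,1), and the lists for psl. -/

section

open Matrix GradedLieSuperalgebra

section psl

variable {m n : ℕ}

theorem map_star_mul {α β γ : Type*} [Fintype β] (x : Matrix α β ℂ) (y : Matrix β γ ℂ) :
    (x * y).map star = x.map star * y.map star := Matrix.map_mul (f := starRingEnd ℂ)

theorem map_star_map_star {α β : Type*} (x : Matrix α β ℂ) : (x.map star).map star = x := by
  ext i j; simp

theorem map_star_smul {α β : Type*} (c : ℂ) (x : Matrix α β ℂ) :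
    (c • x).map star = star c • x.map star := by ext i j; simp

theorem map_star_sub {α β : Type*} (x y : Matrix α β ℂ) :
    (x - y).map star = x.map star - y.map star := by ext i j; simp

/-- A conjugation of the form `b ↦ E b̄ G` on `𝔤_1` satisfies `E b̄ G = i t E b̄ Ē` with `t` real. -/
theorem psl_conjugation_tau_form (hn : 2 ≤ n)
    {σ : pslSpace n n →ₛₗ[starRingEnd ℂ] pslSpace n n}
    (hσ : (psl n n).IsAntilinearGradedConjugation σ) {E G : Matrix (Fin n) (Fin n) ℂ}
    (h : ∀ b, σ (pslUp b) = pslDown (E * b.map star * G)) :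
    IsUnit E ∧ ∃ t : ℝ, t ≠ 0 ∧
      ∀ b, σ (pslUp b) = pslDown ((Complex.I * t) • (E * b.map star * E.map star)) := by
  have : NeZero n := ⟨by lia⟩
  have hnt := Fin.nontrivial_iff_two_le.2 hn
  have hinj : Function.Injective fun b : Matrix (Fin n) (Fin n) ℂ => E * b * G := by
    intro b b' hbb
    have h1 : σ (pslUp (b.map star)) = σ (pslUp (b'.map star)) := by
      rw [h, h, map_star_map_star, map_star_map_star]
      exact congrArg _ hbb
    have h2 := pslUp_injective (hσ.bijective.1 h1)
    rw [← map_star_map_star b, h2, map_star_map_star]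
  obtain ⟨hE, hG⟩ := isUnit_of_injective_mul_mul hinj
  refine ⟨hE, ?_⟩
  obtain ⟨E, rfl⟩ := hE
  obtain ⟨G, rfl⟩ := hG
  have hGs : G.2.map star * G.1.map star = 1 := by
    rw [← map_star_mul, G.4]; ext i j; simp [Matrix.one_apply, apply_ite]
  have hGs' : G.1.map star * G.2.map star = 1 := by
    rw [← map_star_mul, G.3]; ext i j; simp [Matrix.one_apply, apply_ite]
  -- For the form E b̄ G the triple product reverses the order of the factors, which produces a sum
  -- ĒxḠ + GxE = 0 instead of a difference.
  have h1 : ∀ x : Matrix (Fin n) (Fin n) ℂ,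
      E.1.map star * x * G.1.map star + G.1 * x * E.1 = 0 := by
    intro x
    refine eq_zero_of_forall_mul_mul_comm (fun b b' => ?_) (Or.inl hnt)
    have h2 := psl_conjugation_triple hσ h x (b.map star) (b'.map star)
    simp only [map_star_sub, map_star_mul, map_star_map_star] at h2
    have h3 : E.1 * (b * (E.1.map star * x * G.1.map star + G.1 * x * E.1) * b') * G.1 =
        E.1 * (b' * (E.1.map star * x * G.1.map star + G.1 * x * E.1) * b) * G.1 := by
      simp only [Matrix.mul_add, Matrix.add_mul, Matrix.mul_sub, Matrix.sub_mul,
        Matrix.mul_assoc] at h2 ⊢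
      rw [sub_eq_sub_iff_add_eq_add] at h2
      rw [h2, add_comm]
    have h4 := congrArg (fun y => E.2 * y * G.2) h3
    simpa only [Matrix.mul_assoc, GL_inv_mul_mul, G.3, Matrix.mul_one] using h4
  obtain ⟨z, hz1, hz2⟩ := exists_eq_smul_one_of_forall_mul_eq_mul (K := G.2 * E.1.map star)
    (L := -(E.1 * G.2.map star)) (fun x => by
      have h5 := congrArg (fun y => G.2 * y * G.2.map star) (h1 x)
      simp only [Matrix.mul_add, Matrix.add_mul, Matrix.mul_zero, Matrix.zero_mul,
        Matrix.mul_assoc, GL_inv_mul_mul, hGs', Matrix.mul_one] at h5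
      rw [Matrix.mul_assoc, Matrix.mul_neg]
      exact eq_neg_of_add_eq_zero_left h5)
  have hE1 : E.1.map star = z • G.1 := by
    have := congrArg (fun y => G.1 * y) hz1
    simpa only [GL_mul_inv_mul, Matrix.mul_smul, Matrix.mul_one] using this
  have hE2 : -E.1 = z • G.1.map star := by
    have := congrArg (fun y => y * G.1.map star) hz2
    simpa only [Matrix.neg_mul, Matrix.mul_assoc, hGs, Matrix.smul_mul, Matrix.mul_one,
      Matrix.one_mul] using this
  have hz0 : z ≠ 0 := by
    rintro rfl
    rw [zero_smul, neg_eq_zero] at hE2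
    exact E.ne_zero hE2
  have hE3 : E.1 = star z • G.1.map star := by
    rw [← map_star_map_star E.1, hE1, map_star_smul]
  have hzs : star z = -z := by
    have h6 : (z + star z) • G.1.map star = 0 := by
      rw [add_smul, ← hE2, ← hE3, neg_add_cancel]
    have h7 : G.1.map star ≠ 0 := by
      intro h0
      rw [h0, Matrix.mul_zero] at hGs
      exact zero_ne_one hGs
    exact (neg_eq_of_add_eq_zero_right ((smul_eq_zero.1 h6).resolve_right h7)).symm
  have hre : z.re = 0 := by
    have := congrArg Complex.re hzs
    simp at this
    linarith
  have hzI : z = Complex.I * z.im := by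
    apply Complex.ext <;> simp [hre]
  have him : z.im ≠ 0 := by
    intro h0
    apply hz0
    rw [hzI, h0]; simp
  refine ⟨-(z.im)⁻¹, neg_ne_zero.2 (inv_ne_zero him), fun b => ?_⟩
  rw [h]
  congr 1
  have him' : (z.im : ℂ) ≠ 0 := by exact_mod_cast him
  have h8 : Complex.I * ((-(z.im)⁻¹ : ℝ) : ℂ) * z = 1 := by
    rw [hzI]
    push_cast
    simp
    field_simp
    linear_combination -Complex.I_mul_I
  rw [hE1, Matrix.mul_smul, smul_smul, h8, one_smul]

/-- Conjugation by Ad diag(1, rE⁻¹) removes E, and r = |t|^{-1/2} normalizes |t| to 1. The sign of t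
is retained and becomes -ε. -/
theorem psl_equivalent_tau (hn : 2 ≤ n)
    {σ : pslSpace n n →ₛₗ[starRingEnd ℂ] pslSpace n n}
    (hσ : (psl n n).IsAntilinearGradedConjugation σ) {E G : Matrix (Fin n) (Fin n) ℂ}
    (h : ∀ b, σ (pslUp b) = pslDown (E * b.map star * G)) :
    ∃ ε : ℤˣ, (psl n n).Equivalent σ (pslTau n ε) := by
  obtain ⟨hE, t, ht, h'⟩ := psl_conjugation_tau_form hn hσ h
  obtain ⟨E, rfl⟩ := hE
  let r : ℝ := (Real.sqrt |t|)⁻¹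
  have hs : Real.sqrt |t| * Real.sqrt |t| = |t| := Real.mul_self_sqrt (abs_nonneg _)
  have hs0 : Real.sqrt |t| ≠ 0 := by
    intro h0
    rw [h0] at hs
    exact abs_ne_zero.2 ht (by linarith)
  have hr0 : (r : ℂ) ≠ 0 := by exact_mod_cast inv_ne_zero hs0
  obtain ⟨ε, hε⟩ : ∃ ε : ℤˣ, t * (r * r) = -((ε : ℤ) : ℝ) := by
    rcases lt_or_gt_of_ne ht with h0 | h0
    · refine ⟨1, ?_⟩
      simp only [r]
      rw [← mul_inv, hs, abs_of_neg h0]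
      field_simp
      simp
    · refine ⟨-1, ?_⟩
      simp only [r]
      rw [← mul_inv, hs, abs_of_pos h0]
      field_simp
      simp
  let B : GL (Fin n) ℂ :=
    { val := (r : ℂ) • E.2
      inv := (r : ℂ)⁻¹ • E.1
      val_inv := by rw [smul_mul_smul_comm, mul_inv_cancel₀ hr0, E.4, one_smul]
      inv_val := by rw [smul_mul_smul_comm, inv_mul_cancel₀ hr0, E.3, one_smul] }
  refine ⟨ε, hσ.equivalent_of_eqOn (psl_tau_conjugation n ε)
    (psl_generated (by lia) (by lia)) (pslAdEquiv_isGradedAutomorphism 1 B) fun x hx => ?_⟩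
  obtain ⟨b, rfl⟩ : ∃ b, pslUp b = x := ⟨_, pslUp_pslUpper hx⟩
  show pslTau n ε (pslAd _ _ (pslUp b)) = pslAd _ _ (σ (pslUp b))
  rw [h', pslAd_pslUp, pslAd_pslDown, pslTau_pslUp]
  congr 1
  show -((ε : ℤ) * Complex.I : ℂ) • (1 * b * ((r : ℂ)⁻¹ • E.1)).map star =
    ((r : ℂ) • E.2) * ((Complex.I * t) • (E.1 * b.map star * E.1.map star)) * 1
  rw [Matrix.one_mul, Matrix.mul_one, Matrix.mul_smul, map_star_smul, map_star_mul,
    Matrix.mul_smul, Matrix.smul_mul, Matrix.mul_assoc, GL_inv_mul_mul, smul_smul, smul_smul]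
  congr 1
  have hε' : (t : ℂ) * (r * r) = -((ε : ℤ) : ℂ) := by exact_mod_cast hε
  rw [show star ((r : ℂ)⁻¹) = (r : ℂ)⁻¹ by simp, ← div_eq_mul_inv, div_eq_iff hr0]
  linear_combination -Complex.I * hε'

/-- The automorphism `b ↦ b`, `c ↦ t c` of the abelian Lie superalgebra `psl(1,1)`. -/
def pslLowerScale (t : ℂ) : pslSpace 1 1 →ₗ[ℂ] pslSpace 1 1 :=
  pslMap
    { toFun := fun X => fromBlocks X.toBlocks₁₁ X.toBlocks₁₂ (t • X.toBlocks₂₁) X.toBlocks₂₂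
      map_add' := fun X Y => by
        ext (i | i) (j | j) <;> simp [toBlocks₁₁, toBlocks₂₂, toBlocks₁₂, toBlocks₂₁, mul_add]
      map_smul' := fun z X => by
        ext (i | i) (j | j) <;>
        simp [toBlocks₁₁, toBlocks₂₂, toBlocks₁₂, toBlocks₂₁, mul_left_comm] }
    (fun X hX => by
      rw [← fromBlocks_toBlocks X] at hX
      exact fromBlocks_mem_slSpace.2 (fromBlocks_mem_slSpace.1 hX))
    ⟨1, by
      show fromBlocks (toBlocks₁₁ 1) (toBlocks₁₂ 1) (t • toBlocks₂₁ 1) (toBlocks₂₂ 1) = _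
      ext (i | i) (j | j) <;> simp [toBlocks₁₁, toBlocks₂₂, toBlocks₁₂, toBlocks₂₁]⟩

/-- In sl(1,1) every supercommutator is a scalar matrix, so it dies in the quotient. This is why
scaling 𝔤_{-1} alone is an automorphism. -/
theorem psl_one_one_bracket (x y : pslSpace 1 1) : (psl 1 1).bracket x y = 0 := by
  obtain ⟨X, hX, rfl⟩ := exists_pslMk x
  obtain ⟨Y, hY, rfl⟩ := exists_pslMk y
  rw [bracket_pslMk, pslMk_eq_zero]
  rw [← fromBlocks_toBlocks X] at hX ⊢
  rw [← fromBlocks_toBlocks Y] at hY ⊢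
  generalize X.toBlocks₁₁ = a, X.toBlocks₁₂ = b, X.toBlocks₂₁ = c, X.toBlocks₂₂ = d at hX ⊢
  generalize Y.toBlocks₁₁ = a', Y.toBlocks₁₂ = b', Y.toBlocks₂₁ = c', Y.toBlocks₂₂ = d' at hY ⊢
  have h1 := fromBlocks_mem_slSpace.1 hX
  have h2 := fromBlocks_mem_slSpace.1 hY
  simp only [trace_fin_one] at h1 h2
  refine ⟨b 0 0 * c' 0 0 + b' 0 0 * c 0 0, ?_⟩
  rw [superBracket_fromBlocks, ← fromBlocks_one, fromBlocks_smul]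
  congr 1 <;> ext i j <;> fin_cases i <;> fin_cases j <;>
  simp [Matrix.mul_apply, h1, h2] <;> ring

/-- On the one-dimensional 𝔤_1 the conjugation is b ↦ z b̄ with z = DC; scaling 𝔤_{-1} by -z⁻¹ turns
it into b ↦ -b̄, which is σ̃₁. -/
theorem psl_one_one_equivalent {σ : pslSpace 1 1 →ₛₗ[starRingEnd ℂ] pslSpace 1 1}
    (hσ : (psl 1 1).IsAntilinearGradedConjugation σ) {D C : GL (Fin 1) ℂ}
    (h : ∀ b, σ (pslUp b) = pslDown (D.1 * bᴴ * C.1)) :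
    (psl 1 1).Equivalent σ ((pslAd (signMatrix 1 1) (signMatrix 1 1)).comp (pslSigma 1 1)) := by
  have hone : ∀ g : GL (Fin 1) ℂ, g.1 0 0 ≠ 0 := by
    intro g h0
    have := congrFun (congrFun g.3 0) 0
    simp [Matrix.mul_apply, h0] at this
  have hz : D.1 0 0 * C.1 0 0 ≠ 0 := mul_ne_zero (hone D) (hone C)
  set z := D.1 0 0 * C.1 0 0 with hzdef
  have hcomp : ∀ s t : ℂ, s * t = 1 → (pslLowerScale s).comp (pslLowerScale t) = LinearMap.id := by
    intro s t hst
    refine LinearMap.ext fun x => ?_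
    obtain ⟨X, hX, rfl⟩ := exists_pslMk x
    refine pslMk_congr ?_ _
    show fromBlocks X.toBlocks₁₁ X.toBlocks₁₂ (s • t • X.toBlocks₂₁) X.toBlocks₂₂ = X
    rw [smul_smul, hst, one_smul, fromBlocks_toBlocks]
  let φ : pslSpace 1 1 ≃ₗ[ℂ] pslSpace 1 1 := LinearEquiv.ofLinearMap (pslLowerScale (-z⁻¹))
    (pslLowerScale (-z)) (hcomp _ _ (by field_simp)) (hcomp _ _ (by field_simp))
  have hw : ∀ {M : Type} [AddCommGroup M] (w : Fin 1 ⊕ Fin 1 → M) (a : M) (s : ℂ),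
      ∀ X ∈ weightSpace w a,
      fromBlocks X.toBlocks₁₁ X.toBlocks₁₂ (s • X.toBlocks₂₁) X.toBlocks₂₂ ∈ weightSpace w a := by
    intro M _ w a s X hX
    rintro (i | i) (j | j) hij
    · exact hX _ _ hij
    · exact hX _ _ hij
    · exact hX _ _ (right_ne_zero_of_mul (show s * X (Sum.inr i) (Sum.inl j) ≠ 0 from hij))
    · exact hX _ _ hij
  have hφ : (psl 1 1).IsGradedAutomorphism φ :=
    psl_gradedAutomorphism_of_matrix φ _ _ (fun X hX => ⟨_, rfl⟩) (fun X hX => ⟨_, rfl⟩)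
      (fun x y => by rw [psl_one_one_bracket, psl_one_one_bracket, map_zero])
      (fun i X hX => hw _ _ _ X hX) (fun i X hX => hw _ _ _ X hX)
      (fun i X hX => hw _ _ _ X hX) (fun i X hX => hw _ _ _ X hX)
  refine hσ.equivalent_of_eqOn (psl_sign_conjugation 1 1 1 1)
    (psl_generated le_rfl le_rfl) hφ fun x hx => ?_
  obtain ⟨b, rfl⟩ : ∃ b, pslUp b = x := ⟨_, pslUp_pslUpper hx⟩
  have h1 : φ (pslUp b) = pslUp b := by
    refine pslMk_congr ?_ _
    show fromBlocks 0 b ((-z⁻¹) • 0) 0 = _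
    rw [smul_zero]
  have h2 : ∀ c, φ (pslDown c) = pslDown ((-z⁻¹) • c) := fun c => rfl
  rw [h1, h, h2, LinearMap.comp_apply, pslSigma_pslUp, pslAd_pslDown]
  congr 1
  ext i j
  fin_cases i
  fin_cases j
  have hD0 := hone D
  have hC0 := hone C
  simp [signMatrix, Matrix.mul_apply]
  rw [hzdef]
  field_simp

/-- The conjugations `Ad diag(S_p, S_q) σ̃₁` are a complete list for `psl(m,n)`, `m ≠ n`. -/
theorem psl_isCompleteList (hm : 1 ≤ m) (hn : 1 ≤ n) (hmn : m ≠ n) :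
    (psl m n).IsCompleteListOfConjugations {σ | ∃ p ≤ m, ∃ q ≤ n,
      σ = (pslAd (signMatrix m p) (signMatrix n q)).comp (pslSigma m n)} := by
  refine ⟨?_, fun σ hσ => ?_⟩
  · rintro _ ⟨p, -, q, -, rfl⟩
    exact psl_sign_conjugation m n p q
  rcases psl_conjugation_form hm hn hσ with ⟨D, C, h⟩ | ⟨⟨-, h⟩, -⟩
  · obtain ⟨D', C', hD, hC, h'⟩ := psl_conjugation_hermitian hm hn (by lia) hσ h
    obtain ⟨p, hp, q, hq, he⟩ := psl_equivalent_sign hm hn hσ hD hC h'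
    exact ⟨_, ⟨p, hp, q, hq, rfl⟩, he⟩
  · exact absurd h hmn

/-- The conjugations `Ad diag(S_p, S_q) σ̃₁` and `τ_±` are a complete list for `psl(n,n)`. -/
theorem psl_self_isCompleteList (hn : 1 ≤ n) :
    (psl n n).IsCompleteListOfConjugations
      ({σ | ∃ p ≤ n, ∃ q ≤ n,
          σ = (pslAd (signMatrix n p) (signMatrix n q)).comp (pslSigma n n)} ∪
        {pslTau n 1, pslTau n (-1)}) := by
  refine ⟨?_, fun σ hσ => ?_⟩
  · rintro _ (⟨p, -, q, -, rfl⟩ | rfl | rfl)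
    · exact psl_sign_conjugation n n p q
    · exact psl_tau_conjugation n 1
    · exact psl_tau_conjugation n (-1)
  rcases psl_conjugation_form hn hn hσ with ⟨D, C, h⟩ | ⟨⟨hn', -⟩, E, G, h⟩
  -- For n = 1 all conjugations form one class, so the other listed maps are redundant.
  · rcases Nat.eq_or_lt_of_le hn with rfl | hn'
    · exact ⟨_, Or.inl ⟨1, le_rfl, 1, le_rfl, rfl⟩, psl_one_one_equivalent hσ h⟩
    · obtain ⟨D', C', hD, hC, h'⟩ := psl_conjugation_hermitian hn hn (Or.inl hn') hσ h
      obtain ⟨p, hp, q, hq, he⟩ := psl_equivalent_sign hn hn hσ hD hC h'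
      exact ⟨_, Or.inl ⟨p, hp, q, hq, rfl⟩, he⟩
  · obtain ⟨ε, hε⟩ := psl_equivalent_tau hn' hσ h
    rcases Int.units_eq_one_or ε with rfl | rfl
    · exact ⟨_, Or.inr (Or.inl rfl), hε⟩
    · exact ⟨_, Or.inr (Or.inr rfl), hε⟩

end psl

end

/-! ### Anti-linear maps on a symplectic space and adapted Darboux systems. -/

section symplectic

variable {V : Type*} [AddCommGroup V] [Module ℂ V]

/-- An anti-linear bijection compatible with the triple product of `osp(2,2n)` squares to a real
scalar `μ` and satisfies `ω(jx, jy) = -μ conj ω(x, y)`. -/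
theorem exists_sq_eq_smul_of_triple [FiniteDimensional ℂ V] {ω : V →ₗ[ℂ] V →ₗ[ℂ] ℂ}
    (hω : ∀ x y, ω x y = -ω y x) {j : V →ₛₗ[starRingEnd ℂ] V} (hj : Function.Bijective j)
    (hne : ∃ x y, ω x y ≠ 0)
    (h : ∀ x d y, star (ω x (j d)) • j y - star (ω y x) • j (j d) - star (ω y (j d)) • j x =
      ω d (j x) • j y + ω (j y) d • j x + ω (j y) (j x) • d) :
    ∃ μ : ℝ, μ ≠ 0 ∧ (∀ x, j (j x) = (μ : ℂ) • x) ∧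
      ∀ x y, ω (j x) (j y) = -μ * star (ω x y) := by
  let e : V ≃ₛₗ[starRingEnd ℂ] V := LinearEquiv.ofBijective j hj
  have hje : ∀ z, j (e.symm z) = z := fun z => e.apply_symm_apply z
  have hej : ∀ z, e.symm (j z) = z := fun z => e.symm_apply_apply z
  obtain ⟨x₀, y₀, hxy⟩ := hne
  have hnt : Nontrivial V := ⟨x₀, 0, by rintro rfl; simp at hxy⟩
  let A : V → V →ₗ[ℂ] ℂ := fun x =>
    { toFun := fun z => star (ω (e.symm z) x)
      map_add' := fun z w => by simp
      map_smul' := fun c z => by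
        have hc : e.symm (c • z) = star c • e.symm z := hj.1 (by
          rw [hje, map_smulₛₗ, hje]; simp)
        simp [hc] }
  have hA : ∀ x z, A x z = star (ω (e.symm z) x) := fun _ _ => rfl
  have hf : ∀ x d, star (ω x (j d)) = ω d (j x) := by
    intro x d
    -- The identity is read as an equality of linear operators in z = jy and its trace is taken. The
    -- three rank one operators have total trace zero, leaving the scalar times dim V equal to 0.
    have h1 : (star (ω x (j d)) - ω d (j x)) • (LinearMap.id : V →ₗ[ℂ] V) =
        (A (j d) - ω d).smulRight (j x) + (A x).smulRight (j (j d)) +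
          (ω.flip (j x)).smulRight d := by
      ext z
      have h2 := h x d (e.symm z)
      rw [hje, hω z d] at h2
      simp only [LinearMap.smul_apply, LinearMap.id_apply, LinearMap.add_apply,
        LinearMap.smulRight_apply, LinearMap.sub_apply, hA, LinearMap.flip_apply, sub_smul]
      rw [neg_smul] at h2
      rw [sub_eq_iff_eq_add] at h2 ⊢
      rw [sub_eq_iff_eq_add] at h2
      rw [h2]
      abel
    have h3 := congrArg (LinearMap.trace ℂ V) h1
    simp only [map_add, map_smul, LinearMap.trace_smulRight, LinearMap.trace_id,
      LinearMap.sub_apply, hA, hej, LinearMap.flip_apply, smul_eq_mul] at h3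
    rw [hω (j d) x, star_neg] at h3
    have h4 : (star (ω x (j d)) - ω d (j x)) * (Module.finrank ℂ V : ℂ) = 0 := by
      linear_combination h3
    have h5 : (Module.finrank ℂ V : ℂ) ≠ 0 := by
      exact_mod_cast (Module.finrank_pos (R := ℂ) (M := V)).ne'
    exact sub_eq_zero.1 ((mul_eq_zero.1 h4).resolve_right h5)
  -- Once `hf` cancels the terms in jx and jy, what remains is a relation between j(jd) and d. One
  -- pair with ω(x₀, y₀) ≠ 0 then shows that j² is a scalar.
  have hg : ∀ x d y, star (ω y x) • j (j d) = -(ω (j y) (j x) • d) := by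
    intro x d y
    have h2 := h x d y
    rw [hf x d, hf y d, hω (j y) d, neg_smul, sub_right_comm, sub_eq_iff_eq_add] at h2
    rw [eq_neg_iff_add_eq_zero, ← sub_eq_zero.2 h2.symm]
    abel
  set t := star (ω x₀ y₀) with ht
  have ht0 : t ≠ 0 := star_ne_zero.2 hxy
  let μ : ℂ := -(t⁻¹ * ω (j x₀) (j y₀))
  have hμ : ∀ d, j (j d) = μ • d := by
    intro d
    have h2 := hg y₀ d x₀
    have h3 := congrArg (fun v => t⁻¹ • v) h2
    simp only [smul_smul, smul_neg, ← ht, inv_mul_cancel₀ ht0, one_smul] at h3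
    rw [h3, neg_smul]
  have hx₀ : x₀ ≠ 0 := by rintro rfl; simp at hxy
  have hj0 : ∀ x, x ≠ 0 → j x ≠ 0 := by
    intro x hx h0
    exact hx (hj.1 (by rw [h0, map_zero]))
  -- The map j commutes with j² = μ but is anti-linear, so μ is real.
  have hstar : star μ = μ := by
    have h2 : star μ • j x₀ = μ • j x₀ := by
      rw [← hμ (j x₀), hμ x₀, map_smulₛₗ]; rfl
    exact smul_left_injective ℂ (hj0 x₀ hx₀) h2
  have hre : ((μ.re : ℝ) : ℂ) = μ := Complex.conj_eq_iff_re.1 hstar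
  refine ⟨μ.re, ?_, fun x => by rw [hre, hμ], fun x y => ?_⟩
  · intro h0
    have h2 := hμ x₀
    rw [← hre, h0, Complex.ofReal_zero, zero_smul] at h2
    exact hj0 _ (hj0 _ hx₀) h2
  · have h2 := hg y x₀ x
    rw [hμ, smul_smul, ← neg_smul] at h2
    have h3 : star (ω x y) * μ = -ω (j x) (j y) := smul_left_injective ℂ hx₀ h2
    rw [hre]
    linear_combination h3

/-- Extension step for the construction of an adapted Darboux basis. -/
theorem exists_orthogonal_ne_zero [FiniteDimensional ℂ V] {ω : V →ₗ[ℂ] V →ₗ[ℂ] ℂ}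
    (hω : ∀ x y, ω x y = -ω y x) (hnd : ∀ x, (∀ y, ω x y = 0) → x = 0)
    {j : V →ₛₗ[starRingEnd ℂ] V} {ε : ℂ} (hε : ε * ε = 1)
    (hjj : ∀ x, j (j x) = ε • x) (hωj : ∀ x y, ω (j x) (j y) = -ε * star (ω x y))
    {k : ℕ} (hk : 2 * k < Module.finrank ℂ V) {x : Fin k → V} {s : Fin k → ℂ}
    (hs : ∀ a, s a * s a = 1) (h0 : ∀ a b, ω (x a) (x b) = 0)
    (h1 : ∀ a b, ω (j (x a)) (x b) = if a = b then s a else 0) :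
    ∃ w, (∀ a, ω (x a) w = 0 ∧ ω (j (x a)) w = 0) ∧ ω (j w) w ≠ 0 := by
  by_contra! hc
  have hε0 : ε ≠ 0 := left_ne_zero_of_mul_eq_one hε
  let W : Submodule ℂ V :=
    { carrier := {w | ∀ a, ω (x a) w = 0 ∧ ω (j (x a)) w = 0}
      zero_mem' := fun a => by simp
      add_mem' := fun {u v} hu hv a => by
        simp [(hu a).1, (hu a).2, (hv a).1, (hv a).2]
      smul_mem' := fun c u hu a => by simp [(hu a).1, (hu a).2] }
  have hW : ∀ w ∈ W, ω (j w) w = 0 := hc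
  -- Polarization of the sesquilinear form ω(ju, v), using u + v and u + iv.
  have hpol : ∀ u ∈ W, ∀ v ∈ W, ω (j u) v = 0 := by
    intro u hu v hv
    have e1 := hW _ (add_mem hu hv)
    have e2 := hW _ (add_mem hu (W.smul_mem Complex.I hv))
    simp only [map_add, LinearMap.add_apply, map_smulₛₗ, LinearMap.smul_apply, RingHom.id_apply,
      hW u hu, hW v hv, smul_eq_mul, Complex.conj_I] at e1 e2
    linear_combination (1 / 2) * e1 - (1 / 2) * Complex.I * e2 +
      (1 / 2) * (ω (j u) v - ω (j v) u) * Complex.I_mul_I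
  -- The vector c v is the component of v in the span of the x a and j(x a), so v - c v lies in the
  -- orthogonal complement W.
  let c : V → V := fun v => ∑ a, (s a * ω (j (x a)) v) • x a - ∑ a, (s a * ω (x a) v) • j (x a)
  have h2 : ∀ a b, ω (j (x a)) (j (x b)) = 0 := fun a b => by rw [hωj, h0]; simp
  have h3 : ∀ a b, ω (x a) (j (x b)) = if a = b then -s a else 0 := by
    intro a b
    rw [hω, h1]
    by_cases hab : a = b
    · simp [hab]
    · simp [hab, Ne.symm hab]
  have hp : ∀ v, v - c v ∈ W := by
    intro v a
    simp only [c, map_sub, map_sum, map_smul, h0, h1, h2, h3, smul_eq_mul, mul_zero,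
      Finset.sum_const_zero, mul_ite, Finset.sum_ite_eq, Finset.mem_univ, if_true]
    constructor
    · linear_combination -(ω (x a) v) * hs a
    · linear_combination -(ω (j (x a)) v) * hs a
  -- For w in W, the vector jw is orthogonal to the x a, to the j(x a), and by `hpol` to W, hence
  -- zero by nondegeneracy. Then W = 0, and 2k vectors span V, contradicting the dimension.
  have hW0 : ∀ w ∈ W, w = 0 := by
    intro w hw
    have h4 : ∀ a, ω (j w) (x a) = 0 := by
      intro a
      have h5 := hωj (j w) (x a)
      rw [hjj, map_smul, LinearMap.smul_apply, hω, (hw a).2] at h5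
      have h6 : star (ω (j w) (x a)) = 0 := by
        have : -ε * star (ω (j w) (x a)) = 0 := by rw [← h5]; simp
        exact (mul_eq_zero.1 this).resolve_left (neg_ne_zero.2 hε0)
      exact star_eq_zero.1 h6
    have h5 : ∀ a, ω (j w) (j (x a)) = 0 := by
      intro a
      rw [hωj, hω, (hw a).1]; simp
    have h6 : j w = 0 := by
      refine hnd _ fun v => ?_
      have h7 := hpol w hw _ (hp v)
      simpa [c, h4, h5] using h7
    have h7 := hjj w
    rw [h6, map_zero] at h7
    exact (smul_eq_zero.1 h7.symm).resolve_left hε0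
  have hspan : Submodule.span ℂ (Set.range (Sum.elim x fun a => j (x a))) = ⊤ := by
    rw [eq_top_iff]
    intro v _
    rw [sub_eq_zero.1 (hW0 _ (hp v))]
    refine sub_mem (Submodule.sum_mem _ fun a _ => Submodule.smul_mem _ _ ?_)
      (Submodule.sum_mem _ fun a _ => Submodule.smul_mem _ _ ?_)
    · exact Submodule.subset_span ⟨Sum.inl a, rfl⟩
    · exact Submodule.subset_span ⟨Sum.inr a, rfl⟩
  have hcard := finrank_range_le_card (R := ℂ) (Sum.elim x fun a => j (x a))
  rw [Set.finrank, hspan, finrank_top, Fintype.card_sum, Fintype.card_fin] at hcard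
  lia

/-- An adapted Darboux system: `ω(x_a, x_b) = 0` and `ω(j x_a, x_b) = ± δ_{ab}`; all signs can be
taken to be `+` if `j² = 1`. -/
theorem exists_adapted_system [FiniteDimensional ℂ V] {ω : V →ₗ[ℂ] V →ₗ[ℂ] ℂ}
    (hω : ∀ x y, ω x y = -ω y x) (hnd : ∀ x, (∀ y, ω x y = 0) → x = 0)
    {j : V →ₛₗ[starRingEnd ℂ] V} {ε : ℂ} (hε : ε = 1 ∨ ε = -1)
    (hjj : ∀ x, j (j x) = ε • x) (hωj : ∀ x y, ω (j x) (j y) = -ε * star (ω x y))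
    (k : ℕ) (hk : 2 * k ≤ Module.finrank ℂ V) :
    ∃ (x : Fin k → V) (s : Fin k → ℂ), (∀ a, s a = 1 ∨ s a = -1) ∧ (ε = 1 → ∀ a, s a = 1) ∧
      (∀ a b, ω (x a) (x b) = 0) ∧ ∀ a b, ω (j (x a)) (x b) = if a = b then s a else 0 := by
  have hε1 : ε * ε = 1 := by rcases hε with rfl | rfl <;> simp
  have hself : ∀ x, ω x x = 0 := fun x => self_eq_neg.1 (hω x x)
  induction k with
  | zero => exact ⟨Fin.elim0, Fin.elim0, fun a => a.elim0, fun _ a => a.elim0,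
      fun a => a.elim0, fun a => a.elim0⟩
  | succ k ih =>
    obtain ⟨x, s, hs, hs1, h0, h1⟩ := ih (by lia)
    obtain ⟨w, hw, hww⟩ := exists_orthogonal_ne_zero hω hnd hε1 hjj hωj (by lia)
      (fun a => by rcases hs a with h | h <;> simp [h]) h0 h1
    have hnorm : ∃ w' t, (t = 1 ∨ t = -1) ∧ (ε = 1 → t = 1) ∧
        (∀ a, ω (x a) w' = 0 ∧ ω (j (x a)) w' = 0) ∧ ω (j w') w' = t := by
      -- The form ω(ju, v) is Hermitian, so its diagonal values are real and w can be rescaled to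
      -- value ±1.
      have hreal : star (ω (j w) w) = ω (j w) w := by
        have h2 := hωj (j w) w
        rw [hjj, map_smul, LinearMap.smul_apply, smul_eq_mul, hω w] at h2
        linear_combination ε * h2 - (star (ω (j w) w) - ω (j w) w) * hε1
      have hre : (((ω (j w) w).re : ℝ) : ℂ) = ω (j w) w := Complex.conj_eq_iff_re.1 hreal
      set r := (ω (j w) w).re with hr
      have hr0 : r ≠ 0 := by
        intro h2
        rw [h2] at hre
        exact hww (by rw [← hre]; simp)
      have hsq : Real.sqrt |r| * Real.sqrt |r| = |r| := Real.mul_self_sqrt (abs_nonneg _)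
      let c : ℝ := (Real.sqrt |r|)⁻¹
      have hc : ω (j ((c : ℂ) • w)) ((c : ℂ) • w) = ((c * c * r : ℝ) : ℂ) := by
        simp only [map_smulₛₗ, LinearMap.smul_apply, RingHom.id_apply, Complex.conj_ofReal,
          smul_eq_mul, ← hre]
        push_cast
        ring
      have hcc : c * c * r = 1 ∨ c * c * r = -1 := by
        have : c * c = |r|⁻¹ := by rw [← hsq, mul_inv]
        rw [this]
        rcases lt_or_gt_of_ne hr0 with h2 | h2
        · right
          rw [abs_of_neg h2, inv_neg, neg_mul, inv_mul_cancel₀ hr0]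
        · left
          rw [abs_of_pos h2, inv_mul_cancel₀ hr0]
      have horth : ∀ a, ω (x a) ((c : ℂ) • w) = 0 ∧ ω (j (x a)) ((c : ℂ) • w) = 0 := fun a => by
        simp [(hw a).1, (hw a).2]
      rcases hcc with hcc | hcc
      · exact ⟨_, 1, Or.inl rfl, fun _ => rfl, horth, by rw [hc, hcc]; simp⟩
      · rw [hcc] at hc
        generalize (c : ℂ) • w = w₁ at hc horth
        -- If ε = 1, replacing a negative vector w₁ by j w₁ reverses the sign: ω(jjw₁, jw₁) =
        -- -ω(jw₁, w₁). If ε = -1 the sign -1 is kept.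
        rcases hε with rfl | rfl
        · refine ⟨j w₁, 1, Or.inl rfl, fun _ => rfl, fun a => ⟨?_, ?_⟩, ?_⟩
          · have h2 := hωj (x a) (j w₁)
            rw [hjj, one_smul, (horth a).2] at h2
            have h3 : star (ω (x a) (j w₁)) = 0 := by linear_combination h2
            exact star_eq_zero.1 h3
          · rw [hωj, (horth a).1]; simp
          · rw [hjj, one_smul, hω, hc]; simp
        · exact ⟨w₁, -1, Or.inr rfl, fun h => h, horth, by rw [hc]; simp⟩
    obtain ⟨w', t, ht, ht1, hw', hww'⟩ := hnorm
    have hw_star : ∀ b, ω (j w') (x b) = 0 := by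
      intro b
      have h2 := hωj (j w') (x b)
      rw [hjj, map_smul, LinearMap.smul_apply, hω, (hw' b).2, neg_zero, smul_zero] at h2
      have h3 : star (ω (j w') (x b)) = 0 := by
        linear_combination ε * h2 - star (ω (j w') (x b)) * hε1
      exact star_eq_zero.1 h3
    refine ⟨Fin.cons w' x, Fin.cons t s, ?_, ?_, ?_, ?_⟩
    · rw [Fin.forall_fin_succ]
      exact ⟨ht, hs⟩
    · intro h
      rw [Fin.forall_fin_succ]
      exact ⟨ht1 h, hs1 h⟩
    · intro a b
      refine Fin.cases ?_ (fun a => ?_) a <;> refine Fin.cases ?_ (fun b => ?_) b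
      · simp [hself]
      · simp [hω w', (hw' b).1]
      · simp [(hw' a).1]
      · simp [h0]
    · intro a b
      refine Fin.cases ?_ (fun a => ?_) a <;> refine Fin.cases ?_ (fun b => ?_) b
      · simp [hww']
      · simp [hw_star, (Fin.succ_ne_zero b).symm]
      · simp [(hw' a).2]
      · simp [h1]

end symplectic

/-! ### Structure of osp(2,2n): 𝔤_{±1} as symplectic spaces, triple products, generation. -/

section

open Matrix GradedLieSuperalgebra

section ospStructure

variable {n : ℕ}

/-- The standard symplectic form on `ℂ^{2n}`. -/
def sympForm (n : ℕ) : (Fin n ⊕ Fin n → ℂ) →ₗ[ℂ] (Fin n ⊕ Fin n → ℂ) →ₗ[ℂ] ℂ :=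
  LinearMap.mk₂ ℂ (fun x y => x ⬝ᵥ (sympJ n *ᵥ y))
    (fun x y z => add_dotProduct _ _ _) (fun c x y => smul_dotProduct _ _ _)
    (fun x y z => by rw [mulVec_add, dotProduct_add])
    (fun c x y => by rw [mulVec_smul, dotProduct_smul])

theorem sympForm_apply (x y : Fin n ⊕ Fin n → ℂ) : sympForm n x y = x ⬝ᵥ (sympJ n *ᵥ y) := rfl

theorem sympForm_skew (x y : Fin n ⊕ Fin n → ℂ) : sympForm n x y = -sympForm n y x := by
  rw [sympForm_apply, sympForm_apply, dotProduct_mulVec, ← mulVec_transpose, sympJ_transpose,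
    neg_mulVec, neg_dotProduct, dotProduct_comm]

theorem sympJ_mulVec_mulVec (x : Fin n ⊕ Fin n → ℂ) : sympJ n *ᵥ (sympJ n *ᵥ x) = -x := by
  rw [mulVec_mulVec, sympJ_mul_self, neg_mulVec, one_mulVec]

theorem sympForm_nondegenerate (x : Fin n ⊕ Fin n → ℂ) (h : ∀ y, sympForm n x y = 0) : x = 0 := by
  refine dotProduct_eq_zero _ fun y => ?_
  have := h (-(sympJ n *ᵥ y))
  rwa [sympForm_apply, mulVec_neg, sympJ_mulVec_mulVec, neg_neg] at this

theorem osp_ext {x y : ospSpace n} (h₁ : x.1.toBlocks₁₁ = y.1.toBlocks₁₁)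
    (h₂ : x.1.toBlocks₁₂ = y.1.toBlocks₁₂) (h₃ : x.1.toBlocks₂₂ = y.1.toBlocks₂₂) : x = y := by
  have hx := x.2
  have hy := y.2
  rw [← fromBlocks_toBlocks x.1] at hx
  rw [← fromBlocks_toBlocks y.1] at hy
  refine Subtype.ext ?_
  rw [← fromBlocks_toBlocks x.1, ← fromBlocks_toBlocks y.1, (fromBlocks_mem_ospSpace.1 hx).2.2,
    (fromBlocks_mem_ospSpace.1 hy).2.2, h₁, h₂, h₃]

theorem sympJ_mul_transpose_mul_symQ (β γ : Fin n ⊕ Fin n → ℂ) :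
    sympJ n * (of ![β, γ])ᵀ * symQ = (of ![sympJ n *ᵥ γ, sympJ n *ᵥ β])ᵀ := by
  have h : sympJ n * (of ![β, γ])ᵀ = (of ![sympJ n *ᵥ β, sympJ n *ᵥ γ])ᵀ := by
    ext i j
    fin_cases j <;> rfl
  rw [h]
  ext i j
  fin_cases j <;> simp [Matrix.mul_apply, symQ]

/-- The element of `𝔤_1` with first row `β`. -/
def ospUp (n : ℕ) : (Fin n ⊕ Fin n → ℂ) →ₗ[ℂ] ospSpace n where
  toFun β := ⟨fromBlocks 0 (of ![β, 0]) (of ![0, sympJ n *ᵥ β])ᵀ 0,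
    fromBlocks_mem_ospSpace.2 ⟨by simp, by simp, by simp [sympJ_mul_transpose_mul_symQ]⟩⟩
  map_add' x y := osp_ext (by simp [fromBlocks_add])
    (by ext i j; fin_cases i <;> simp [fromBlocks_add])
    (by simp [fromBlocks_add])
  map_smul' c x := osp_ext (by simp [fromBlocks_smul])
    (by ext i j; fin_cases i <;> simp [fromBlocks_smul])
    (by simp [fromBlocks_smul])

/-- The element of `𝔤_{-1}` with second row `γ`. -/
def ospDown (n : ℕ) : (Fin n ⊕ Fin n → ℂ) →ₗ[ℂ] ospSpace n where
  toFun γ := ⟨fromBlocks 0 (of ![0, γ]) (of ![sympJ n *ᵥ γ, 0])ᵀ 0,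
    fromBlocks_mem_ospSpace.2 ⟨by simp, by simp, by simp [sympJ_mul_transpose_mul_symQ]⟩⟩
  map_add' x y := osp_ext (by simp [fromBlocks_add])
    (by ext i j; fin_cases i <;> simp [fromBlocks_add])
    (by simp [fromBlocks_add])
  map_smul' c x := osp_ext (by simp [fromBlocks_smul])
    (by ext i j; fin_cases i <;> simp [fromBlocks_smul])
    (by simp [fromBlocks_smul])

/-- The second row of the upper right block. -/
def ospLower (n : ℕ) : ospSpace n →ₗ[ℂ] (Fin n ⊕ Fin n → ℂ) where
  toFun x := x.1.toBlocks₁₂ 1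
  map_add' _ _ := rfl
  map_smul' _ _ := rfl

theorem ospUp_val (β : Fin n ⊕ Fin n → ℂ) :
    (ospUp n β).1 = fromBlocks 0 (of ![β, 0]) (of ![0, sympJ n *ᵥ β])ᵀ 0 := rfl

theorem ospDown_val (γ : Fin n ⊕ Fin n → ℂ) :
    (ospDown n γ).1 = fromBlocks 0 (of ![0, γ]) (of ![sympJ n *ᵥ γ, 0])ᵀ 0 := rfl

theorem ospLower_ospDown (γ : Fin n ⊕ Fin n → ℂ) : ospLower n (ospDown n γ) = γ := rfl

theorem ospDown_injective : Function.Injective (ospDown n) := fun x y h => by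
  rw [← ospLower_ospDown x, h, ospLower_ospDown]

theorem ospUp_injective : Function.Injective (ospUp n) := fun _ _ h =>
  congrArg (fun z : ospSpace n => z.1.toBlocks₁₂ 0) h

theorem ospUp_mem_deg (β : Fin n ⊕ Fin n → ℂ) : ospUp n β ∈ (osp n).deg 1 := by
  show (ospUp n β).1 ∈ weightSpace (ospWeight n) 1
  rw [ospUp_val]
  rintro (i | i) (j | j) h
  · simp at h
  · fin_cases i <;> simp [ospWeight] at h ⊢
  · fin_cases j <;> simp [ospWeight] at h ⊢
  · simp at h

theorem ospDown_mem_deg (γ : Fin n ⊕ Fin n → ℂ) : ospDown n γ ∈ (osp n).deg (-1) := by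
  show (ospDown n γ).1 ∈ weightSpace (ospWeight n) (-1)
  rw [ospDown_val]
  rintro (i | i) (j | j) h
  · simp at h
  · fin_cases i <;> simp [ospWeight] at h ⊢
  · fin_cases j <;> simp [ospWeight] at h ⊢
  · simp at h

theorem exists_ospUp {x : ospSpace n} (hx : x ∈ (osp n).deg 1) : ∃ β, ospUp n β = x := by
  have hx' : ∀ i j, x.1 i j ≠ 0 → ospWeight n i - ospWeight n j = 1 := hx
  refine ⟨x.1.toBlocks₁₂ 0, osp_ext ?_ ?_ ?_⟩
  · ext i j
    by_contra h
    have := hx' (Sum.inl i) (Sum.inl j) (Ne.symm h)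
    revert this
    fin_cases i <;> fin_cases j <;> simp [ospWeight]
  · ext i j
    fin_cases i
    · rfl
    · by_contra h
      have := hx' (Sum.inl 1) (Sum.inr j) (Ne.symm h)
      revert this
      simp [ospWeight]
  · ext i j
    by_contra h
    have := hx' (Sum.inr i) (Sum.inr j) (Ne.symm h)
    revert this
    simp [ospWeight]

theorem exists_ospDown {x : ospSpace n} (hx : x ∈ (osp n).deg (-1)) : ∃ γ, ospDown n γ = x := by
  have hx' : ∀ i j, x.1 i j ≠ 0 → ospWeight n i - ospWeight n j = -1 := hx
  refine ⟨x.1.toBlocks₁₂ 1, osp_ext ?_ ?_ ?_⟩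
  · ext i j
    by_contra h
    have := hx' (Sum.inl i) (Sum.inl j) (Ne.symm h)
    revert this
    fin_cases i <;> fin_cases j <;> simp [ospWeight]
  · ext i j
    fin_cases i
    · by_contra h
      have := hx' (Sum.inl 0) (Sum.inr j) (Ne.symm h)
      revert this
      simp [ospWeight]
    · rfl
  · ext i j
    by_contra h
    have := hx' (Sum.inr i) (Sum.inr j) (Ne.symm h)
    revert this
    simp [ospWeight]

theorem osp_bracket_val (x y : ospSpace n) :
    ((osp n).bracket x y).1 = superBracket x.1 y.1 := rfl

theorem ospUp_ospDown_val (β γ : Fin n ⊕ Fin n → ℂ) :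
    ((osp n).bracket (ospUp n β) (ospDown n γ)).1 =
      fromBlocks !![sympForm n β γ, 0; 0, -sympForm n β γ] 0 0
        (vecMulVec (sympJ n *ᵥ β) γ + vecMulVec (sympJ n *ᵥ γ) β) := by
  rw [osp_bracket_val, ospUp_val, ospDown_val, superBracket_fromBlocks]
  congr 1
  · rw [← sympForm_skew]
    ext i j
    fin_cases i <;> fin_cases j <;>
      simp [vecMul, sympForm_apply, dotProduct]
  · simp
  · simp
  · ext i j
    simp [Matrix.mul_apply, Fin.sum_univ_two, vecMulVec_apply]

theorem osp_bracket_down_up (β γ : Fin n ⊕ Fin n → ℂ) :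
    (osp n).bracket (ospDown n γ) (ospUp n β) = (osp n).bracket (ospUp n β) (ospDown n γ) := by
  have h := (osp n).bracket_skew 1 1 (ospDown n γ) (ospUp n β)
    (by simpa using (osp n).deg_le_part _ (ospDown_mem_deg γ))
    (by simpa using (osp n).deg_le_part _ (ospUp_mem_deg β))
  simpa [ZMod.val_one] using h

theorem vecMul_vecMulVec_sympJ (β γ δ : Fin n ⊕ Fin n → ℂ) :
    δ ᵥ* (vecMulVec (sympJ n *ᵥ β) γ + vecMulVec (sympJ n *ᵥ γ) β) =
      sympForm n δ β • γ + sympForm n δ γ • β := by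
  rw [vecMul_add, vecMul_vecMulVec, vecMul_vecMulVec]
  rfl

/-- The so(2) part of the inner bracket contributes the term with ω(β, γ)δ, the sp(2n) part the
other two. On 𝔤_{-1} only the former changes sign, since the torus acts there with the opposite
weight. -/
theorem osp_triple_up (β γ δ : Fin n ⊕ Fin n → ℂ) :
    (osp n).bracket ((osp n).bracket (ospUp n β) (ospDown n γ)) (ospUp n δ) =
      ospUp n (sympForm n β γ • δ - sympForm n δ β • γ - sympForm n δ γ • β) := by
  have h : ∀ x : ospSpace n, ((osp n).bracket ((osp n).bracket (ospUp n β) (ospDown n γ)) x).1 =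
      superBracket ((osp n).bracket (ospUp n β) (ospDown n γ)).1 x.1 := fun _ => rfl
  refine osp_ext ?_ ?_ ?_
  · rw [h, ospUp_ospDown_val, ospUp_val, ospUp_val, superBracket_fromBlocks]
    simp
  · rw [sub_sub, ← vecMul_vecMulVec_sympJ, h, ospUp_ospDown_val, ospUp_val, ospUp_val,
      superBracket_fromBlocks]
    simp only [toBlocks_fromBlocks₁₂, Matrix.zero_mul, Matrix.mul_zero, add_zero, sub_zero]
    ext i j
    fin_cases i <;> simp [Matrix.sub_apply, vecMul, dotProduct]
  · rw [h, ospUp_ospDown_val, ospUp_val, ospUp_val, superBracket_fromBlocks]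
    simp

theorem osp_triple_down (β γ δ : Fin n ⊕ Fin n → ℂ) :
    (osp n).bracket ((osp n).bracket (ospUp n β) (ospDown n γ)) (ospDown n δ) =
      ospDown n (-(sympForm n β γ • δ) - sympForm n δ β • γ - sympForm n δ γ • β) := by
  have h : ∀ x : ospSpace n, ((osp n).bracket ((osp n).bracket (ospUp n β) (ospDown n γ)) x).1 =
      superBracket ((osp n).bracket (ospUp n β) (ospDown n γ)).1 x.1 := fun _ => rfl
  refine osp_ext ?_ ?_ ?_
  · rw [h, ospUp_ospDown_val, ospDown_val, ospDown_val, superBracket_fromBlocks]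
    simp
  · rw [sub_sub, ← vecMul_vecMulVec_sympJ, h, ospUp_ospDown_val, ospDown_val, ospDown_val,
      superBracket_fromBlocks]
    simp only [toBlocks_fromBlocks₁₂, Matrix.zero_mul, Matrix.mul_zero, add_zero, sub_zero]
    ext i j
    fin_cases i <;> simp [Matrix.sub_apply, vecMul, dotProduct]
  · rw [h, ospUp_ospDown_val, ospDown_val, ospDown_val, superBracket_fromBlocks]
    simp

/-- The element `diag(0, J (S + Sᵗ))` of `sp(2n) ⊆ osp(2,2n)`. -/
def ospSymm (n : ℕ) : Matrix (Fin n ⊕ Fin n) (Fin n ⊕ Fin n) ℂ →ₗ[ℂ] ospSpace n where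
  toFun S := ⟨fromBlocks 0 0 0 (sympJ n * (S + Sᵀ)), fromBlocks_mem_ospSpace.2
    ⟨by simp, by
      rw [transpose_mul, ← Matrix.mul_assoc, sympJ_mul_self, sympJ_transpose, transpose_add,
        transpose_transpose, add_comm Sᵀ, Matrix.mul_neg, Matrix.neg_mul, Matrix.neg_mul,
        Matrix.one_mul], by simp⟩⟩
  map_add' S T := osp_ext (by simp [fromBlocks_add]) (by simp [fromBlocks_add])
    (by simp [fromBlocks_add, Matrix.mul_add]; abel)
  map_smul' c S := osp_ext (by simp [fromBlocks_smul]) (by simp [fromBlocks_smul])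
    (by simp [fromBlocks_smul, Matrix.mul_add])

theorem ospSymm_val (S : Matrix (Fin n ⊕ Fin n) (Fin n ⊕ Fin n) ℂ) :
    (ospSymm n S).1 = fromBlocks 0 0 0 (sympJ n * (S + Sᵀ)) := rfl

theorem sympForm_self (x : Fin n ⊕ Fin n → ℂ) : sympForm n x x = 0 :=
  self_eq_neg.1 (sympForm_skew x x)

/-- As ω(β, β) = 0, this bracket has no so(2) component. Polarizing the squares β⊗β will yield all
of sp(2n). -/
theorem ospSymm_vecMulVec_self (β : Fin n ⊕ Fin n → ℂ) :
    ospSymm n (vecMulVec β β) = (osp n).bracket (ospUp n β) (ospDown n β) := by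
  refine Subtype.ext ?_
  rw [ospUp_ospDown_val, ospSymm_val, sympForm_self, transpose_vecMulVec, Matrix.mul_add,
    mul_vecMulVec]
  congr 1
  ext i j
  fin_cases i <;> fin_cases j <;> simp

/-- `osp(2,2n)` is spanned by `𝔤_1`, `𝔤_{-1}` and `[𝔤_1, 𝔤_{-1}]`. -/
theorem osp_generated (hn : 1 ≤ n) (N : Submodule ℂ (ospSpace n)) (h₁ : (osp n).deg 1 ≤ N)
    (h₂ : (osp n).deg (-1) ≤ N)
    (h₃ : ∀ x ∈ (osp n).deg 1, ∀ y ∈ (osp n).deg (-1), (osp n).bracket x y ∈ N) : N = ⊤ := by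
  have hB : ∀ β γ, (osp n).bracket (ospUp n β) (ospDown n γ) ∈ N := fun β γ =>
    h₃ _ (ospUp_mem_deg β) _ (ospDown_mem_deg γ)
  have hsymm : ∀ S, ospSymm n S ∈ N := by
    refine mem_of_forall_vecMulVec_mem (ospSymm n) N fun u v => ?_
    have hself : ∀ w, ospSymm n (vecMulVec w w) ∈ N := fun w => ospSymm_vecMulVec_self w ▸ hB w w
    have hT : ospSymm n (vecMulVec v u) = ospSymm n (vecMulVec u v) := by
      refine Subtype.ext ?_
      rw [ospSymm_val, ospSymm_val, transpose_vecMulVec, transpose_vecMulVec, add_comm]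
    have h := sub_mem (sub_mem (hself (u + v)) (hself u)) (hself v)
    rw [add_vecMulVec, vecMulVec_add, vecMulVec_add, map_add, map_add, map_add, hT] at h
    have h2 := N.smul_mem (1 / 2 : ℂ) h
    convert h2 using 1
    module
  rw [eq_top_iff]
  intro x _
  obtain ⟨a, ha⟩ : ∃ i : Fin n, i.val = 0 := ⟨⟨0, hn⟩, rfl⟩
  -- A pair with ω(e, f) = 1, whose bracket supplies the missing so(2) direction.
  let e : Fin n ⊕ Fin n → ℂ := Pi.single (Sum.inl a) 1
  let f : Fin n ⊕ Fin n → ℂ := Pi.single (Sum.inr a) 1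
  have hef : sympForm n e f = 1 := by
    simp [sympForm_apply, e, f, sympJ]
  have hx := x.2
  rw [← fromBlocks_toBlocks x.1, fromBlocks_mem_ospSpace] at hx
  have hq : ∀ i j : Fin 2, (symQ * x.1.toBlocks₁₁ * symQ) i j =
      x.1.toBlocks₁₁ (1 - i) (1 - j) := by
    intro i j
    simp only [Matrix.mul_apply, Fin.sum_univ_two]
    fin_cases i <;> fin_cases j <;> simp [symQ]
  have hq' : ∀ i j : Fin 2, x.1.toBlocks₁₁ j i = -x.1.toBlocks₁₁ (1 - i) (1 - j) := by
    intro i j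
    rw [← hq]
    exact congrFun (congrFun hx.1 i) j
  set t : ℂ := x.1.toBlocks₁₁ 0 0 with ht
  -- What remains of the sp(2n) component after subtracting t[e, f]. Since JD is symmetric, it is
  -- recovered as J(S + Sᵗ) with S = -JD/2.
  let D := x.1.toBlocks₂₂ - t • (vecMulVec (sympJ n *ᵥ e) f + vecMulVec (sympJ n *ᵥ f) e)
  have hB2 := ((osp n).bracket (ospUp n e) (ospDown n f)).2
  rw [ospUp_ospDown_val, fromBlocks_mem_ospSpace] at hB2
  have hD : Dᵀ = sympJ n * D * sympJ n := by
    simp only [D, transpose_sub, transpose_smul, hx.2.1, hB2.2.1, Matrix.mul_sub, Matrix.sub_mul,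
      Matrix.mul_smul, Matrix.smul_mul]
  have hJD : sympJ n * (sympJ n * D) = -D := by
    rw [← Matrix.mul_assoc, sympJ_mul_self, Matrix.neg_mul, Matrix.one_mul]
  have hsum : x = ospUp n (x.1.toBlocks₁₂ 0) + ospDown n (x.1.toBlocks₁₂ 1) +
      t • (osp n).bracket (ospUp n e) (ospDown n f) +
        ospSymm n (-(1 / 2 : ℂ) • (sympJ n * D)) := by
    have hval : ∀ y z w v : ospSpace n, (y + z + t • w + v).1 = y.1 + z.1 + t • w.1 + v.1 :=
      fun _ _ _ _ => rfl
    refine osp_ext ?_ ?_ ?_ <;>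
    rw [hval, ospUp_val, ospDown_val, ospUp_ospDown_val, ospSymm_val, hef, fromBlocks_smul,
      fromBlocks_add, fromBlocks_add, fromBlocks_add]
    · have h01 := self_eq_neg.1 (hq' 1 0)
      have h10 := self_eq_neg.1 (hq' 0 1)
      have h11 := hq' 1 1
      ext i j
      fin_cases i <;> fin_cases j
      · simp [← ht]
      · simpa using h01
      · simpa using h10
      · simpa using h11
    · ext i j
      fin_cases i <;> simp
    · rw [toBlocks_fromBlocks₂₂, transpose_smul, transpose_mul, hD, sympJ_transpose,
        Matrix.mul_neg, Matrix.mul_assoc (sympJ n * D), sympJ_mul_self, Matrix.mul_add,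
        Matrix.mul_smul, Matrix.mul_smul, hJD]
      simp only [Matrix.mul_neg, Matrix.mul_one, neg_neg, hJD, D]
      module
  rw [hsum]
  exact add_mem (add_mem (add_mem (h₁ (ospUp_mem_deg _)) (h₂ (ospDown_mem_deg _)))
    (N.smul_mem _ (hB _ _))) (hsymm _)

end ospStructure

end

/-! ### The listed conjugations of osp(2,2n) and their action on 𝔤_1. -/

section

open Matrix GradedLieSuperalgebra

section ospConjugations

variable {n : ℕ}

theorem GL_inv_eq_of_mul_eq_one {ι : Type*} [Fintype ι] [DecidableEq ι] {A : GL ι ℂ}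
    {M : Matrix ι ι ℂ} (h : A.1 * M = 1) : A.2 = M := by
  rw [← Matrix.mul_one A.2, ← h, GL_inv_mul_mul]

theorem torusMatrix_inv (α : ℂˣ) : torusMatrix α⁻¹ = (torusMatrix α)⁻¹ := by
  refine Units.ext ?_
  show !![((α⁻¹ : ℂˣ) : ℂ), 0; 0, ((α⁻¹⁻¹ : ℂˣ) : ℂ)] = !![((α⁻¹ : ℂˣ) : ℂ), 0; 0, α]
  rw [inv_inv]

theorem sympToGL_inv (B : symplecticGroup (Fin n) ℂ) : sympToGL B⁻¹ = (sympToGL B)⁻¹ := by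
  simp [sympToGL]

theorem torusMatrix_mem_weightSpace (α : ℂˣ) :
    (torusMatrix α).1 ∈ weightSpace (ospWeight n ∘ Sum.inl) 0 := by
  intro i j h
  fin_cases i <;> fin_cases j <;> simp [torusMatrix, ospWeight] at h ⊢

theorem matrixAd_mem_ospWeight (α : ℂˣ) (B : symplecticGroup (Fin n) ℂ) {j : ℤ}
    {X : Matrix (Fin 2 ⊕ (Fin n ⊕ Fin n)) (Fin 2 ⊕ (Fin n ⊕ Fin n)) ℂ}
    (hX : X ∈ weightSpace (ospWeight n) j) :
    matrixAd (blockDiag (torusMatrix α) (sympToGL B)) X ∈ weightSpace (ospWeight n) j := by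
  have h := torusMatrix_mem_weightSpace (n := n) α⁻¹
  rw [torusMatrix_inv] at h
  exact matrixAd_mem_weightSpace
    (fromBlocks_mem_weightSpace_zero (torusMatrix_mem_weightSpace α)
      (mem_weightSpace_const (by simp [ospWeight]) _))
    (fromBlocks_mem_weightSpace_zero h (mem_weightSpace_const (by simp [ospWeight]) _)) hX

/-- The common ε covers both families: A and B Hermitian (ε = 1) or anti-Hermitian (ε = -1). In
either case (Ad diag(A, B) σ̃₁)² is the parity operator. -/
theorem osp_ad_sigma_conjugation {α : ℂˣ} {B : symplecticGroup (Fin n) ℂ} {ε : ℂ}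
    (hε : ε * ε = 1) (hA : (torusMatrix α).1ᴴ = ε • (torusMatrix α).1)
    (hB : (sympToGL B).1ᴴ = ε • (sympToGL B).1) :
    (osp n).IsAntilinearGradedConjugation ((ospAd α B).comp (ospSigma n)) := by
  refine .of_mapsTo (fun x y => Subtype.ext ?_) (fun i x hx => ?_) (fun j x hx => ?_)
    (fun k x hx => Subtype.ext ?_)
  · show matrixAd _ (sigmaTilde (superBracket x.1 y.1)) =
      superBracket (matrixAd _ (sigmaTilde x.1)) (matrixAd _ (sigmaTilde y.1))
    rw [sigmaTilde_superBracket, matrixAd_superBracket]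
  · refine matrixAd_blockDiag_mem_part _ _ ?_
    have := sigmaTilde_mem_weightSpace (X := x.1) (w := parity) (a := i) hx
    rwa [ZMod.neg_eq_self_mod_two] at this
  · exact matrixAd_mem_ospWeight _ _ (sigmaTilde_mem_weightSpace (X := x.1) hx)
  · refine (matrixAd_sigmaTilde_sq hε hA hB x.1).trans (evenPart_sub_oddPart_of_mem ?_)
    exact (osp n).deg_le_part k hx

theorem osp_herm_conjugation {α : ℂˣ} (hα : α = 1 ∨ α = -1) (p : ℕ) :
    (osp n).IsAntilinearGradedConjugation ((ospAd α (hermH n p)).comp (ospSigma n)) := by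
  refine osp_ad_sigma_conjugation (ε := 1) (by simp) ?_ ?_
  · rcases hα with rfl | rfl
    · simp [torusMatrix_one]
    · simp [torusMatrix_neg, torusMatrix_one]
  · show (fromBlocks (signMatrix n p).1 0 0 (signMatrix n p).1)ᴴ =
      (1 : ℂ) • fromBlocks (signMatrix n p).1 0 0 (signMatrix n p).1
    rw [fromBlocks_conjTranspose, signMatrix_conjTranspose]
    simp

theorem osp_antiHerm_conjugation {α : ℂˣ} (hα : α = unitI ∨ α = -unitI) :
    (osp n).IsAntilinearGradedConjugation ((ospAd α (antiHermH n)).comp (ospSigma n)) := by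
  have hI : (torusMatrix unitI).1ᴴ = (-1 : ℂ) • (torusMatrix unitI).1 := by
    rw [torusMatrix_unitI]
    ext i j
    fin_cases i <;> fin_cases j <;> simp
  refine osp_ad_sigma_conjugation (ε := -1) (by simp) ?_ ?_
  · rcases hα with rfl | rfl
    · exact hI
    · rw [torusMatrix_neg, conjTranspose_neg, hI, smul_neg]
  · show (Complex.I • fromBlocks (1 : Matrix (Fin n) (Fin n) ℂ) 0 0 (-1))ᴴ =
      (-1 : ℂ) • Complex.I • fromBlocks (1 : Matrix (Fin n) (Fin n) ℂ) 0 0 (-1)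
    rw [conjTranspose_smul, fromBlocks_conjTranspose]
    simp

theorem ospAd_ospUp (α : ℂˣ) (B : symplecticGroup (Fin n) ℂ) (β : Fin n ⊕ Fin n → ℂ) :
    ospAd α B (ospUp n β) = ospUp n ((α : ℂ) • (β ᵥ* (sympToGL B).2)) := by
  have h : ∀ x : ospSpace n, (ospAd α B x).1 =
      matrixAd (blockDiag (torusMatrix α) (sympToGL B)) x.1 := fun _ => rfl
  refine osp_ext ?_ ?_ ?_ <;> rw [h, ospUp_val, ospUp_val, matrixAd_blockDiag]
  · simp
  · simp only [toBlocks_fromBlocks₁₂, torusMatrix]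
    ext i j
    fin_cases i <;> simp [smul_vecMul]
  · simp

theorem ospAd_ospDown (α : ℂˣ) (B : symplecticGroup (Fin n) ℂ) (γ : Fin n ⊕ Fin n → ℂ) :
    ospAd α B (ospDown n γ) = ospDown n (((α⁻¹ : ℂˣ) : ℂ) • (γ ᵥ* (sympToGL B).2)) := by
  have h : ∀ x : ospSpace n, (ospAd α B x).1 =
      matrixAd (blockDiag (torusMatrix α) (sympToGL B)) x.1 := fun _ => rfl
  refine osp_ext ?_ ?_ ?_ <;> rw [h, ospDown_val, ospDown_val, matrixAd_blockDiag]
  · simp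
  · simp only [toBlocks_fromBlocks₁₂, torusMatrix]
    ext i j
    fin_cases i <;> simp [smul_vecMul]
  · simp

theorem ospSigma_ospUp (β : Fin n ⊕ Fin n → ℂ) :
    ospSigma n (ospUp n β) = ospDown n (star (sympJ n *ᵥ β)) := by
  have h : ∀ x : ospSpace n, (ospSigma n x).1 = sigmaTilde x.1 := fun _ => rfl
  refine osp_ext ?_ ?_ ?_ <;> rw [h, ospUp_val, ospDown_val, sigmaTilde_fromBlocks]
  · simp
  · simp only [toBlocks_fromBlocks₁₂]
    ext i j
    fin_cases i <;> simp
  · simp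

theorem ospAd_inv_ospAd (α : ℂˣ) (B : symplecticGroup (Fin n) ℂ) (x : ospSpace n) :
    ospAd α⁻¹ B⁻¹ (ospAd α B x) = x := by
  refine Subtype.ext ?_
  show matrixAd (blockDiag (torusMatrix α⁻¹) (sympToGL B⁻¹))
    (matrixAd (blockDiag (torusMatrix α) (sympToGL B)) x.1) = x.1
  rw [torusMatrix_inv, sympToGL_inv, blockDiag_inv, matrixAd_inv_matrixAd]

/-- `Ad diag(diag(α, α⁻¹), B)` as an equivalence. -/
def ospAdEquiv (α : ℂˣ) (B : symplecticGroup (Fin n) ℂ) : ospSpace n ≃ₗ[ℂ] ospSpace n :=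
  LinearEquiv.ofLinearMap (ospAd α B) (ospAd α⁻¹ B⁻¹)
    (LinearMap.ext fun x => by
      have := ospAd_inv_ospAd α⁻¹ B⁻¹ x
      rwa [inv_inv, inv_inv] at this)
    (LinearMap.ext fun x => ospAd_inv_ospAd α B x)

theorem ospAdEquiv_isGradedAutomorphism (α : ℂˣ) (B : symplecticGroup (Fin n) ℂ) :
    (osp n).IsGradedAutomorphism (ospAdEquiv α B) := by
  refine .of_mapsTo (fun x y => Subtype.ext ?_) (fun i x hx => ?_) (fun i x hx => ?_)
    (fun j x hx => ?_) (fun j x hx => ?_)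
  · exact matrixAd_superBracket _ _ x.1 y.1
  · exact matrixAd_blockDiag_mem_part _ _ (X := x.1) hx
  · exact matrixAd_blockDiag_mem_part _ _ (X := x.1) hx
  · exact matrixAd_mem_ospWeight _ _ (X := x.1) hx
  · exact matrixAd_mem_ospWeight _ _ (X := x.1) hx

/-- The anti-linear map of `ℂ^{2n}` describing the listed conjugations on `𝔤_1`. -/
def modelMap (ε : ℂ) (s : Fin n → ℂ) (δ : Fin n ⊕ Fin n → ℂ) : Fin n ⊕ Fin n → ℂ :=
  Sum.elim (fun a => s a * star (δ (Sum.inr a))) (fun a => ε * s a * star (δ (Sum.inl a)))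

theorem sympJ_mulVec (δ : Fin n ⊕ Fin n → ℂ) :
    sympJ n *ᵥ δ = Sum.elim (fun a => δ (Sum.inr a)) (fun a => -δ (Sum.inl a)) := by
  rw [sympJ, fromBlocks_mulVec]
  simp [Function.comp_def, neg_mulVec]
  rfl

/-- The Hermitian family realizes the model with j² = -1, the sign coming from J in σ̃₁ on 𝔤_1. -/
theorem ospAd_hermH_sigma (p : ℕ) (δ : Fin n ⊕ Fin n → ℂ) :
    (ospAd 1 (hermH n p)).comp (ospSigma n) (ospUp n δ) =
      ospDown n (modelMap (-1) (fun a => if a.val < p then 1 else -1) δ) := by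
  have hinv : (sympToGL (hermH n p)).2 =
      diagonal (Sum.elim (fun a => if a.val < p then 1 else -1)
        (fun a => if a.val < p then 1 else -1)) := by
    refine GL_inv_eq_of_mul_eq_one ?_
    show fromBlocks (signMatrix n p).1 0 0 (signMatrix n p).1 * _ = _
    rw [← fromBlocks_diagonal, fromBlocks_multiply]
    have h : (signMatrix n p).1 * (signMatrix n p).1 = 1 := (signMatrix n p).3
    have h' : (signMatrix n p).1 * (diagonal fun a => if a.val < p then 1 else -1) = 1 := h
    simp [h']
  rw [LinearMap.comp_apply, ospSigma_ospUp, ospAd_ospDown, hinv, sympJ_mulVec]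
  congr 1
  ext (a | a) <;> by_cases h : a.val < p <;> simp [modelMap, vecMul_diagonal, h]

theorem ospAd_antiHermH_sigma (δ : Fin n ⊕ Fin n → ℂ) :
    (ospAd (-unitI) (antiHermH n)).comp (ospSigma n) (ospUp n δ) =
      ospDown n (modelMap 1 (fun _ => 1) δ) := by
  have hinv : (sympToGL (antiHermH n)).2 =
      diagonal (Sum.elim (fun _ => -Complex.I) (fun _ => Complex.I)) := by
    refine GL_inv_eq_of_mul_eq_one ?_
    show Complex.I • fromBlocks (1 : Matrix (Fin n) (Fin n) ℂ) 0 0 (-1) * _ = _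
    rw [← fromBlocks_diagonal, smul_mul_assoc, fromBlocks_multiply, fromBlocks_smul, ← fromBlocks_one]
    congr 1
    · ext i j
      by_cases h : i = j <;> simp [h, Matrix.one_apply]
    · simp
    · simp
    · ext i j
      by_cases h : i = j <;> simp [h, Matrix.one_apply]
  rw [LinearMap.comp_apply, ospSigma_ospUp, ospAd_ospDown, hinv, sympJ_mulVec]
  congr 1
  -- The choice α = -i makes the factor α⁻¹ = i cancel the entries ∓i, so that all signs of the
  -- model are +1.
  have hI : (((-unitI)⁻¹ : ℂˣ) : ℂ) = Complex.I := by simp [unitI, inv_neg]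
  rw [hI]
  ext (a | a) <;> simp [modelMap, vecMul_diagonal]
  · linear_combination -(starRingEnd ℂ) (δ (Sum.inr a)) * Complex.I_mul_I
  · linear_combination -(starRingEnd ℂ) (δ (Sum.inl a)) * Complex.I_mul_I

end ospConjugations

end

/-! ### Classification for osp(2,2n). -/

section

open Matrix GradedLieSuperalgebra

section ospClassification

variable {n : ℕ}

/-- The rows `s_a j(x_a)` and `x_a` obtained from an adapted Darboux system form a symplectic
matrix. -/
theorem exists_symplectic_rows {j : (Fin n ⊕ Fin n → ℂ) →ₛₗ[starRingEnd ℂ] (Fin n ⊕ Fin n → ℂ)}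
    {ε : ℂ} (hωj : ∀ x y, sympForm n (j x) (j y) = -ε * star (sympForm n x y))
    {x : Fin n → Fin n ⊕ Fin n → ℂ} {s : Fin n → ℂ} (hs : ∀ a, s a = 1 ∨ s a = -1)
    (h0 : ∀ a b, sympForm n (x a) (x b) = 0)
    (h1 : ∀ a b, sympForm n (j (x a)) (x b) = if a = b then s a else 0) :
    ∃ B : symplecticGroup (Fin n) ℂ, B.1 = of (Sum.elim (fun a => s a • j (x a)) x) := by
  refine ⟨⟨of (Sum.elim (fun a => s a • j (x a)) x), ?_⟩, rfl⟩
  have hJ : Matrix.J (Fin n) ℂ = -sympJ n := by simp [Matrix.J, sympJ, fromBlocks_neg]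
  rw [SymplecticGroup.mem_iff, hJ, Matrix.mul_neg, Matrix.neg_mul, neg_inj]
  set C : Matrix (Fin n ⊕ Fin n) (Fin n ⊕ Fin n) ℂ := of (Sum.elim (fun a => s a • j (x a)) x)
  have hent : ∀ k l, (C * sympJ n * Cᵀ) k l = sympForm n (C k) (C l) := by
    intro k l
    rw [Matrix.mul_assoc]
    rfl
  have hss : ∀ a, s a * s a = 1 := fun a => by rcases hs a with h | h <;> simp [h]
  have hl : ∀ a, C (Sum.inl a) = s a • j (x a) := fun _ => rfl
  have hr : ∀ a, C (Sum.inr a) = x a := fun _ => rfl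
  have h01 : ∀ a b, sympForm n (C (Sum.inl a)) (C (Sum.inr b)) = if a = b then 1 else 0 := by
    intro a b
    rw [hl, hr, map_smul, LinearMap.smul_apply, h1]
    split_ifs <;> simp [hss]
  ext (a | a) (b | b) <;> rw [hent]
  · rw [hl, hl, map_smul, map_smul, LinearMap.smul_apply, hωj, h0]
    simp [sympJ]
  · rw [h01]
    simp [sympJ, Matrix.one_apply]
  · rw [sympForm_skew, h01]
    simp [sympJ, Matrix.one_apply, eq_comm]
  · rw [hr, hr, h0]
    simp [sympJ]

/-- A conjugation given on `𝔤_1` by a multiple of `j` is equivalent to the model conjugation whose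
signs are those of an adapted Darboux system of `j`. -/
theorem osp_equivalent_model (hn : 1 ≤ n) {σ τ : ospSpace n →ₛₗ[starRingEnd ℂ] ospSpace n}
    (hσ : (osp n).IsAntilinearGradedConjugation σ) (hτ : (osp n).IsAntilinearGradedConjugation τ)
    {j : (Fin n ⊕ Fin n → ℂ) →ₛₗ[starRingEnd ℂ] (Fin n ⊕ Fin n → ℂ)} {ε : ℂ}
    (hjj : ∀ x, j (j x) = ε • x)
    (hωj : ∀ x y, sympForm n (j x) (j y) = -ε * star (sympForm n x y))
    {u : ℂˣ} (hu : star (u : ℂ) = u) (hσj : ∀ β, σ (ospUp n β) = ospDown n ((u * u : ℂ) • j β))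
    {x : Fin n → Fin n ⊕ Fin n → ℂ} {s : Fin n → ℂ} (hs : ∀ a, s a = 1 ∨ s a = -1)
    (h0 : ∀ a b, sympForm n (x a) (x b) = 0)
    (h1 : ∀ a b, sympForm n (j (x a)) (x b) = if a = b then s a else 0)
    (hτs : ∀ δ, τ (ospUp n δ) = ospDown n (modelMap ε s δ)) : (osp n).Equivalent σ τ := by
  obtain ⟨B, hB⟩ := exists_symplectic_rows hωj hs h0 h1
  have hss : ∀ a, s a * s a = 1 := fun a => by rcases hs a with h | h <;> simp [h]
  have hsc : ∀ a, star (s a) = s a := fun a => by rcases hs a with h | h <;> simp [h]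
  have hrow : ∀ δ : Fin n ⊕ Fin n → ℂ, δ ᵥ* (sympToGL B).1 =
      ∑ a, δ (Sum.inl a) • s a • j (x a) + ∑ a, δ (Sum.inr a) • x a := by
    intro δ
    have : (sympToGL B).1 = of (Sum.elim (fun a => s a • j (x a)) x) := hB
    rw [this, vecMul_eq_sum, Fintype.sum_sum_type]
    rfl
  -- In the basis given by the rows of B, the map j exchanges the two halves with the prescribed
  -- signs, so B intertwines the model map with j.
  have hj : ∀ δ, j (δ ᵥ* (sympToGL B).1) = modelMap ε s δ ᵥ* (sympToGL B).1 := by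
    intro δ
    rw [hrow, hrow, map_add, map_sum, map_sum, add_comm]
    congr 1 <;> refine Finset.sum_congr rfl fun a _ => ?_
    · rw [map_smulₛₗ, modelMap, Sum.elim_inl, smul_smul]
      congr 1
      rw [Complex.star_def]
      linear_combination -(starRingEnd ℂ) (δ (Sum.inr a)) * hss a
    · rw [map_smulₛₗ, map_smulₛₗ, hjj, modelMap, Sum.elim_inr, smul_smul, smul_smul]
      congr 1
      have := hsc a
      rw [Complex.star_def] at this ⊢
      rw [this]
      ring
  -- Ad scales 𝔤_1 by u and 𝔤_{-1} by u⁻¹, so for real u it absorbs exactly the factor u·u in σ.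
  refine hσ.equivalent_of_eqOn hτ (osp_generated hn) (ospAdEquiv_isGradedAutomorphism u B)
    fun z hz => ?_
  obtain ⟨β, rfl⟩ := exists_ospUp hz
  show τ (ospAd u B (ospUp n β)) = ospAd u B (σ (ospUp n β))
  set δ := β ᵥ* (sympToGL B).2 with hδ
  have hβ : β = δ ᵥ* (sympToGL B).1 := by
    rw [hδ, vecMul_vecMul, (sympToGL B).4, vecMul_one]
  have hm : j β ᵥ* (sympToGL B).2 = modelMap ε s δ := by
    rw [hβ, hj, vecMul_vecMul, (sympToGL B).3, vecMul_one]
  rw [ospAd_ospUp, ← hδ, map_smul, map_smulₛₗ, hτs, hσj, ospAd_ospDown, smul_vecMul, hm, smul_smul,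
    map_smul]
  congr 1
  rw [← Complex.star_def, hu, ← mul_assoc, Units.inv_mul, one_mul]

/-- An anti-linear graded conjugation of `osp(2,2n)` is given on `𝔤_1` by a positive multiple of an
anti-linear map `j` with `j² = ε = ±1` and `ω(jx, jy) = -ε conj ω(x, y)`. -/
theorem osp_conjugation_normal_form (hn : 1 ≤ n)
    {σ : ospSpace n →ₛₗ[starRingEnd ℂ] ospSpace n}
    (hσ : (osp n).IsAntilinearGradedConjugation σ) :
    ∃ (j : (Fin n ⊕ Fin n → ℂ) →ₛₗ[starRingEnd ℂ] (Fin n ⊕ Fin n → ℂ)) (ε : ℂ) (u : ℂˣ),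
      (ε = 1 ∨ ε = -1) ∧ star (u : ℂ) = u ∧ (∀ x, j (j x) = ε • x) ∧
      (∀ x y, sympForm n (j x) (j y) = -ε * star (sympForm n x y)) ∧
      ∀ β, σ (ospUp n β) = ospDown n ((u * u : ℂ) • j β) := by
  let j : (Fin n ⊕ Fin n → ℂ) →ₛₗ[starRingEnd ℂ] (Fin n ⊕ Fin n → ℂ) :=
    (ospLower n).comp (σ.comp (ospUp n))
  have hj : ∀ β, σ (ospUp n β) = ospDown n (j β) := by
    intro β
    obtain ⟨γ, hγ⟩ := exists_ospDown (hσ.mem_deg (ospUp_mem_deg β))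
    show _ = ospDown n (ospLower n (σ (ospUp n β)))
    rw [← hγ, ospLower_ospDown]
  have hj' : ∀ β, σ (ospDown n (j β)) = -ospUp n β := fun β => by
    rw [← hj, hσ.apply_apply_one (ospUp_mem_deg β)]
  have hbij : Function.Bijective j := by
    constructor
    · intro x y hxy
      refine ospUp_injective (hσ.bijective.1 ?_)
      rw [hj, hj, hxy]
    · intro y
      have hy := ospDown_mem_deg y
      rw [← hσ.map_deg 1] at hy
      obtain ⟨z, hz, hzy⟩ := hy
      obtain ⟨β, rfl⟩ := exists_ospUp hz
      exact ⟨β, ospDown_injective ((hj β).symm.trans hzy)⟩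
  have hne : ∃ x y, sympForm n x y ≠ 0 := by
    by_contra! h
    have h1 := sympForm_nondegenerate (n := n) (fun _ => 1) (h _)
    have h2 := congrFun h1 (Sum.inl ⟨0, hn⟩)
    simp at h2
  obtain ⟨μ, hμ, hjj, hωj⟩ := exists_sq_eq_smul_of_triple sympForm_skew hbij hne fun x d y => by
    have h := congrArg σ (osp_triple_up x (j d) y)
    rw [hσ.map_bracket, hσ.map_bracket, hj, hj, hj, hj', map_neg, map_neg, LinearMap.neg_apply,
      osp_bracket_down_up, osp_triple_down, ← map_neg] at h
    have h' := ospDown_injective h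
    simp only [map_sub, map_smulₛₗ] at h'
    simp only [Complex.star_def]
    rw [← h']
    module
  have hr : 0 < Real.sqrt (Real.sqrt |μ|) := Real.sqrt_pos.2 (Real.sqrt_pos.2 (abs_pos.2 hμ))
  -- A fourth root: replacing j by r⁻²j divides j² by r⁴ = |μ|, and the factor r² removed from j is
  -- the square required for u = r.
  set r := Real.sqrt (Real.sqrt |μ|) with hrdef
  have hr2 : r * r = Real.sqrt |μ| := Real.mul_self_sqrt (Real.sqrt_nonneg _)
  have hr4 : (r * r) * (r * r) = |μ| := by rw [hr2]; exact Real.mul_self_sqrt (abs_nonneg _)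
  let c : ℝ := (r * r)⁻¹
  have hcc : c * c = |μ|⁻¹ := by rw [← hr4, mul_inv]
  have hε : c * c * μ = 1 ∨ c * c * μ = -1 := by
    rw [hcc]
    rcases lt_or_gt_of_ne hμ with h | h
    · right
      rw [abs_of_neg h, inv_neg, neg_mul, inv_mul_cancel₀ hμ]
    · left
      rw [abs_of_pos h, inv_mul_cancel₀ hμ]
  have hr0 : (r : ℂ) ≠ 0 := Complex.ofReal_ne_zero.2 hr.ne'
  refine ⟨(c : ℂ) • j, ((c * c * μ : ℝ) : ℂ), Units.mk0 (r : ℂ) hr0, ?_, by simp, fun x => ?_,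
    fun x y => ?_, fun β => ?_⟩
  · rcases hε with h | h <;> simp [h]
  · simp only [LinearMap.smul_apply, map_smulₛₗ, hjj, Complex.conj_ofReal, smul_smul]
    push_cast
    rw [mul_assoc]
  · simp only [LinearMap.smul_apply, map_smul, hωj, smul_eq_mul]
    push_cast
    ring
  · rw [hj, LinearMap.smul_apply, smul_smul, Units.val_mk0]
    have : (r * r : ℂ) * (c : ℂ) = 1 := by
      rw [← Complex.ofReal_mul, ← Complex.ofReal_mul, mul_inv_cancel₀ (mul_self_ne_zero.2 hr.ne'),
        Complex.ofReal_one]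
    rw [this, one_smul]

/-- The classification of the anti-linear graded conjugations of `osp(2,2n)`. -/
theorem osp_isCompleteList (hn : 1 ≤ n) : (osp n).IsCompleteListOfConjugations
    ({σ | ∃ α : ℂˣ, (α = 1 ∨ α = -1) ∧ ∃ p ≤ n, σ = (ospAd α (hermH n p)).comp (ospSigma n)} ∪
      {σ | ∃ α : ℂˣ, (α = unitI ∨ α = -unitI) ∧
        σ = (ospAd α (antiHermH n)).comp (ospSigma n)}) := by
  constructor
  · rintro σ (⟨α, hα, p, -, rfl⟩ | ⟨α, hα, rfl⟩)
    · exact osp_herm_conjugation hα p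
    · exact osp_antiHerm_conjugation hα
  · intro σ hσ
    obtain ⟨j, ε, u, hε, hu, hjj, hωj, hσj⟩ := osp_conjugation_normal_form hn hσ
    obtain ⟨x, s, hs, hs1, h0, h1⟩ := exists_adapted_system sympForm_skew sympForm_nondegenerate
      hε hjj hωj n (by simp [two_mul])
    rcases hε with rfl | rfl
    · refine ⟨_, Or.inr ⟨-unitI, Or.inr rfl, rfl⟩, ?_⟩
      refine osp_equivalent_model hn hσ (osp_antiHerm_conjugation (Or.inr rfl)) hjj hωj hu hσj hs
        h0 h1 fun δ => ?_
      rw [ospAd_antiHermH_sigma, (funext (hs1 rfl) : s = fun _ => 1)]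
    -- For ε = -1 the signs cannot be changed, only sorted by reindexing the Darboux system; their
    -- number p of +1's selects H_p. One value of α suffices in each family.
    · obtain ⟨p, hp, e, he⟩ := exists_perm_iff_lt fun a => s a = 1
      refine ⟨_, Or.inl ⟨1, Or.inl rfl, p, hp, rfl⟩, ?_⟩
      refine osp_equivalent_model hn hσ (osp_herm_conjugation (Or.inl rfl) p) hjj hωj hu hσj
        (x := x ∘ e) (s := s ∘ e) (fun a => hs (e a)) (fun a b => h0 _ _) (fun a b => ?_)
        fun δ => ?_
      · simp [h1]
      · rw [ospAd_hermH_sigma]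
        congr 2
        ext a
        rw [Function.comp_apply]
        by_cases ha : s (e a) = 1
        · rw [if_pos ((he a).1 ha), ha]
        · rw [if_neg fun h => ha ((he a).2 h), (hs (e a)).resolve_left ha]

end ospClassification

end

theorem proposition3p7 :
    (∀ m n : ℕ, 1 ≤ m → 1 ≤ n → m ≠ n →
      (psl m n).IsCompleteListOfConjugations
        {σ | ∃ p ≤ m, ∃ q ≤ n,
          σ = (pslAd (signMatrix m p) (signMatrix n q)).comp (pslSigma m n)}) ∧
    (∀ n : ℕ, 1 ≤ n →
      (psl n n).IsCompleteListOfConjugations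
        ({σ | ∃ p ≤ n, ∃ q ≤ n,
            σ = (pslAd (signMatrix n p) (signMatrix n q)).comp (pslSigma n n)} ∪
          {pslTau n 1, pslTau n (-1)})) ∧
    (∀ n : ℕ, 1 ≤ n →
      (osp n).IsCompleteListOfConjugations
        ({σ | ∃ α : ℂˣ, (α = 1 ∨ α = -1) ∧ ∃ p ≤ n,
            σ = (ospAd α (hermH n p)).comp (ospSigma n)} ∪
          {σ | ∃ α : ℂˣ, (α = unitI ∨ α = -unitI) ∧
            σ = (ospAd α (antiHermH n)).comp (ospSigma n)})) := by
  exact ⟨fun m n hm hn hmn => psl_isCompleteList hm hn hmn, fun n hn => psl_self_isCompleteList hn,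
    fun n hn => osp_isCompleteList hn⟩
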